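/- Let $\mathbb K$ be a field and $\mathcal V$ a finite nonempty set. A $\mathcal V$-face algebra is a $\mathbb K$-algebra $\mathfrak H$ with a coalgebra structure $(\Delta,\varepsilon)$ and elements $e_i,\mathring e_i$ $(i\in\mathcal V)$ such that $\Delta(ab)=\Delta(a)\Delta(b)$, $e_ie_j=\delta_{ij}e_i$, $\mathring e_i\mathring e_j=\delta_{ij}\mathring e_i$, $e_i\mathring e_j=\mathring e_je_i$, $\sum_k e_k=1=\sum_k\mathring e_k$, $\Delta(\mathring e_ie_j)=\sum_k\mathring e_ie_k\otimes\mathring e_ke_j$, $\varepsilon(\mathring e_ie_j)=\delta_{ij}$ and $\varepsilon(ab)=\sum_k\varepsilon(ae_k)\varepsilon(\mathring e_kb)$. The dual $\mathfrak H^*$ is an algebra under convolution. A functional $\mathcal G\in\mathfrak H^*$ is group-like if $\mathcal G(ab)=\sum_k\mathcal G(ae_k)\mathcal G(\mathring e_kb)$, $\mathcal G(\mathring e_ia\mathring e_j)=\mathcal G(e_iae_j)$ and $\mathcal G(\mathring e_ie_j)=\delta_{ij}$ for all $a,b,i,j$; $\mathrm{GLF}(\mathfrak H)$ is the semigroup (monoid)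 of these functionals, and $\mathrm{GLF}(\mathfrak H)^\times$ is the group of those that are invertible in $\mathfrak H^*$. For elements of an algebra, $x^-$ is an $(e^+,e^-)$-generalized inverse of $x^+$ if $x^{\mp}x^{\pm}=e^{\pm}$ and $x^{\pm}x^{\mp}x^{\pm}=x^{\pm}$. A face algebra is coquasitriangular (CQT) if it is given $\mathcal R^+\in(\mathfrak H\otimes\mathfrak H)^*$ with an $(m^*(1),(m^{\mathrm{op}})^*(1))$-generalized inverse $\mathcal R^-$ such that $\mathcal R^+m^*(X)\mathcal R^-=(m^{\mathrm{op}})^*(X)$ for $X\in\mathfrak H^*$, $(m\otimes\mathrm{id})^*(\mathcal R^+)=\mathcal R^+_{13}\mathcal R^+_{23}$ and $(\mathrm{id}\otimes m)^*(\mathcal R^+)=\mathcal R^+_{13}\mathcal R^+_{12}$, where $m$ is the product and $Z_{ij}(a_1,a_2,a_3)=Z(a_i,a_j)\varepsilon(a_k)$ for $\{i,j,k\}=\{1,2,3\}$. It is closable (CCQT) if in $(\mathfrak H\otimes\mathfrak H^{\mathrm{cop}})^*$ the form $\mathcal R^+$ has an $(\mathcal F^+,\mathcal F^-)$-generalized inverse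 $\mathcal Q^-$ and $\mathcal R^-$ has an $(\mathcal F^-,\mathcal F^+)$-generalized inverse $\mathcal Q^+$, where $\mathcal F^+(a,b)=\sum_k\varepsilon(e_ka)\varepsilon(e_kb)$ and $\mathcal F^-(a,b)=\sum_k\varepsilon(ae_k)\varepsilon(be_k)$. The Hopf closure $\mathrm{Hc}(\mathfrak H)$ of a CCQT face algebra is the algebra generated by the algebra $\mathfrak H$ (via the canonical map $\iota$) and an anti-isomorphic copy $\sigma(\mathfrak H)$, subject to $\sigma(e_i)=\mathring e_i$, $\sigma(\mathring e_i)=e_i$, $$\sigma(b)\,c=\sum\mathcal R^-(b_{(1)},c_{(3)})\,\mathcal Q^+(b_{(3)},c_{(1)})\,c_{(2)}\,\sigma(b_{(2)}),$$ $$\sum\sigma(a_{(1)})a_{(2)}=\sum_k\varepsilon(ae_k)e_k,\qquad \sum a_{(1)}\sigma(a_{(2)})=\sum_k\varepsilon(e_ka)\mathring e_k ;$$ it is a $\mathcal V$-face algebra with the face idempotents of $\mathfrak H$, $\Delta(a\sigma(b))=\sum a_{(1)}\sigma(b_{(2)})\otimes a_{(2)}\sigma(b_{(1)})$ and $\varepsilon(a\sigma(b))=\sum_k\varepsilon(ae_k)\varepsilon(be_k)$.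 Let $\Gamma$ be a finite oriented graph with vertex set $\mathcal V$, and $\Gamma^m$ its set of paths of length $m$ (the paths of length $0$ are the vertices). $\mathfrak H(\Gamma)$ is the $\mathcal V$-face algebra with basis $e\binom{\mathbf p}{\mathbf q}$ ($\mathbf p,\mathbf q\in\Gamma^m$, $m\ge0$), $e\binom{\mathbf p}{\mathbf q}e\binom{\mathbf r}{\mathbf s}=e\binom{\mathbf p\cdot\mathbf r}{\mathbf q\cdot\mathbf s}$ if both concatenations exist and $0$ otherwise, $\Delta e\binom{\mathbf p}{\mathbf q}=\sum_{\mathbf t\in\Gamma^m}e\binom{\mathbf p}{\mathbf t}\otimes e\binom{\mathbf t}{\mathbf q}$, $\varepsilon(e\binom{\mathbf p}{\mathbf q})=\delta_{\mathbf p\mathbf q}$, $\mathring e_i=\sum_je\binom ij$, $e_j=\sum_ie\binom ij$. A face model $w$ assigns a scalar $w[\mathbf r,\mathbf p,\mathbf s,\mathbf q]$ to all edges $\mathbf r$ (left), $\mathbf p$ (top), $\mathbf s$ (bottom), $\mathbf q$ (right), which is $0$ unless $\mathbf p,\mathbf r$ have the same source, $\mathbf s,\mathbf q$ the same range, and $(\mathbf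 p,\mathbf q)$, $(\mathbf r,\mathbf s)$ are paths. It acts on $\mathbb K\Gamma^2$ by $w(\mathbf p,\mathbf q)=\sum_{(\mathbf r,\mathbf s)\in\Gamma^2}w[\mathbf r,\mathbf p,\mathbf s,\mathbf q](\mathbf r,\mathbf s)$, and $\mathfrak A(w)$ is the quotient face algebra of $\mathfrak H(\Gamma)$ by $$\sum_{(\mathbf c,\mathbf d)}w[\mathbf a,\mathbf c,\mathbf b,\mathbf d]\,e\tbinom{\mathbf c\cdot\mathbf d}{\mathbf p\cdot\mathbf q}=\sum_{(\mathbf r,\mathbf s)}w[\mathbf r,\mathbf p,\mathbf s,\mathbf q]\,e\tbinom{\mathbf a\cdot\mathbf b}{\mathbf r\cdot\mathbf s}\qquad((\mathbf a,\mathbf b),(\mathbf p,\mathbf q)\in\Gamma^2).$$ For $\mathfrak H=\mathfrak H(\Gamma)$ or $\mathfrak A(w)$ and $X\in\mathfrak H^*$ let $\pi(X)\in\mathrm{End}(\mathbb K\Gamma^1)$ be $\pi(X)\mathbf q=\sum_{\mathbf p\in\Gamma^1}X(e\binom{\mathbf p}{\mathbf q})\,\mathbf p$. Let $\mathfrak E\subset\mathfrak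 H^*$ be the subalgebra generated by the functionals $\varepsilon(\,\cdot\,e_i)$ and $\varepsilon(e_i\,\cdot\,)$, and let $\mathrm{End}_{\pi(\mathfrak E)}$, $\mathrm{Aut}_{\pi(\mathfrak E)}$ be the endomorphisms and automorphisms of $\mathbb K\Gamma^1$ that commute with $\pi(\mathfrak E)$. For such $G$, $G\bar\otimes G$ is the restriction of $G\otimes G$ to $\mathbb K\Gamma^2\subset\mathbb K\Gamma^1\otimes\mathbb K\Gamma^1$. Then: 1. For each CCQT $\mathcal V$-face algebra $\mathfrak H$, the map $\iota^*\colon X\mapsto X\circ\iota$ is a group isomorphism $\mathrm{GLF}(\mathrm{Hc}(\mathfrak H))\cong\mathrm{GLF}(\mathfrak H)^\times$, whose inverse $\mathcal G\mapsto\mathcal G_{\mathrm{Hc}}$ is given by $\mathcal G_{\mathrm{Hc}}(a\sigma(b))=\sum_k\mathcal G(ae_k)\,\mathcal G^{-1}(be_k)$. 2. For each finite oriented graph $\Gamma$ with vertex set $\mathcal V$ and each face model $w$ on $\Gamma$, the map $X\mapsto\pi(X)$ gives semigroup isomorphisms $\mathrm{GLF}(\mathfrak H(\Gamma))\cong\mathrm{End}_{\pi(\mathfrak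 E)}(\mathbb K\Gamma^1)$ and $$\mathrm{GLF}(\mathfrak A(w))\cong\{G\in\mathrm{End}_{\pi(\mathfrak E)}(\mathbb K\Gamma^1)\mid(G\bar\otimes G)w=w(G\bar\otimes G)\}.$$ 3. For each face model $w$ and each CCQT structure on $\mathfrak A(w)$ (in particular, for each closable star-triangular face model with the canonical braiding of $\mathfrak A(w)$), there is a group isomorphism $$\Phi\colon\{G\in\mathrm{Aut}_{\pi(\mathfrak E)}(\mathbb K\Gamma^1)\mid(G\bar\otimes G)w=w(G\bar\otimes G)\}\cong\mathrm{GLF}(\mathrm{Hc}(\mathfrak A(w)))$$ obtained by combining 1 and 2, that is, with $\pi(\iota^*(\Phi(G)))=G$ for all $G$. -/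

import Mathlib

open TensorProduct Coalgebra WithConv

set_option linter.unusedSectionVars false
set_option linter.unusedSimpArgs false
set_option linter.style.longLine false

namespace FaceAlg

noncomputable section

section Coalg


variable {K : Type*} [Field K] {C D : Type*} [AddCommGroup C] [Module K C] [Coalgebra K C]
  [AddCommGroup D] [Module K D] [Coalgebra K D]

/-- `a ↦ ∑ a₁ f(a₂)`. -/
def lact (f : WithConv (C →ₗ[K] K)) : C →ₗ[K] C :=
  (TensorProduct.rid K C).toLinearMap ∘ₗ LinearMap.lTensor C f.ofConv ∘ₗ comul

/-- `a ↦ ∑ f(a₁) a₂`. -/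
def ract (f : WithConv (C →ₗ[K] K)) : C →ₗ[K] C :=
  (TensorProduct.lid K C).toLinearMap ∘ₗ LinearMap.rTensor C f.ofConv ∘ₗ comul

theorem conv_apply' (f g : WithConv (C →ₗ[K] K)) (a : C) :
    (f * g) a = TensorProduct.lift (f.ofConv.smulRight g.ofConv) (comul a) := by
  rw [LinearMap.convMul_apply]
  generalize comul (R := K) a = z
  induction z with
  | zero => simp
  | tmul x y => simp
  | add x y hx hy => simp only [map_add, hx, hy]

theorem lact_one : lact (1 : WithConv (C →ₗ[K] K)) = LinearMap.id := by
  ext a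
  simp [lact, LinearMap.convOne_def]

theorem ract_one : ract (1 : WithConv (C →ₗ[K] K)) = LinearMap.id := by
  ext a
  simp [ract, LinearMap.convOne_def]

theorem comul_lact (f : WithConv (C →ₗ[K] K)) (a : C) :
    comul (lact f a) = LinearMap.lTensor C (lact f) (comul (R := K) a) := by
  have h := congrArg (fun z => (TensorProduct.rid K (C ⊗[K] C)).toLinearMap
    (LinearMap.lTensor (C ⊗[K] C) f.ofConv ((TensorProduct.assoc K C C C).symm z)))
    (Coalgebra.coassoc_apply (R := K) a)
  simp only [LinearEquiv.symm_apply_apply] at h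
  convert h using 1
  · simp only [lact, LinearMap.comp_apply]
    generalize comul (R := K) a = z
    induction z with
    | zero => simp
    | tmul x y => simp
    | add x y hx hy => simp only [map_add, hx, hy]
  · generalize comul (R := K) a = z
    induction z with
    | zero => simp
    | tmul x y =>
      simp only [lact, LinearMap.lTensor_tmul, LinearMap.comp_apply]
      generalize comul (R := K) y = z
      induction z with
      | zero => simp
      | tmul x y => simp
      | add x y hx hy => simp only [map_add, tmul_add, hx, hy]
    | add x y hx hy => simp only [map_add, hx, hy]

theorem comul_ract (f : WithConv (C →ₗ[K] K)) (a : C) :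
    comul (ract f a) = LinearMap.rTensor C (ract f) (comul (R := K) a) := by
  have h := congrArg (fun z => (TensorProduct.lid K (C ⊗[K] C)).toLinearMap
    (LinearMap.rTensor (C ⊗[K] C) f.ofConv z))
    (Coalgebra.coassoc_apply (R := K) a)
  beta_reduce at h
  symm
  convert h using 1
  · generalize comul (R := K) a = z
    induction z with
    | zero => simp
    | tmul x y =>
      simp only [ract, LinearMap.rTensor_tmul, LinearMap.comp_apply]
      generalize comul (R := K) x = z
      induction z with
      | zero => simp
      | tmul x y => simp [smul_tmul']
      | add x y hx hy => simp only [map_add, add_tmul, hx, hy]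
    | add x y hx hy => simp only [map_add, hx, hy]
  · simp only [ract, LinearMap.comp_apply]
    generalize comul (R := K) a = z
    induction z with
    | zero => simp
    | tmul x y => simp
    | add x y hx hy => simp only [map_add, hx, hy]

theorem lact_ract_mid (f : WithConv (C →ₗ[K] K)) (a : C) :
    LinearMap.rTensor C (lact f) (comul (R := K) a) =
      LinearMap.lTensor C (ract f) (comul (R := K) a) := by
  have h := congrArg (fun z => 
    (LinearMap.lTensor C ((TensorProduct.lid K C).toLinearMap ∘ₗ LinearMap.rTensor C f.ofConv) z))
    (Coalgebra.coassoc_apply (R := K) a)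
  beta_reduce at h
  convert h using 1
  · generalize comul (R := K) a = z
    induction z with
    | zero => simp
    | tmul x y =>
      simp only [lact, LinearMap.rTensor_tmul, LinearMap.comp_apply]
      generalize comul (R := K) x = z
      induction z with
      | zero => simp
      | tmul x y => simp [smul_tmul]
      | add x y hx hy => simp only [map_add, add_tmul, hx, hy]
    | add x y hx hy => simp only [map_add, hx, hy]
  · generalize comul (R := K) a = z
    induction z with
    | zero => simp
    | tmul x y => simp [ract]
    | add x y hx hy => simp only [map_add, hx, hy]

theorem apply_lact (f g : WithConv (C →ₗ[K] K)) (a : C) : f (lact g a) = (f * g) a := by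
  rw [conv_apply']
  simp only [lact, LinearMap.comp_apply]
  generalize comul (R := K) a = z
  induction z with
  | zero => simp
  | tmul x y => simp [mul_comm]
  | add x y hx hy => simp only [map_add, hx, hy]

theorem apply_ract (f g : WithConv (C →ₗ[K] K)) (a : C) : f (ract g a) = (g * f) a := by
  rw [conv_apply']
  simp only [ract, LinearMap.comp_apply]
  generalize comul (R := K) a = z
  induction z with
  | zero => simp
  | tmul x y => simp [mul_comm]
  | add x y hx hy => simp only [map_add, hx, hy]

theorem lact_mul (f g : WithConv (C →ₗ[K] K)) (a : C) : lact (f * g) a = lact f (lact g a) := by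
  conv_rhs => rw [lact]
  simp only [LinearMap.comp_apply]
  rw [comul_lact]
  simp only [lact, LinearMap.comp_apply]
  generalize comul (R := K) a = z
  induction z with
  | zero => simp
  | tmul x y =>
    have := apply_lact f g y
    simp only [lact, LinearMap.comp_apply] at this
    simp only [LinearMap.lTensor_tmul, LinearMap.comp_apply]
    rw [← this]
  | add x y hx hy => simp only [map_add, hx, hy]

theorem ract_mul (f g : WithConv (C →ₗ[K] K)) (a : C) : ract (f * g) a = ract g (ract f a) := by
  conv_rhs => rw [ract]
  simp only [LinearMap.comp_apply]
  rw [comul_ract]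
  simp only [ract, LinearMap.comp_apply]
  generalize comul (R := K) a = z
  induction z with
  | zero => simp
  | tmul x y =>
    have := apply_ract g f x
    simp only [ract, LinearMap.comp_apply] at this
    simp only [LinearMap.rTensor_tmul, LinearMap.comp_apply]
    rw [← this]
  | add x y hx hy => simp only [map_add, hx, hy]

theorem lact_ract_comm (f g : WithConv (C →ₗ[K] K)) (a : C) :
    lact f (ract g a) = ract g (lact f a) := by
  conv_lhs => rw [lact]
  conv_rhs => rw [lact]
  simp only [LinearMap.comp_apply]
  rw [comul_ract]
  generalize comul (R := K) a = z
  induction z with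
  | zero => simp
  | tmul x y => simp
  | add x y hx hy => simp only [map_add, hx, hy]

end Coalg

/-- A `V`-face algebra over the field `K`. -/
class FaceAlgebra (K V H : Type*) [Field K] [Fintype V] [DecidableEq V] [Ring H] [Algebra K H]
    [Coalgebra K H] where
  /-- the face idempotents `e i` -/
  e : V → H
  /-- the face idempotents `e° i` -/
  eo : V → H
  comul_mul : ∀ a b : H, comul (R := K) (a * b) = comul (R := K) a * comul (R := K) b
  e_mul_e : ∀ i j, e i * e j = if i = j then e i else 0
  eo_mul_eo : ∀ i j, eo i * eo j = if i = j then eo i else 0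
  e_mul_eo : ∀ i j, e i * eo j = eo j * e i
  sum_e : ∑ k, e k = 1
  sum_eo : ∑ k, eo k = 1
  comul_eo_mul_e : ∀ i j, comul (R := K) (eo i * e j) = ∑ k, (eo i * e k) ⊗ₜ[K] (eo k * e j)
  counit_eo_mul_e : ∀ i j, counit (R := K) (eo i * e j) = if i = j then 1 else 0
  counit_mul : ∀ a b : H,
    counit (R := K) (a * b) = ∑ k, counit (R := K) (a * e k) * counit (R := K) (eo k * b)

section Face

variable {K V H : Type*} [Field K] [Fintype V] [DecidableEq V] [Ring H] [Algebra K H]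
  [Coalgebra K H] [FaceAlgebra K V H]


open FaceAlgebra

theorem comul_e (j : V) : comul (R := K) (e K j : H) = ∑ k : V, e K k ⊗ₜ[K] (eo K k * e K j) := by
  conv_lhs => rw [← one_mul (e K j : H), ← sum_eo (K := K) (V := V) (H := H), Finset.sum_mul, map_sum]
  simp_rw [comul_eo_mul_e]
  rw [Finset.sum_comm]
  refine Finset.sum_congr rfl fun k _ => ?_
  rw [← sum_tmul, ← Finset.sum_mul, sum_eo, one_mul]

variable (K V H) in
theorem comul_one : comul (R := K) (1 : H) = ∑ k : V, e K k ⊗ₜ[K] eo K k := by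
  conv_lhs => rw [← sum_e (K := K) (V := V) (H := H), map_sum]
  simp_rw [comul_e]
  rw [Finset.sum_comm]
  refine Finset.sum_congr rfl fun k _ => ?_
  rw [← tmul_sum, ← Finset.mul_sum, sum_e, mul_one]

theorem comul_one_mul (V : Type*) [Fintype V] [DecidableEq V] [FaceAlgebra K V H] (a : H) : comul (R := K) (1 : H) * comul (R := K) a = comul (R := K) a := by
  rw [← comul_mul (V := V), one_mul]

theorem comul_mul_one (V : Type*) [Fintype V] [DecidableEq V] [FaceAlgebra K V H] (a : H) : comul (R := K) a * comul (R := K) (1 : H) = comul (R := K) a := by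
  rw [← comul_mul (V := V), mul_one]

theorem comul_e' (i : V) : comul (R := K) (e K i : H) = (1 ⊗ₜ[K] e K i) * comul (R := K) (1 : H) := by
  rw [comul_e, comul_one K V H, Finset.mul_sum]
  simp [e_mul_eo]

theorem comul_e'' (i : V) : comul (R := K) (e K i : H) = comul (R := K) (1 : H) * (1 ⊗ₜ[K] e K i) := by
  rw [comul_e, comul_one K V H, Finset.sum_mul]
  simp

theorem comul_eo' (i : V) : comul (R := K) (eo K i : H) = (eo K i ⊗ₜ[K] 1) * comul (R := K) (1 : H) := by
  conv_lhs => rw [← mul_one (eo K i : H), ← sum_e (K := K) (V := V) (H := H), Finset.mul_sum, map_sum]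
  simp_rw [comul_eo_mul_e]
  rw [Finset.sum_comm, comul_one K V H, Finset.mul_sum]
  refine Finset.sum_congr rfl fun k _ => ?_
  rw [← tmul_sum, ← Finset.mul_sum, sum_e, mul_one]
  simp

theorem comul_eo'' (i : V) : comul (R := K) (eo K i : H) = comul (R := K) (1 : H) * (eo K i ⊗ₜ[K] 1) := by
  rw [comul_eo', comul_one K V H, Finset.sum_mul, Finset.mul_sum]
  simp [e_mul_eo]

theorem comul_e_mul (i : V) (a : H) :
    comul (R := K) (e K i * a) = (1 ⊗ₜ[K] e K i) * comul (R := K) a := by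
  rw [comul_mul (V := V), comul_e', mul_assoc, comul_one_mul V]

theorem comul_mul_e (i : V) (a : H) :
    comul (R := K) (a * e K i) = comul (R := K) a * (1 ⊗ₜ[K] e K i) := by
  rw [comul_mul (V := V), comul_e'', ← mul_assoc, comul_mul_one V]

theorem comul_eo_mul (i : V) (a : H) :
    comul (R := K) (eo K i * a) = (eo K i ⊗ₜ[K] 1) * comul (R := K) a := by
  rw [comul_mul (V := V), comul_eo', mul_assoc, comul_one_mul V]

theorem comul_mul_eo (i : V) (a : H) :
    comul (R := K) (a * eo K i) = comul (R := K) a * (eo K i ⊗ₜ[K] 1) := by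
  rw [comul_mul (V := V), comul_eo'', ← mul_assoc, comul_mul_one V]

theorem e_comul_one (i : V) :
    (e K i ⊗ₜ[K] 1) * comul (R := K) (1 : H) = (1 ⊗ₜ[K] eo K i) * comul (R := K) (1 : H) := by
  rw [comul_one K V H, Finset.mul_sum, Finset.mul_sum]
  simp [e_mul_e, eo_mul_eo, ite_tmul, tmul_ite]

theorem comul_one_e (i : V) :
    comul (R := K) (1 : H) * (e K i ⊗ₜ[K] 1) = comul (R := K) (1 : H) * (1 ⊗ₜ[K] eo K i) := by
  rw [comul_one K V H, Finset.sum_mul, Finset.sum_mul]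
  simp [e_mul_e, eo_mul_eo, ite_tmul, tmul_ite]

theorem e_comul (i : V) (a : H) :
    (e K i ⊗ₜ[K] 1) * comul (R := K) a = (1 ⊗ₜ[K] eo K i) * comul (R := K) a := by
  rw [← comul_one_mul V a, ← mul_assoc, e_comul_one, mul_assoc]

theorem comul_e_right (i : V) (a : H) :
    comul (R := K) a * (e K i ⊗ₜ[K] 1) = comul (R := K) a * (1 ⊗ₜ[K] eo K i) := by
  rw [← comul_mul_one V a, mul_assoc, comul_one_e, mul_assoc]

theorem counit_e (i : V) : counit (R := K) (e K i : H) = 1 := by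
  rw [← one_mul (e K i : H), ← sum_eo (K := K) (V := V) (H := H), Finset.sum_mul, map_sum]
  simp [counit_eo_mul_e]

theorem counit_eo (i : V) : counit (R := K) (eo K i : H) = 1 := by
  rw [← mul_one (eo K i : H), ← sum_e (K := K) (V := V) (H := H), Finset.mul_sum, map_sum]
  simp [counit_eo_mul_e]

theorem counit_eo_mul (i : V) (a : H) :
    counit (R := K) (eo K i * a) = counit (R := K) (e K i * a) := by
  rw [counit_mul (V := V) (e K i) a]
  simp [e_mul_e, apply_ite (counit (R := K)), counit_e]

theorem counit_mul_eo (i : V) (a : H) :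
    counit (R := K) (a * eo K i) = counit (R := K) (a * e K i) := by
  rw [counit_mul (V := V) a (eo K i)]
  simp [eo_mul_eo, apply_ite (counit (R := K)), counit_eo]

theorem counit_mul' (V : Type*) [Fintype V] [DecidableEq V] [FaceAlgebra K V H] (a b : H) : counit (R := K) (a * b) =
    ∑ k : V, counit (R := K) (a * e K k) * counit (R := K) (e K k * b) := by
  rw [counit_mul (V := V) a b]
  simp_rw [counit_eo_mul]

variable (K H) in
/-- The face idempotents `e i = ε(· e i)` of the dual face algebra. -/
def dualE (i : V) : WithConv (H →ₗ[K] K) :=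
  toConv ((counit (R := K) (A := H)) ∘ₗ LinearMap.mulRight K (e K i))

variable (K H) in
/-- The face idempotents `e° i = ε(e i ·)` of the dual face algebra. -/
def dualEo (i : V) : WithConv (H →ₗ[K] K) :=
  toConv ((counit (R := K) (A := H)) ∘ₗ LinearMap.mulLeft K (e K i))

@[simp] theorem dualE_apply (i : V) (a : H) :
    dualE K H i a = counit (R := K) (a * e K i) := rfl

@[simp] theorem dualEo_apply (i : V) (a : H) :
    dualEo K H i a = counit (R := K) (e K i * a) := rfl

theorem lact_dualE (i : V) (a : H) : lact (dualE K H i) a = a * e K i := by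
  have h := congrArg (TensorProduct.rid K H)
    (Coalgebra.lTensor_counit_comul (R := K) (a * e K i))
  rw [comul_mul_e] at h
  simp only [rid_tmul, one_smul] at h
  rw [← h, lact]
  simp only [LinearMap.comp_apply]
  generalize comul (R := K) a = z
  induction z with
  | zero => simp
  | tmul x y => simp
  | add x y hx hy => simp only [map_add, add_mul, hx, hy]

theorem ract_dualE (i : V) (a : H) : ract (dualE K H i) a = a * eo K i := by
  have h := congrArg (TensorProduct.lid K H)
    (Coalgebra.rTensor_counit_comul (R := K) (a * eo K i))
  rw [comul_mul_eo] at h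
  simp only [lid_tmul, one_smul] at h
  rw [← h, ract]
  simp only [LinearMap.comp_apply]
  generalize comul (R := K) a = z
  induction z with
  | zero => simp
  | tmul x y => simp [counit_mul_eo]
  | add x y hx hy => simp only [map_add, add_mul, hx, hy]

theorem lact_dualEo (i : V) (a : H) : lact (dualEo K H i) a = e K i * a := by
  have h := congrArg (TensorProduct.rid K H)
    (Coalgebra.lTensor_counit_comul (R := K) (e K i * a))
  rw [comul_e_mul] at h
  simp only [rid_tmul, one_smul] at h
  rw [← h, lact]
  simp only [LinearMap.comp_apply]
  generalize comul (R := K) a = z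
  induction z with
  | zero => simp
  | tmul x y => simp
  | add x y hx hy => simp only [map_add, mul_add, hx, hy]

theorem ract_dualEo (i : V) (a : H) : ract (dualEo K H i) a = eo K i * a := by
  have h := congrArg (TensorProduct.lid K H)
    (Coalgebra.rTensor_counit_comul (R := K) (eo K i * a))
  rw [comul_eo_mul] at h
  simp only [lid_tmul, one_smul] at h
  rw [← h, ract]
  simp only [LinearMap.comp_apply]
  generalize comul (R := K) a = z
  induction z with
  | zero => simp
  | tmul x y => simp [counit_eo_mul]
  | add x y hx hy => simp only [map_add, mul_add, hx, hy]

theorem mul_dualE (f : WithConv (H →ₗ[K] K)) (i : V) (a : H) :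
    (f * dualE K H i) a = f (a * e K i) := by rw [← apply_lact, lact_dualE]

theorem dualE_mul (f : WithConv (H →ₗ[K] K)) (i : V) (a : H) :
    (dualE K H i * f) a = f (a * eo K i) := by rw [← apply_ract, ract_dualE]

theorem mul_dualEo (f : WithConv (H →ₗ[K] K)) (i : V) (a : H) :
    (f * dualEo K H i) a = f (e K i * a) := by rw [← apply_lact, lact_dualEo]

theorem dualEo_mul (f : WithConv (H →ₗ[K] K)) (i : V) (a : H) :
    (dualEo K H i * f) a = f (eo K i * a) := by rw [← apply_ract, ract_dualEo]

/-! ### Group-like functionals -/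

theorem glf_l {f : WithConv (H →ₗ[K] K)}
    (h : ∀ (a : H) (i j : V), f (eo K i * a * eo K j) = f (e K i * a * e K j)) (i : V) (a : H) :
    f (eo K i * a) = f (e K i * a) := by
  have := Finset.sum_congr rfl fun j (_ : j ∈ Finset.univ) => h a i j
  rwa [← map_sum, ← map_sum, ← Finset.mul_sum, ← Finset.mul_sum, sum_e, sum_eo, mul_one,
    mul_one] at this

theorem glf_r {f : WithConv (H →ₗ[K] K)}
    (h : ∀ (a : H) (i j : V), f (eo K i * a * eo K j) = f (e K i * a * e K j)) (i : V) (a : H) :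
    f (a * eo K i) = f (a * e K i) := by
  have := Finset.sum_congr rfl fun j (_ : j ∈ Finset.univ) => h a j i
  rwa [← map_sum, ← map_sum, ← Finset.sum_mul, ← Finset.sum_mul, ← Finset.sum_mul,
    ← Finset.sum_mul, sum_e, sum_eo, one_mul] at this

variable (K V H) in
/-- Group-like functionals. -/
structure IsGroupLike (f : WithConv (H →ₗ[K] K)) : Prop where
  map_mul : ∀ a b : H, f (a * b) = ∑ k : V, f (a * e K k) * f (eo K k * b)
  map_eo_mul_eo : ∀ (a : H) (i j : V), f (eo K i * a * eo K j) = f (e K i * a * e K j)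
  map_eo_mul_e : ∀ i j : V, f (eo K i * e K j) = if i = j then 1 else 0

theorem isGroupLike_one : IsGroupLike K V H 1 where
  map_mul a b := counit_mul a b
  map_eo_mul_eo a i j := by
    simp only [LinearMap.convOne_apply, mul_assoc, counit_eo_mul]
    simp only [← mul_assoc, counit_mul_eo]
  map_eo_mul_e i j := counit_eo_mul_e i j

theorem central_iff {f : WithConv (H →ₗ[K] K)} (i : V) :
    (∀ a, f (a * eo K i) = f (a * e K i)) ↔ Commute f (dualE K H i) := by
  refine ⟨fun h => ?_, fun h a => ?_⟩
  · refine WithConv.ext (LinearMap.ext fun a => ?_)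
    rw [mul_dualE, dualE_mul, h]
  · rw [← mul_dualE, ← dualE_mul, h.eq]

theorem central_iff' {f : WithConv (H →ₗ[K] K)} (i : V) :
    (∀ a, f (eo K i * a) = f (e K i * a)) ↔ Commute f (dualEo K H i) := by
  refine ⟨fun h => ?_, fun h a => ?_⟩
  · refine WithConv.ext (LinearMap.ext fun a => ?_)
    rw [mul_dualEo, dualEo_mul, h]
  · rw [← mul_dualEo, ← dualEo_mul, h.eq]


/-- The functional `f ⊗ g` on `C ⊗ D`. -/
def tmulF {C D : Type*} [AddCommGroup C] [Module K C] [AddCommGroup D] [Module K D]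
    (f : WithConv (C →ₗ[K] K)) (g : WithConv (D →ₗ[K] K)) : WithConv (C ⊗[K] D →ₗ[K] K) :=
  toConv (TensorProduct.lift (f.ofConv.smulRight g.ofConv))

@[simp] theorem tmulF_apply {C D : Type*} [AddCommGroup C] [Module K C] [AddCommGroup D]
    [Module K D] (f : WithConv (C →ₗ[K] K)) (g : WithConv (D →ₗ[K] K)) (a : C) (b : D) :
    tmulF f g (a ⊗ₜ b) = f a * g b := by
  simp [tmulF]

theorem tmulF_mul {C D : Type*} [AddCommGroup C] [Module K C] [Coalgebra K C] [AddCommGroup D]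
    [Module K D] [Coalgebra K D] (f f' : WithConv (C →ₗ[K] K)) (g g' : WithConv (D →ₗ[K] K)) :
    tmulF f g * tmulF f' g' = tmulF (f * f') (g * g') := by
  refine WithConv.ext (TensorProduct.ext' fun a b => ?_)
  rw [tmulF_apply, conv_apply' f, conv_apply' g, LinearMap.convMul_apply, TensorProduct.comul_tmul]
  generalize comul (R := K) a = z
  generalize comul (R := K) b = w
  induction z with
  | zero => simp
  | add x y hx hy => simp only [map_add, add_tmul, add_mul, hx, hy]
  | tmul x y =>
    induction w with
    | zero => simp
    | add x y hx hy => simp only [map_add, tmul_add, mul_add, hx, hy]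
    | tmul x' y' => simp; ring

section Pull

/-- The functional `m^*(X)` on `H ⊗ H`, where `m` is the product. -/
def mulPull (X : WithConv (H →ₗ[K] K)) : WithConv (H ⊗[K] H →ₗ[K] K) :=
  toConv (X.ofConv ∘ₗ LinearMap.mul' K H)

/-- The functional `(m^op)^*(X)` on `H ⊗ H`, where `m^op` is the opposite product. -/
def mulOpPull (X : WithConv (H →ₗ[K] K)) : WithConv (H ⊗[K] H →ₗ[K] K) :=
  toConv (X.ofConv ∘ₗ LinearMap.mul' K H ∘ₗ (TensorProduct.comm K H H).toLinearMap)

@[simp] theorem mulPull_apply (X : WithConv (H →ₗ[K] K)) (a b : H) :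
    mulPull X (a ⊗ₜ b) = X (a * b) := rfl

@[simp] theorem mulOpPull_apply (X : WithConv (H →ₗ[K] K)) (a b : H) :
    mulOpPull X (a ⊗ₜ b) = X (b * a) := rfl

end Pull

theorem mulPull_mul (V : Type*) [Fintype V] [DecidableEq V] [FaceAlgebra K V H]
    (X Y : WithConv (H →ₗ[K] K)) : mulPull (X * Y) = mulPull X * mulPull Y := by
  refine WithConv.ext (TensorProduct.ext' fun a b => ?_)
  rw [mulPull_apply, conv_apply', LinearMap.convMul_apply, TensorProduct.comul_tmul,
    FaceAlgebra.comul_mul (V := V)]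
  generalize comul (R := K) a = z
  generalize comul (R := K) b = w
  induction z with
  | zero => simp
  | add x y hx hy => simp only [map_add, add_tmul, add_mul, hx, hy]
  | tmul x y =>
    induction w with
    | zero => simp
    | add x y hx hy => simp only [map_add, tmul_add, mul_add, hx, hy]
    | tmul x' y' => simp

theorem mulPull_one : mulPull (1 : WithConv (H →ₗ[K] K)) =
    ∑ k : V, tmulF (dualE K H k) (dualEo K H k) := by
  refine WithConv.ext (TensorProduct.ext' fun a b => ?_)
  rw [mulPull_apply, LinearMap.convOne_apply, counit_mul' V]
  simp

theorem isGroupLike_iff (f : WithConv (H →ₗ[K] K)) : IsGroupLike K V H f ↔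
    (∀ i : V, Commute f (dualE K H i)) ∧ (∀ i : V, Commute f (dualEo K H i)) ∧
    (∀ i : V, f (e K i) = 1) ∧ mulPull f = tmulF f f * mulPull 1 := by
  have key : (∀ i : V, Commute f (dualEo K H i)) → 
      ((∀ a b : H, f (a * b) = ∑ k : V, f (a * e K k) * f (eo K k * b)) ↔
       mulPull f = tmulF f f * mulPull 1) := by
    intro h
    rw [mulPull_one (V := V), Finset.mul_sum]
    simp_rw [tmulF_mul]
    constructor
    · intro H
      refine WithConv.ext (TensorProduct.ext' fun a b => ?_)
      rw [mulPull_apply, H]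
      simp [(central_iff' _).2 (h _), mul_dualE, mul_dualEo, -LinearMap.convMul_apply]
    · intro H a b
      rw [← mulPull_apply f, H]
      simp [(central_iff' _).2 (h _), mul_dualE, mul_dualEo, -LinearMap.convMul_apply]
  constructor
  · intro h
    have h1 : ∀ i : V, Commute f (dualE K H i) :=
      fun i => (central_iff i).1 (glf_r h.map_eo_mul_eo i)
    have h2 : ∀ i : V, Commute f (dualEo K H i) :=
      fun i => (central_iff' i).1 (glf_l h.map_eo_mul_eo i)
    refine ⟨h1, h2, fun i => ?_, (key h2).1 h.map_mul⟩
    have := h.map_eo_mul_e i i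
    rw [(central_iff' i).2 (h2 i), e_mul_e] at this
    simpa using this
  · rintro ⟨h1, h2, h3, h4⟩
    refine ⟨(key h2).2 h4, fun a i j => ?_, fun i j => ?_⟩
    · rw [(central_iff j).2 (h1 j), mul_assoc, mul_assoc, (central_iff' i).2 (h2 i)]
    · rw [(central_iff' i).2 (h2 i), e_mul_e]
      split_ifs
      · exact h3 i
      · simp

theorem tmulF_comm {f : WithConv (H →ₗ[K] K)} (h1 : ∀ i : V, Commute f (dualE K H i))
    (h2 : ∀ i : V, Commute f (dualEo K H i)) : Commute (tmulF f f) (mulPull 1) := by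
  rw [mulPull_one (V := V)]
  refine Commute.sum_right _ _ _ fun k _ => ?_
  rw [Commute, SemiconjBy, tmulF_mul, tmulF_mul, (h1 k).eq, (h2 k).eq]

theorem conv_e (f g : WithConv (H →ₗ[K] K)) (h2 : ∀ i : V, Commute g (dualEo K H i)) (i : V) :
    (f * g) (e K i) = f (e K i) * g (e K i) := by
  rw [conv_apply', comul_e, map_sum]
  simp only [lift.tmul, LinearMap.smulRight_apply]
  simp [(central_iff' _).2 (h2 _), e_mul_e, apply_ite, LinearMap.smul_apply]

theorem IsGroupLike.mul {f g : WithConv (H →ₗ[K] K)} (hf : IsGroupLike K V H f)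
    (hg : IsGroupLike K V H g) : IsGroupLike K V H (f * g) := by
  rw [isGroupLike_iff] at *
  obtain ⟨f1, f2, f3, f4⟩ := hf
  obtain ⟨g1, g2, g3, g4⟩ := hg
  refine ⟨fun i => (f1 i).mul_left (g1 i), fun i => (f2 i).mul_left (g2 i), fun i => ?_, ?_⟩
  · rw [conv_e _ _ g2, f3, g3, one_mul]
  · rw [mulPull_mul V, f4, g4, (tmulF_comm g1 g2).eq, mul_assoc, ← mul_assoc (mulPull 1),
      ← mulPull_mul V, one_mul, ← (tmulF_comm g1 g2).eq, ← mul_assoc, tmulF_mul]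

theorem IsGroupLike.inv {u : (WithConv (H →ₗ[K] K))ˣ} (hf : IsGroupLike K V H u) :
    IsGroupLike K V H (u⁻¹ : (WithConv (H →ₗ[K] K))ˣ) := by
  rw [isGroupLike_iff] at *
  obtain ⟨f1, f2, f3, f4⟩ := hf
  have g2 : ∀ i : V, Commute (u⁻¹ : (WithConv (H →ₗ[K] K))ˣ).val (dualEo K H i) :=
    fun i => (f2 i).units_inv_left
  refine ⟨fun i => (f1 i).units_inv_left, g2, fun i => ?_, ?_⟩
  · have := conv_e (u : WithConv (H →ₗ[K] K)) (u⁻¹ : (WithConv (H →ₗ[K] K))ˣ) g2 i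
    rw [Units.mul_inv, f3, one_mul, LinearMap.convOne_apply, counit_e] at this
    simpa using this.symm
  · set g := (u⁻¹ : (WithConv (H →ₗ[K] K))ˣ).val with hg
    have hone : tmulF (1 : WithConv (H →ₗ[K] K)) (1 : WithConv (H →ₗ[K] K)) = 1 := by
      refine WithConv.ext (TensorProduct.ext' fun a b => ?_)
      rw [tmulF_apply]
      simp [mul_comm]
    have h1 : mulPull (1 : WithConv (H →ₗ[K] K)) = tmulF g g * mulPull u.val := by
      rw [f4, ← mul_assoc, tmulF_mul, hg, Units.inv_mul, hone, one_mul]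
    calc mulPull g = mulPull 1 * mulPull g := by rw [← mulPull_mul V, one_mul]
      _ = tmulF g g * (mulPull u.val * mulPull g) := by rw [h1, mul_assoc]
      _ = _ := by rw [← mulPull_mul V, hg, Units.mul_inv]

variable (K V H) in
/-- The semigroup of group-like functionals. -/
def GLF : Submonoid (WithConv (H →ₗ[K] K)) where
  carrier := {f | IsGroupLike K V H f}
  mul_mem' := IsGroupLike.mul
  one_mem' := isGroupLike_one

variable (K V H) in
/-- The group of those group-like functionals that are invertible in the dual algebra. -/
def GLFUnits : Subgroup (WithConv (H →ₗ[K] K))ˣ where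
  carrier := {u | IsGroupLike K V H (u : WithConv (H →ₗ[K] K))}
  mul_mem' := fun ha hb => IsGroupLike.mul ha hb
  one_mem' := isGroupLike_one
  inv_mem' := IsGroupLike.inv

end Face

/-! ### Building a face algebra from multiplicative data -/

section Corner

variable {K B : Type*} [Field K] [Ring B] [Algebra K B] {p : B} (hp : IsIdempotentElem p)

instance : Algebra K hp.Corner :=
  letI : SMul K hp.Corner := ⟨fun k x => ⟨k • x.1, by
    have h := (Subsemigroup.mem_corner_iff hp).1 x.2
    refine (Subsemigroup.mem_corner_iff hp).2 ⟨?_, ?_⟩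
    · rw [mul_smul_comm, h.1]
    · rw [smul_mul_assoc, h.2]⟩⟩
  letI : Module K hp.Corner := Function.Injective.module K
    (⟨⟨fun x => x.1, rfl⟩, fun _ _ => rfl⟩ : hp.Corner →+ B) Subtype.val_injective fun _ _ => rfl
  Algebra.ofModule (fun k x y => Subtype.ext (smul_mul_assoc k x.1 y.1))
    (fun k x y => Subtype.ext (mul_smul_comm k x.1 y.1))

/-- The inclusion of the corner `p B p` into `B`. -/
def cornerVal : hp.Corner →ₗ[K] B where
  toFun x := x.1
  map_add' _ _ := rfl
  map_smul' _ _ := rfl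

variable (K) in
theorem cornerVal_injective : Function.Injective (cornerVal (K := K) hp) := Subtype.val_injective

@[simp] theorem cornerVal_mul (x y : hp.Corner) :
    cornerVal (K := K) hp (x * y) = cornerVal (K := K) hp x * cornerVal (K := K) hp y := rfl

@[simp] theorem cornerVal_one : cornerVal (K := K) hp (1 : hp.Corner) = p := rfl

/-- A linear map into `B` with values in `p B p`, as a map into the corner. -/
def toCorner {M : Type*} [AddCommGroup M] [Module K M] (f : M →ₗ[K] B)
    (h1 : ∀ x, p * f x = f x) (h2 : ∀ x, f x * p = f x) : M →ₗ[K] hp.Corner where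
  toFun x := ⟨f x, (Subsemigroup.mem_corner_iff hp).2 ⟨h1 x, h2 x⟩⟩
  map_add' x y := Subtype.ext (map_add f x y)
  map_smul' k x := Subtype.ext (map_smul f k x)

@[simp] theorem cornerVal_toCorner {M : Type*} [AddCommGroup M] [Module K M] (f : M →ₗ[K] B)
    (h1 : ∀ x, p * f x = f x) (h2 : ∀ x, f x * p = f x) (x : M) :
    cornerVal (K := K) hp (toCorner hp f h1 h2 x) = f x := rfl

end Corner

/-- The sum of the entries of a matrix. -/
def entrySum (K V : Type*) [Field K] [Fintype V] : Matrix V V K →ₗ[K] K :=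
  ∑ i, ∑ j, Matrix.entryLinearMap K K i j

theorem entrySum_apply {K V : Type*} [Field K] [Fintype V] (A : Matrix V V K) :
    entrySum K V A = ∑ i, ∑ j, A i j := by
  simp [entrySum, LinearMap.sum_apply]

theorem entrySum_transpose {K V : Type*} [Field K] [Fintype V] (A : Matrix V V K) :
    entrySum K V A.transpose = entrySum K V A := by
  rw [entrySum_apply, entrySum_apply]
  exact Finset.sum_comm

theorem entrySum_single {K V : Type*} [Field K] [Fintype V] [DecidableEq V] (i j : V) (c : K) :
    entrySum K V (Matrix.single i j c) = c := by
  rw [entrySum_apply]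
  simp [Matrix.single_apply, ite_and]

theorem entrySum_mul {K V : Type*} [Field K] [Fintype V] [DecidableEq V] (A B : Matrix V V K) :
    entrySum K V (A * B) = ∑ k, entrySum K V (A * Matrix.single k k 1) *
      entrySum K V (Matrix.single k k 1 * B) := by
  have h1 : ∀ k, entrySum K V (A * Matrix.single k k 1) = ∑ i, A i k := fun k => by
    rw [entrySum_apply]
    simp [Matrix.mul_apply, Matrix.single_apply, ite_and]
  have h2 : ∀ k, entrySum K V (Matrix.single k k 1 * B) = ∑ j, B k j := fun k => by
    rw [entrySum_apply]
    simp [Matrix.mul_apply, Matrix.single_apply, ite_and]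
  simp_rw [h1, h2, entrySum_apply, Matrix.mul_apply, Finset.sum_mul_sum]
  rw [Finset.sum_comm' (s := Finset.univ (α := V)) (t := fun _ => Finset.univ)
    (t' := Finset.univ) (s' := fun _ => Finset.univ) (by simp)]
  rw [Finset.sum_congr rfl fun j _ => Finset.sum_comm, Finset.sum_comm]
  exact Finset.sum_congr rfl fun k _ => Finset.sum_comm

/-- Data on an algebra `P` from which a face algebra structure can be read off: a multiplicative
map `D` (the comultiplication) and a representation `ρ` by matrices (the counit is the sum of the
entries of `ρ`), such that the coalgebra axioms hold on a set of generators. -/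
structure FaceDatum (K V P : Type*) [Field K] [Fintype V] [DecidableEq V] [Ring P]
    [Algebra K P] where
  e : V → P
  eo : V → P
  e_mul_e : ∀ i j, e i * e j = if i = j then e i else 0
  eo_mul_eo : ∀ i j, eo i * eo j = if i = j then eo i else 0
  e_mul_eo : ∀ i j, e i * eo j = eo j * e i
  sum_e : ∑ k, e k = 1
  sum_eo : ∑ k, eo k = 1
  D : P →ₗ[K] P ⊗[K] P
  D_mul : ∀ a b, D (a * b) = D a * D b
  D_eo_mul_e : ∀ i j, D (eo i * e j) = ∑ k, (eo i * e k) ⊗ₜ[K] (eo k * e j)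
  ρ : P →ₐ[K] Matrix V V K
  ρ_e : ∀ i, ρ (e i) = Matrix.single i i 1
  ρ_eo : ∀ i, ρ (eo i) = Matrix.single i i 1
  gen : Set P
  gen_top : Algebra.adjoin K gen = ⊤
  coassoc_gen : ∀ x ∈ gen, TensorProduct.assoc K P P P (D.rTensor P (D x)) = D.lTensor P (D x)
  counit_left_gen : ∀ x ∈ gen,
    (entrySum K V ∘ₗ ρ.toLinearMap).rTensor P (D x) = 1 ⊗ₜ[K] x
  counit_right_gen : ∀ x ∈ gen,
    (entrySum K V ∘ₗ ρ.toLinearMap).lTensor P (D x) = x ⊗ₜ[K] 1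

namespace FaceDatum

variable {K V P : Type*} [Field K] [Fintype V] [DecidableEq V] [Ring P] [Algebra K P]
  (F : FaceDatum K V P)

/-- The counit. -/
def eps : P →ₗ[K] K := entrySum K V ∘ₗ F.ρ.toLinearMap

theorem eps_e_mul (x : P) (k : V) : F.eps (F.e k * x) = F.eps (F.eo k * x) := by
  simp only [eps, LinearMap.comp_apply, AlgHom.toLinearMap_apply, map_mul, F.ρ_e, F.ρ_eo]

theorem eps_mul (x y : P) :
    F.eps (x * y) = ∑ k, F.eps (x * F.e k) * F.eps (F.eo k * y) := by
  simp only [eps, LinearMap.comp_apply, AlgHom.toLinearMap_apply, map_mul, F.ρ_e, F.ρ_eo]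
  exact entrySum_mul _ _

theorem eps_eo_mul_e (i j : V) : F.eps (F.eo i * F.e j) = if i = j then 1 else 0 := by
  simp only [eps, LinearMap.comp_apply, AlgHom.toLinearMap_apply, map_mul, F.ρ_e, F.ρ_eo]
  split_ifs with h
  · subst h
    rw [Matrix.single_mul_single_same, entrySum_single, mul_one]
  · rw [Matrix.single_mul_single_of_ne _ _ _ _ h, map_zero]

theorem eps_e (k : V) : F.eps (F.e k) = 1 := by
  simp [eps, F.ρ_e, entrySum_single]

theorem eps_eo (k : V) : F.eps (F.eo k) = 1 := by
  simp [eps, F.ρ_eo, entrySum_single]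

theorem D_e (j : V) : F.D (F.e j) = ∑ k, F.e k ⊗ₜ[K] (F.eo k * F.e j) := by
  conv_lhs => rw [← one_mul (F.e j), ← F.sum_eo, Finset.sum_mul, map_sum]
  simp_rw [D_eo_mul_e]
  rw [Finset.sum_comm]
  refine Finset.sum_congr rfl fun k _ => ?_
  rw [← sum_tmul, ← Finset.sum_mul, F.sum_eo, one_mul]

theorem D_eo (i : V) : F.D (F.eo i) = ∑ k, (F.eo i * F.e k) ⊗ₜ[K] F.eo k := by
  conv_lhs => rw [← mul_one (F.eo i), ← F.sum_e, Finset.mul_sum, map_sum]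
  simp_rw [D_eo_mul_e]
  rw [Finset.sum_comm]
  refine Finset.sum_congr rfl fun k _ => ?_
  rw [← tmul_sum, ← Finset.mul_sum, F.sum_e, mul_one]

theorem D_one : F.D 1 = ∑ k, F.e k ⊗ₜ[K] F.eo k := by
  conv_lhs => rw [← F.sum_e, map_sum]
  simp_rw [D_e]
  rw [Finset.sum_comm]
  refine Finset.sum_congr rfl fun k _ => ?_
  rw [← tmul_sum, ← Finset.mul_sum, F.sum_e, mul_one]

theorem D_mul_e (x : P) (k : V) : F.D x * (F.e k ⊗ₜ 1) = F.D x * (1 ⊗ₜ F.eo k) := by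
  have : F.D 1 * (F.e k ⊗ₜ 1) = F.D 1 * (1 ⊗ₜ F.eo k) := by
    simp [D_one, Finset.sum_mul, F.e_mul_e, F.eo_mul_eo, ite_tmul, tmul_ite]
  rw [← mul_one x, F.D_mul, mul_assoc, this, mul_assoc]

theorem e_mul_D (x : P) (k : V) : (F.e k ⊗ₜ 1) * F.D x = (1 ⊗ₜ F.eo k) * F.D x := by
  have : (F.e k ⊗ₜ 1) * F.D 1 = (1 ⊗ₜ F.eo k) * F.D 1 := by
    simp [D_one, Finset.mul_sum, F.e_mul_e, F.eo_mul_eo, ite_tmul, tmul_ite]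
  rw [← one_mul x, F.D_mul, ← mul_assoc, this, mul_assoc]

theorem induct {q : P → Prop} (hg : ∀ x ∈ F.gen, q x) (h1 : q 1) (ha : ∀ x y, q x → q y → q (x + y))
    (hs : ∀ (k : K) x, q x → q (k • x)) (hm : ∀ x y, q x → q y → q (x * y)) (x : P) : q x := by
  have hx : x ∈ Algebra.adjoin K F.gen := by rw [F.gen_top]; trivial
  induction hx using Algebra.adjoin_induction with
  | mem x h => exact hg x h
  | algebraMap r => rw [Algebra.algebraMap_eq_smul_one]; exact hs r 1 h1
  | add x y _ _ hx hy => exact ha x y hx hy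
  | mul x y _ _ hx hy => exact hm x y hx hy

theorem coassoc (x : P) :
    TensorProduct.assoc K P P P (F.D.rTensor P (F.D x)) = F.D.lTensor P (F.D x) := by
  refine F.induct F.coassoc_gen ?_ (fun x y hx hy => ?_) (fun k x hx => ?_) (fun x y hx hy => ?_) x
  · simp only [D_one, map_sum, LinearMap.rTensor_tmul, LinearMap.lTensor_tmul, D_e, D_eo,
      sum_tmul, tmul_sum, assoc_tmul]
    rw [Finset.sum_comm]
  · simp only [map_add, hx, hy]
  · simp only [map_smul, hx]
  · have h1 : ∀ X Y : P ⊗[K] P, F.D.rTensor P (X * Y) = F.D.rTensor P X * F.D.rTensor P Y := by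
      intro X Y
      induction X with
      | zero => simp
      | add x y hx hy => simp only [map_add, add_mul, hx, hy]
      | tmul x y =>
        induction Y with
        | zero => simp
        | add x y hx hy => simp only [map_add, mul_add, hx, hy]
        | tmul x' y' => simp [F.D_mul]
    have h2 : ∀ X Y : P ⊗[K] P, F.D.lTensor P (X * Y) = F.D.lTensor P X * F.D.lTensor P Y := by
      intro X Y
      induction X with
      | zero => simp
      | add x y hx hy => simp only [map_add, add_mul, hx, hy]
      | tmul x y =>
        induction Y with
        | zero => simp
        | add x y hx hy => simp only [map_add, mul_add, hx, hy]
        | tmul x' y' => simp [F.D_mul]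
    have h3 : ∀ X Y : (P ⊗[K] P) ⊗[K] P, TensorProduct.assoc K P P P (X * Y) =
        TensorProduct.assoc K P P P X * TensorProduct.assoc K P P P Y :=
      fun X Y => map_mul (Algebra.TensorProduct.assoc K K K P P P) X Y
    rw [F.D_mul, h1, h2, h3, hx, hy]

theorem counit_left (x : P) : F.eps.rTensor P (F.D x) = 1 ⊗ₜ[K] x := by
  refine F.induct (q := fun x => F.eps.rTensor P (F.D x) = 1 ⊗ₜ[K] x) F.counit_left_gen ?_ (fun x y hx hy => ?_) (fun k x hx => ?_)
    (fun x y hx hy => ?_) x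
  · simp only [D_one, map_sum, LinearMap.rTensor_tmul, eps_e]
    rw [← tmul_sum, F.sum_eo]
  · simp only [map_add, hx, hy, tmul_add]
  · simp only [map_smul, hx, tmul_smul]
  · have h1 : ∀ X Y : P ⊗[K] P, F.eps.rTensor P (X * Y) =
        ∑ k, F.eps.rTensor P (X * (F.e k ⊗ₜ 1)) * F.eps.rTensor P ((F.e k ⊗ₜ 1) * Y) := by
      intro X Y
      induction X with
      | zero => simp
      | add x y hx hy => simp only [map_add, add_mul, hx, hy, Finset.sum_add_distrib]
      | tmul x y =>
        induction Y with
        | zero => simp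
        | add x y hx hy => simp only [map_add, mul_add, hx, hy, Finset.sum_add_distrib]
        | tmul x' y' =>
          simp only [Algebra.TensorProduct.tmul_mul_tmul, LinearMap.rTensor_tmul, mul_one, one_mul]
          rw [← sum_tmul, F.eps_mul]
          simp_rw [F.eps_e_mul]
    have h2 : ∀ (X : P ⊗[K] P) k, F.eps.rTensor P (X * (1 ⊗ₜ F.eo k)) =
        F.eps.rTensor P X * (1 ⊗ₜ F.eo k) := by
      intro X k
      induction X with
      | zero => simp
      | add x y hx hy => simp only [map_add, add_mul, hx, hy]
      | tmul x y => simp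
    have h3 : ∀ (X : P ⊗[K] P) k, F.eps.rTensor P ((1 ⊗ₜ F.eo k) * X) =
        (1 ⊗ₜ F.eo k) * F.eps.rTensor P X := by
      intro X k
      induction X with
      | zero => simp
      | add x y hx hy => simp only [map_add, mul_add, hx, hy]
      | tmul x y => simp
    rw [F.D_mul, h1]
    have h4 : ∀ k, F.eps.rTensor P (F.D x * (F.e k ⊗ₜ 1)) *
        F.eps.rTensor P ((F.e k ⊗ₜ 1) * F.D y) = 1 ⊗ₜ[K] (x * F.eo k * y) := fun k => by
      rw [D_mul_e, e_mul_D, h2, h3, hx, hy]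
      simp only [Algebra.TensorProduct.tmul_mul_tmul, one_mul]
      rw [← mul_assoc, mul_assoc x, F.eo_mul_eo, if_pos rfl]
    simp_rw [h4]
    rw [← tmul_sum, ← Finset.sum_mul, ← Finset.mul_sum, F.sum_eo, mul_one]

theorem counit_right (x : P) : F.eps.lTensor P (F.D x) = x ⊗ₜ[K] 1 := by
  refine F.induct (q := fun x => F.eps.lTensor P (F.D x) = x ⊗ₜ[K] 1) F.counit_right_gen ?_ (fun x y hx hy => ?_) (fun k x hx => ?_)
    (fun x y hx hy => ?_) x
  · simp only [D_one, map_sum, LinearMap.lTensor_tmul, eps_eo]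
    rw [← sum_tmul, F.sum_e]
  · simp only [map_add, hx, hy, add_tmul]
  · simp only [map_smul, hx, smul_tmul']
  · have h0 : ∀ x k, F.eps (x * F.eo k) = F.eps (x * F.e k) := fun x k => by
      simp only [eps, LinearMap.comp_apply, AlgHom.toLinearMap_apply, map_mul, F.ρ_e, F.ρ_eo]
    have h1 : ∀ X Y : P ⊗[K] P, F.eps.lTensor P (X * Y) =
        ∑ k, F.eps.lTensor P (X * (1 ⊗ₜ F.eo k)) * F.eps.lTensor P ((1 ⊗ₜ F.eo k) * Y) := by
      intro X Y
      induction X with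
      | zero => simp
      | add x y hx hy => simp only [map_add, add_mul, hx, hy, Finset.sum_add_distrib]
      | tmul x y =>
        induction Y with
        | zero => simp
        | add x y hx hy => simp only [map_add, mul_add, hx, hy, Finset.sum_add_distrib]
        | tmul x' y' =>
          simp only [Algebra.TensorProduct.tmul_mul_tmul, LinearMap.lTensor_tmul, mul_one, one_mul]
          rw [← tmul_sum, F.eps_mul]
          simp_rw [h0]
    have h2 : ∀ (X : P ⊗[K] P) k, F.eps.lTensor P (X * (F.e k ⊗ₜ 1)) =
        F.eps.lTensor P X * (F.e k ⊗ₜ 1) := by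
      intro X k
      induction X with
      | zero => simp
      | add x y hx hy => simp only [map_add, add_mul, hx, hy]
      | tmul x y => simp
    have h3 : ∀ (X : P ⊗[K] P) k, F.eps.lTensor P ((F.e k ⊗ₜ 1) * X) =
        (F.e k ⊗ₜ 1) * F.eps.lTensor P X := by
      intro X k
      induction X with
      | zero => simp
      | add x y hx hy => simp only [map_add, mul_add, hx, hy]
      | tmul x y => simp
    rw [F.D_mul, h1]
    have h4 : ∀ k, F.eps.lTensor P (F.D x * (1 ⊗ₜ F.eo k)) *
        F.eps.lTensor P ((1 ⊗ₜ F.eo k) * F.D y) = (x * F.e k * y) ⊗ₜ[K] 1 := fun k => by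
      rw [← D_mul_e, ← e_mul_D, h2, h3, hx, hy]
      simp only [Algebra.TensorProduct.tmul_mul_tmul, one_mul]
      rw [← mul_assoc, mul_assoc x, F.e_mul_e, if_pos rfl]
    simp_rw [h4]
    rw [← sum_tmul, ← Finset.sum_mul, ← Finset.mul_sum, F.sum_e, mul_one]

/-- The coalgebra structure. -/
@[reducible] def toCoalgebra : Coalgebra K P where
  comul := F.D
  counit := F.eps
  coassoc := LinearMap.ext F.coassoc
  rTensor_counit_comp_comul := LinearMap.ext F.counit_left
  lTensor_counit_comp_comul := LinearMap.ext F.counit_right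

/-- The face algebra structure. -/
@[reducible] def toFaceAlgebra : letI := F.toCoalgebra; FaceAlgebra K V P :=
  letI := F.toCoalgebra
  { e := F.e
    eo := F.eo
    comul_mul := F.D_mul
    e_mul_e := F.e_mul_e
    eo_mul_eo := F.eo_mul_eo
    e_mul_eo := F.e_mul_eo
    sum_e := F.sum_e
    sum_eo := F.sum_eo
    comul_eo_mul_e := F.D_eo_mul_e
    counit_eo_mul_e := F.eps_eo_mul_e
    counit_mul := F.eps_mul }

end FaceDatum

open FaceAlgebra

/-! ### The co-opposite coalgebra -/

/-- The vector space underlying the co-opposite coalgebra `H^cop`. -/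
def Cop (H : Type*) : Type _ := H

section Cop

variable {K H : Type*} [Field K] [AddCommGroup H] [Module K H] [Coalgebra K H]

instance (H : Type*) [AddCommGroup H] : AddCommGroup (Cop H) := inferInstanceAs (AddCommGroup H)
instance (K H : Type*) [Field K] [AddCommGroup H] [Module K H] : Module K (Cop H) :=
  inferInstanceAs (Module K H)

/-- The identity map `H → H^cop`. -/
def toCop (K H : Type*) [Field K] [AddCommGroup H] [Module K H] : H ≃ₗ[K] Cop H :=
  LinearEquiv.refl K H

theorem cop_coassoc (a : H) :
    TensorProduct.assoc K H H H (LinearMap.rTensor H ((TensorProduct.comm K H H).toLinearMap ∘ₗ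
      comul (R := K)) (TensorProduct.comm K H H (comul (R := K) a))) =
    LinearMap.lTensor H ((TensorProduct.comm K H H).toLinearMap ∘ₗ
      comul (R := K)) (TensorProduct.comm K H H (comul (R := K) a)) := by
  have h := congrArg (fun z => TensorProduct.assoc K H H H ((TensorProduct.comm K H H).rTensor H
    (TensorProduct.comm K _ _ z))) (Coalgebra.coassoc_apply (R := K) a)
  beta_reduce at h
  symm
  convert h using 1
  · generalize comul (R := K) a = z
    induction z with
    | zero => simp
    | add x y hx hy => simp only [map_add, hx, hy]
    | tmul x y =>
      simp only [comm_tmul, LinearMap.lTensor_tmul, LinearMap.rTensor_tmul, LinearMap.comp_apply]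
      generalize comul (R := K) x = z
      induction z with
      | zero => simp
      | add x y hx hy => simp only [map_add, tmul_add, add_tmul, hx, hy]
      | tmul x y => simp
  · generalize comul (R := K) a = z
    induction z with
    | zero => simp
    | add x y hx hy => simp only [map_add, hx, hy]
    | tmul x y => simp

instance : Coalgebra K (Cop H) where
  comul := (TensorProduct.comm K H H).toLinearMap ∘ₗ comul (R := K) (A := H)
  counit := counit (R := K) (A := H)
  coassoc := LinearMap.ext fun a => cop_coassoc (K := K) (H := H) a
  rTensor_counit_comp_comul := LinearMap.ext fun a => by
    have h := congrArg (TensorProduct.comm K _ _) (Coalgebra.lTensor_counit_comul (R := K) (A := H) a)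
    refine Eq.trans ?_ h
    change LinearMap.rTensor H (counit (R := K) (A := H)) (TensorProduct.comm K H H
      (comul (R := K) (A := H) a)) = _
    generalize comul (R := K) (A := H) a = z
    induction z with
    | zero => simp
    | add x y hx hy => simp only [map_add, hx, hy]
    | tmul x y => simp
  lTensor_counit_comp_comul := LinearMap.ext fun a => by
    have h := congrArg (TensorProduct.comm K _ _) (Coalgebra.rTensor_counit_comul (R := K) (A := H) a)
    refine Eq.trans ?_ h
    change LinearMap.lTensor H (counit (R := K) (A := H)) (TensorProduct.comm K H H
      (comul (R := K) (A := H) a)) = _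
    generalize comul (R := K) (A := H) a = z
    induction z with
    | zero => simp
    | add x y hx hy => simp only [map_add, hx, hy]
    | tmul x y => simp

theorem comul_toCop (a : H) : comul (R := K) (toCop K H a) =
    TensorProduct.comm K _ _ (TensorProduct.map (toCop K H).toLinearMap (toCop K H).toLinearMap
      (comul (R := K) a)) := by
  have : (TensorProduct.map (toCop K H).toLinearMap (toCop K H).toLinearMap) = LinearMap.id :=
    TensorProduct.map_id
  rw [this]; rfl

/-- A functional on `H`, as a functional on `H^cop`. -/
def copF (f : WithConv (H →ₗ[K] K)) : WithConv (Cop H →ₗ[K] K) :=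
  toConv (f.ofConv ∘ₗ (toCop K H).symm.toLinearMap)

/-- A bilinear form on `H`, as a functional on `H ⊗ H^cop`. -/
def onCop (X : WithConv (H ⊗[K] H →ₗ[K] K)) : WithConv (H ⊗[K] Cop H →ₗ[K] K) :=
  toConv (X.ofConv ∘ₗ (toCop K H).symm.toLinearMap.lTensor H)

@[simp] theorem copF_apply (f : WithConv (H →ₗ[K] K)) (a : H) : copF f (toCop K H a) = f a := rfl

@[simp] theorem onCop_apply (X : WithConv (H ⊗[K] H →ₗ[K] K)) (a b : H) :
    onCop X (a ⊗ₜ toCop K H b) = X (a ⊗ₜ b) := rfl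

theorem lact_copF (f : WithConv (H →ₗ[K] K)) (a : H) :
    lact (copF f) (toCop K H a) = toCop K H (ract f a) := by
  simp only [lact, ract, LinearMap.comp_apply, comul_toCop]
  generalize comul (R := K) a = z
  induction z with
  | zero => simp
  | add x y hx hy => simp only [map_add, hx, hy]
  | tmul x y => simp [copF]

theorem ract_copF (f : WithConv (H →ₗ[K] K)) (a : H) :
    ract (copF f) (toCop K H a) = toCop K H (lact f a) := by
  simp only [lact, ract, LinearMap.comp_apply, comul_toCop]
  generalize comul (R := K) a = z
  induction z with
  | zero => simp
  | add x y hx hy => simp only [map_add, hx, hy]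
  | tmul x y => simp [copF]

theorem cop_ext {M : Type*} [AddCommGroup M] [Module K M] {f g : H ⊗[K] Cop H →ₗ[K] M}
    (h : ∀ a b : H, f (a ⊗ₜ toCop K H b) = g (a ⊗ₜ toCop K H b)) : f = g :=
  TensorProduct.ext' fun a b => h a ((toCop K H).symm b)

end Cop

section TmulF

variable {K C D : Type*} [Field K] [AddCommGroup C] [Module K C] [Coalgebra K C]
  [AddCommGroup D] [Module K D] [Coalgebra K D]

theorem lact_tmulF (f : WithConv (C →ₗ[K] K)) (g : WithConv (D →ₗ[K] K)) (a : C) (b : D) :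
    lact (tmulF f g) (a ⊗ₜ b) = lact f a ⊗ₜ lact g b := by
  simp only [lact, LinearMap.comp_apply, TensorProduct.comul_tmul]
  generalize comul (R := K) a = z
  generalize comul (R := K) b = w
  induction z with
  | zero => simp
  | add x y hx hy => simp only [map_add, add_tmul, hx, hy]
  | tmul x y =>
    induction w with
    | zero => simp
    | add x y hx hy => simp only [map_add, tmul_add, hx, hy]
    | tmul x' y' =>
      simp [tmulF]
      rw [← smul_tmul', smul_smul, mul_comm]

theorem ract_tmulF (f : WithConv (C →ₗ[K] K)) (g : WithConv (D →ₗ[K] K)) (a : C) (b : D) :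
    ract (tmulF f g) (a ⊗ₜ b) = ract f a ⊗ₜ ract g b := by
  simp only [ract, LinearMap.comp_apply, TensorProduct.comul_tmul]
  generalize comul (R := K) a = z
  generalize comul (R := K) b = w
  induction z with
  | zero => simp
  | add x y hx hy => simp only [map_add, add_tmul, hx, hy]
  | tmul x y =>
    induction w with
    | zero => simp
    | add x y hx hy => simp only [map_add, tmul_add, hx, hy]
    | tmul x' y' =>
      simp [tmulF]
      rw [← smul_tmul', smul_smul, mul_comm]

theorem lact_sum {ι : Type*} (s : Finset ι) (f : ι → WithConv (C →ₗ[K] K)) (a : C) :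
    lact (∑ i ∈ s, f i) a = ∑ i ∈ s, lact (f i) a := by
  simp only [lact, LinearMap.comp_apply]
  generalize comul (R := K) a = z
  induction z with
  | zero => simp
  | add x y hx hy => simp only [map_add, hx, hy, Finset.sum_add_distrib]
  | tmul x y => simp [ofConv_sum, LinearMap.sum_apply, Finset.sum_smul]

end TmulF

/-! ### Coquasitriangular and closable face algebras -/

/-- `xm` is an `(ep, em)`-generalized inverse of `xp`. -/
structure IsGenInv {A : Type*} [Mul A] (ep em xp xm : A) : Prop where
  mul_eq_ep : xm * xp = ep
  mul_eq_em : xp * xm = em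
  mul_mul_self : xp * xm * xp = xp
  mul_mul_inv : xm * xp * xm = xm

section Legs

variable {K H : Type*} [Field K] [AddCommGroup H] [Module K H] [Coalgebra K H]

/-- `Z₁₂ (a, b, c) = Z (a, b) ε(c)`. -/
def leg12 (Z : WithConv (H ⊗[K] H →ₗ[K] K)) : WithConv ((H ⊗[K] H) ⊗[K] H →ₗ[K] K) :=
  tmulF Z 1

/-- `Z₂₃ (a, b, c) = Z (b, c) ε(a)`. -/
def leg23 (Z : WithConv (H ⊗[K] H →ₗ[K] K)) : WithConv ((H ⊗[K] H) ⊗[K] H →ₗ[K] K) :=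
  toConv ((tmulF 1 Z).ofConv ∘ₗ (TensorProduct.assoc K H H H).toLinearMap)

/-- `Z₁₃ (a, b, c) = Z (a, c) ε(b)`. -/
def leg13 (Z : WithConv (H ⊗[K] H →ₗ[K] K)) : WithConv ((H ⊗[K] H) ⊗[K] H →ₗ[K] K) :=
  toConv ((tmulF Z 1).ofConv ∘ₗ (TensorProduct.rightComm K H H H).toLinearMap)

end Legs

/-- A coquasitriangular structure (braiding) on a face algebra `H`. Products of functionals on
`H ⊗ H` and on `H ⊗ H ⊗ H` are convolution products. -/
structure CQT (K H : Type*) [Field K] [Ring H] [Algebra K H] [Coalgebra K H] where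
  /-- `R⁺` -/
  Rp : WithConv (H ⊗[K] H →ₗ[K] K)
  /-- `R⁻` -/
  Rm : WithConv (H ⊗[K] H →ₗ[K] K)
  genInv : IsGenInv (mulPull 1) (mulOpPull 1) Rp Rm
  braid : ∀ X : WithConv (H →ₗ[K] K), Rp * mulPull X * Rm = mulOpPull X
  mul_left : toConv (Rp.ofConv ∘ₗ (LinearMap.mul' K H).rTensor H) = leg13 Rp * leg23 Rp
  mul_right : toConv (Rp.ofConv ∘ₗ (LinearMap.mul' K H).lTensor H ∘ₗ
    (TensorProduct.assoc K H H H).toLinearMap) = leg13 Rp * leg12 Rp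

section FForms

variable (K V H : Type*) [Field K] [Fintype V] [DecidableEq V] [Ring H] [Algebra K H]
  [Coalgebra K H] [FaceAlgebra K V H]

/-- `F⁺(a, b) = ∑ ε(e k a) ε(e k b)`, a functional on `H ⊗ H^cop`. -/
def Fplus : WithConv (H ⊗[K] Cop H →ₗ[K] K) :=
  ∑ k : V, tmulF (dualEo K H k) (copF (dualEo K H k))

/-- `F⁻(a, b) = ∑ ε(a e k) ε(b e k)`, a functional on `H ⊗ H^cop`. -/
def Fminus : WithConv (H ⊗[K] Cop H →ₗ[K] K) :=
  ∑ k : V, tmulF (dualE K H k) (copF (dualE K H k))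

/-- A closable coquasitriangular structure on `H`: a coquasitriangular structure for which the
Lyubashenko forms `Q⁻`, `Q⁺` exist (they are unique) in the algebra `(H ⊗ H^cop)^*`. -/
structure CCQT extends CQT K H where
  /-- `Q⁻` -/
  Qm : WithConv (H ⊗[K] Cop H →ₗ[K] K)
  /-- `Q⁺` -/
  Qp : WithConv (H ⊗[K] Cop H →ₗ[K] K)
  genInv_Qm : IsGenInv (Fplus K V H) (Fminus K V H) (onCop Rp) Qm
  genInv_Qp : IsGenInv (Fminus K V H) (Fplus K V H) (onCop Rm) Qp

/-- The representation `a ↦ (ε(e i a e j))` of a face algebra. -/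
def rep : H →ₐ[K] Matrix V V K :=
  AlgHom.ofLinearMap
    { toFun := fun a => Matrix.of fun i j => counit (R := K) (e K i * a * e K j)
      map_add' := fun a b => by ext i j; simp [mul_add, add_mul]
      map_smul' := fun c a => by ext i j; simp }
    (by
      ext i j
      simp only [LinearMap.coe_mk, AddHom.coe_mk, Matrix.of_apply, mul_one, e_mul_e,
        Matrix.one_apply]
      split_ifs
      · exact counit_e i
      · simp)
    (fun a b => by
      ext i j
      simp only [LinearMap.coe_mk, AddHom.coe_mk, Matrix.of_apply, Matrix.mul_apply]
      rw [← mul_assoc, mul_assoc (e K i * a), counit_mul' V]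
      simp only [mul_assoc])

variable {K V H}

@[simp] theorem rep_apply (a : H) (i j : V) :
    rep K V H a i j = counit (R := K) (e K i * a * e K j) := rfl

theorem rep_e (k : V) : rep K V H (e K k) = Matrix.single k k 1 := by
  ext i j
  rw [rep_apply, e_mul_e, Matrix.single_apply]
  split_ifs with h1 h2 h2
  · rw [e_mul_e, if_pos (h1.trans h2.2), counit_e]
  · rw [e_mul_e, if_neg (fun h => h2 ⟨h1.symm, h1.symm.trans h⟩), map_zero]
  · exact absurd h2.1.symm h1
  · simp

theorem rep_eo (k : V) : rep K V H (eo K k) = Matrix.single k k 1 := by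
  rw [← rep_e (H := H)]
  ext i j
  rw [rep_apply, rep_apply, e_mul_eo, mul_assoc, counit_eo_mul, mul_assoc, ← mul_assoc,
    ← mul_assoc, e_mul_e, e_mul_e]
  simp [eq_comm]
  split_ifs <;> simp_all

theorem entrySum_rep (a : H) : entrySum K V (rep K V H a) = counit (R := K) a := by
  rw [entrySum_apply]
  simp only [rep_apply]
  simp_rw [← map_sum, ← Finset.mul_sum, ← Finset.sum_mul]
  simp [sum_e]

theorem Rm_e_left (C : CQT K H) (j : V) (a b : H) :
    C.Rm ((e K j * a) ⊗ₜ b) = C.Rm (a ⊗ₜ (b * e K j)) := by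
  have key : ∀ a b : H, C.Rm (a ⊗ₜ b) = ∑ k : V, C.Rm ((e K k * a) ⊗ₜ (b * e K k)) := by
    intro a b
    have h1 : mulOpPull (1 : WithConv (H →ₗ[K] K)) =
        ∑ k : V, tmulF (dualEo K H k) (dualE K H k) := by
      refine WithConv.ext (TensorProduct.ext' fun a b => ?_)
      rw [mulOpPull_apply, LinearMap.convOne_apply, counit_mul' V]
      simp [mul_comm]
    have h := C.genInv.mul_mul_inv
    rw [mul_assoc, C.genInv.mul_eq_em, h1] at h
    conv_lhs => rw [← h, ← apply_lact, lact_sum, map_sum]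
    simp only [lact_tmulF, lact_dualEo, lact_dualE]
  rw [key, key a]
  simp only [← mul_assoc, mul_assoc b, e_mul_e, ite_mul, zero_mul, mul_ite, mul_zero]
  simp [ite_tmul, tmul_ite, apply_ite]

theorem Rm_eo_right (C : CQT K H) (i : V) (a b : H) :
    C.Rm (a ⊗ₜ (eo K i * b)) = C.Rm ((a * eo K i) ⊗ₜ b) := by
  have key : ∀ a b : H, C.Rm (a ⊗ₜ b) = ∑ k : V, C.Rm ((a * eo K k) ⊗ₜ (eo K k * b)) := by
    intro a b
    have h := C.genInv.mul_mul_inv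
    rw [C.genInv.mul_eq_ep, mulPull_one (V := V), Finset.sum_mul] at h
    conv_lhs => rw [← h]
    rw [ofConv_sum, LinearMap.sum_apply]
    refine Finset.sum_congr rfl fun k _ => ?_
    rw [← apply_ract, ract_tmulF, ract_dualE, ract_dualEo]
  rw [key, key (a * eo K i)]
  simp only [← mul_assoc, mul_assoc a, eo_mul_eo, ite_mul, zero_mul, mul_ite, mul_zero]
  simp [ite_tmul, tmul_ite, apply_ite]

end FForms

open FaceAlgebra

/-! ### The Hopf closure -/

section Hc

variable {K V H : Type*} [Field K] [Fintype V] [DecidableEq V] [Ring H] [Algebra K H]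
  [Coalgebra K H] [FaceAlgebra K V H]

variable (K V) in
/-- `E⁺(a) = ∑ ε(a e k) e k`. -/
def Eplus (a : H) : H := ∑ k : V, counit (R := K) (a * e K k) • e K k

variable (K V) in
/-- `E⁻(a) = ∑ ε(e k a) e° k`. -/
def Eminus (a : H) : H := ∑ k : V, counit (R := K) (e K k * a) • eo K k

/-- `b ⊗ c ↦ ∑ R⁻(b₁, c₃) Q⁺(b₃, c₁) b₂ ⊗ c₂`. -/
def twist (C : CCQT K V H) : H ⊗[K] Cop H →ₗ[K] H ⊗[K] Cop H :=
  lact C.Qp ∘ₗ ract (onCop C.Rm)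

variable (K H) in
/-- The generator `a`. -/
def genL : H →ₗ[K] TensorAlgebra K (H × H) := TensorAlgebra.ι K ∘ₗ LinearMap.inl K H H

variable (K H) in
/-- The generator `σ(b)`. -/
def genS : H →ₗ[K] TensorAlgebra K (H × H) := TensorAlgebra.ι K ∘ₗ LinearMap.inr K H H

/-- `b ⊗ c ↦ c σ(b)`, for given `c ↦ c` and `b ↦ σ(b)`. -/
def prodLS {A : Type*} [Ring A] [Algebra K A] (l s : H →ₗ[K] A) : H ⊗[K] Cop H →ₗ[K] A :=
  LinearMap.mul' K A ∘ₗ TensorProduct.map l s ∘ₗ (TensorProduct.comm K H H).toLinearMap ∘ₗ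
    (toCop K H).symm.toLinearMap.lTensor H

/-- `b ⊗ c ↦ σ(b) c`, for given `c ↦ c` and `b ↦ σ(b)`. -/
def prodSL {A : Type*} [Ring A] [Algebra K A] (l s : H →ₗ[K] A) : H ⊗[K] Cop H →ₗ[K] A :=
  LinearMap.mul' K A ∘ₗ TensorProduct.map s l ∘ₗ (toCop K H).symm.toLinearMap.lTensor H

@[simp] theorem prodLS_apply {A : Type*} [Ring A] [Algebra K A] (l s : H →ₗ[K] A) (b c : H) :
    prodLS l s (b ⊗ₜ toCop K H c) = l c * s b := rfl

@[simp] theorem prodSL_apply {A : Type*} [Ring A] [Algebra K A] (l s : H →ₗ[K] A) (b c : H) :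
    prodSL l s (b ⊗ₜ toCop K H c) = s b * l c := rfl

/-- The defining relations of the Hopf closure. The first six say that the elements `a σ(b)` form
the algebra `H ⊗_E H^bop` with product
`(a σ(b)) (c σ(d)) = ∑ R⁻(b₁, c₃) Q⁺(b₃, c₁) a c₂ σ(d b₂)`, the last two
are the generators `∑ σ(a₁) a₂ - ∑ ε(a e k) e k` and `∑ a₁ σ(a₂) - ∑ ε(e k a) e° k` of the
biideal `J` that is divided out. -/
inductive HcRel (C : CCQT K V H) : TensorAlgebra K (H × H) → TensorAlgebra K (H × H) → Prop
  | one : HcRel C (genL K H 1) 1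
  | mul (a b : H) : HcRel C (genL K H (a * b)) (genL K H a * genL K H b)
  | sig_mul (a b : H) : HcRel C (genS K H (a * b)) (genS K H b * genS K H a)
  | sig_e (i : V) : HcRel C (genS K H (e K i)) (genL K H (eo K i))
  | sig_eo (i : V) : HcRel C (genS K H (eo K i)) (genL K H (e K i))
  | straighten (b c : H) : HcRel C (genS K H b * genL K H c)
      (prodLS (genL K H) (genS K H) (twist C (b ⊗ₜ toCop K H c)))
  | antipode_left (a : H) : HcRel C
      (LinearMap.mul' K _ (TensorProduct.map (genS K H) (genL K H) (comul (R := K) a)))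
      (genL K H (Eplus K V a))
  | antipode_right (a : H) : HcRel C
      (LinearMap.mul' K _ (TensorProduct.map (genL K H) (genS K H) (comul (R := K) a)))
      (genL K H (Eminus K V a))

/-- The Hopf closure `Hc(H)` of a closable coquasitriangular face algebra `H`. -/
def Hc (C : CCQT K V H) : Type _ := RingQuot (HcRel C)

variable (C : CCQT K V H)

instance : Ring (Hc C) := inferInstanceAs (Ring (RingQuot (HcRel C)))
instance : Algebra K (Hc C) := inferInstanceAs (Algebra K (RingQuot (HcRel C)))

namespace Hc

/-- The projection onto `Hc(H)`. -/
def mk : TensorAlgebra K (H × H) →ₐ[K] Hc C := RingQuot.mkAlgHom K (HcRel C)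

theorem mk_rel {x y : TensorAlgebra K (H × H)} (h : HcRel C x y) : mk C x = mk C y :=
  RingQuot.mkAlgHom_rel K h

/-- An algebra map out of `Hc(H)`. -/
def lift {A : Type*} [Ring A] [Algebra K A] (f : TensorAlgebra K (H × H) →ₐ[K] A)
    (h : ∀ ⦃x y⦄, HcRel C x y → f x = f y) : Hc C →ₐ[K] A :=
  RingQuot.liftAlgHom K ⟨f, h⟩

theorem lift_mk {A : Type*} [Ring A] [Algebra K A] (f : TensorAlgebra K (H × H) →ₐ[K] A)
    (h : ∀ ⦃x y⦄, HcRel C x y → f x = f y) (x : TensorAlgebra K (H × H)) :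
    lift C f h (mk C x) = f x :=
  RingQuot.liftAlgHom_mkAlgHom_apply K f h x

theorem mk_surjective : Function.Surjective (mk C) := RingQuot.mkAlgHom_surjective K (HcRel C)

/-- The element `σ(b)` of `Hc(H)`. -/
def sig : H →ₗ[K] Hc C := (mk C).toLinearMap ∘ₗ genS K H

/-- The canonical map `ι : H → Hc(H)`. -/
def iota : H →ₐ[K] Hc C :=
  AlgHom.ofLinearMap ((mk C).toLinearMap ∘ₗ genL K H)
    ((mk_rel C HcRel.one).trans (map_one _))
    (fun a b => (mk_rel C (HcRel.mul a b)).trans (map_mul _ _ _))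

theorem mk_genL (a : H) : mk C (genL K H a) = iota C a := rfl
theorem mk_genS (b : H) : mk C (genS K H b) = sig C b := rfl

theorem sig_mul (a b : H) : sig C (a * b) = sig C b * sig C a :=
  (mk_rel C (HcRel.sig_mul a b)).trans (map_mul _ _ _)

theorem sig_e (i : V) : sig C (e K i) = iota C (eo K i) := mk_rel C (HcRel.sig_e i)

theorem sig_eo (i : V) : sig C (eo K i) = iota C (e K i) := mk_rel C (HcRel.sig_eo i)

theorem map_prodLS {A B : Type*} [Ring A] [Algebra K A] [Ring B] [Algebra K B] (f : A →ₐ[K] B)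
    (l s : H →ₗ[K] A) (x : H ⊗[K] Cop H) :
    f (prodLS l s x) = prodLS (f.toLinearMap ∘ₗ l) (f.toLinearMap ∘ₗ s) x := by
  have : f.toLinearMap ∘ₗ prodLS l s = prodLS (f.toLinearMap ∘ₗ l) (f.toLinearMap ∘ₗ s) :=
    cop_ext fun a b => by simp
  exact LinearMap.congr_fun this x

theorem map_mul_map {A B : Type*} [Ring A] [Algebra K A] [Ring B] [Algebra K B] (f : A →ₐ[K] B)
    (l s : H →ₗ[K] A) (x : H ⊗[K] H) :
    f (LinearMap.mul' K A (TensorProduct.map l s x)) =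
      LinearMap.mul' K B (TensorProduct.map (f.toLinearMap ∘ₗ l) (f.toLinearMap ∘ₗ s) x) := by
  induction x with
  | zero => simp
  | add x y hx hy => simp only [map_add, hx, hy]
  | tmul x y => simp

theorem straighten (x : H ⊗[K] Cop H) :
    prodSL (iota C).toLinearMap (sig C) x =
      prodLS (iota C).toLinearMap (sig C) (twist C x) := by
  have : prodSL (iota C).toLinearMap (sig C) =
      prodLS (iota C).toLinearMap (sig C) ∘ₗ twist C := cop_ext fun b c => by
    have h := mk_rel C (HcRel.straighten b c)
    rw [map_mul, map_prodLS] at h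
    exact h
  exact LinearMap.congr_fun this x

theorem antipode_left (a : H) : LinearMap.mul' K (Hc C) (TensorProduct.map (sig C)
    (iota C).toLinearMap (comul (R := K) a)) = iota C (Eplus K V a) := by
  have h := mk_rel C (HcRel.antipode_left a)
  rw [map_mul_map] at h
  exact h

theorem antipode_right (a : H) : LinearMap.mul' K (Hc C) (TensorProduct.map
    (iota C).toLinearMap (sig C) (comul (R := K) a)) = iota C (Eminus K V a) := by
  have h := mk_rel C (HcRel.antipode_right a)
  rw [map_mul_map] at h
  exact h

/-! #### The matrix representation -/

/-- `σ(b) ↦ (ε(e j b e i))`. -/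
def repS : H →ₗ[K] Matrix V V K :=
  (Matrix.transposeLinearEquiv V V K K).toLinearMap ∘ₗ (rep K V H).toLinearMap

/-- The representation on the free algebra. -/
def preRep : TensorAlgebra K (H × H) →ₐ[K] Matrix V V K :=
  TensorAlgebra.lift K ((rep K V H).toLinearMap.coprod repS)

theorem preRep_genL (a : H) : preRep (V := V) (genL K H a) = rep K V H a := by
  simp [preRep, genL]

theorem preRep_genS (a : H) : preRep (V := V) (genS K H a) = (rep K V H a).transpose := by
  simp [preRep, genS, repS]

theorem Fplus_eq : onCop C.Rm * (Fminus K V H * C.Qp) = Fplus K V H := by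
  rw [← C.genInv_Qp.mul_eq_ep, mul_assoc, ← mul_assoc, ← mul_assoc, C.genInv_Qp.mul_mul_self,
    C.genInv_Qp.mul_eq_em]

theorem Fplus_tmul (b c : H) : Fplus K V H (b ⊗ₜ toCop K H c) =
    ∑ k : V, counit (R := K) (e K k * b) * counit (R := K) (e K k * c) := by
  simp [Fplus, LinearMap.sum_apply]

/-- The `(i, j)` entry of `c σ(b)`. -/
theorem entry_LS (i j : V) (x : H ⊗[K] Cop H) :
    prodLS (rep K V H).toLinearMap repS x i j =
      (tmulF (dualEo K H j) (1 : WithConv (Cop H →ₗ[K] K)) *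
        (tmulF (1 : WithConv (H →ₗ[K] K)) (copF (dualEo K H i)) * Fminus K V H)) x := by
  have : Matrix.entryLinearMap K K i j ∘ₗ prodLS (rep K V H).toLinearMap repS =
      (tmulF (dualEo K H j) (1 : WithConv (Cop H →ₗ[K] K)) *
        (tmulF (1 : WithConv (H →ₗ[K] K)) (copF (dualEo K H i)) * Fminus K V H)).ofConv := by
    refine cop_ext fun b c => ?_
    simp only [Fminus, Finset.mul_sum, tmulF_mul, ofConv_sum, LinearMap.sum_apply, one_mul]
    simp only [LinearMap.comp_apply, prodLS_apply, Matrix.entryLinearMap_apply,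
      AlgHom.toLinearMap_apply, repS, Matrix.mul_apply, LinearEquiv.coe_coe,
      Matrix.transposeLinearEquiv_apply, Matrix.transpose_apply, rep_apply, tmulF_apply]
    refine Finset.sum_congr rfl fun k _ => ?_
    rw [mul_dualE, ← apply_lact, lact_copF, ract_dualE, copF_apply, dualEo_apply, dualEo_apply,
      ← mul_assoc, ← mul_assoc, counit_mul_eo, mul_comm]
    rfl
  exact LinearMap.congr_fun this x

theorem preRep_straighten (b c : H) :
    preRep (V := V) (genS K H b * genL K H c) =
      preRep (prodLS (genL K H) (genS K H) (twist C (b ⊗ₜ toCop K H c))) := by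
  have e1 : (preRep (K := K) (V := V) (H := H)).toLinearMap ∘ₗ genL K H =
      (rep K V H).toLinearMap := LinearMap.ext fun a => preRep_genL a
  have e2 : (preRep (K := K) (V := V) (H := H)).toLinearMap ∘ₗ genS K H = repS :=
    LinearMap.ext fun a => preRep_genS a
  rw [map_prodLS, e1, e2, map_mul, preRep_genL, preRep_genS]
  ext i j
  have h1 : onCop C.Rm * tmulF (dualEo K H j) (1 : WithConv (Cop H →ₗ[K] K)) =
      tmulF (1 : WithConv (H →ₗ[K] K)) (copF (dualE K H j)) * onCop C.Rm := by
    refine WithConv.ext (cop_ext fun a b => ?_)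
    rw [← apply_lact, ← apply_ract, lact_tmulF, ract_tmulF, lact_one, ract_one, ract_copF,
      lact_dualEo, lact_dualE]
    exact Rm_e_left C.toCQT j a b
  have h2 : onCop C.Rm * tmulF (1 : WithConv (H →ₗ[K] K)) (copF (dualEo K H i)) =
      tmulF (dualE K H i) (1 : WithConv (Cop H →ₗ[K] K)) * onCop C.Rm := by
    refine WithConv.ext (cop_ext fun a b => ?_)
    rw [← apply_lact, ← apply_ract, lact_tmulF, ract_tmulF, lact_one, ract_one, lact_copF,
      ract_dualEo, ract_dualE]
    exact Rm_eo_right C.toCQT i a b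
  rw [entry_LS, twist, LinearMap.comp_apply, apply_lact, apply_ract]
  have h3 : onCop C.Rm * (tmulF (dualEo K H j) (1 : WithConv (Cop H →ₗ[K] K)) *
      (tmulF (1 : WithConv (H →ₗ[K] K)) (copF (dualEo K H i)) * Fminus K V H) * C.Qp) =
      tmulF (dualE K H i) (copF (dualE K H j)) * Fplus K V H := by
    rw [mul_assoc, mul_assoc, ← mul_assoc, h1, mul_assoc, ← mul_assoc (onCop C.Rm), h2,
      mul_assoc, Fplus_eq, ← mul_assoc, tmulF_mul, one_mul, mul_one]
  rw [h3, ← apply_ract, ract_tmulF, ract_copF, ract_dualE, lact_dualE, Fplus_tmul,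
    Matrix.mul_apply]
  refine Finset.sum_congr rfl fun k _ => ?_
  rw [Matrix.transpose_apply, rep_apply, rep_apply, ← mul_assoc, ← mul_assoc, counit_mul_eo]

theorem entry_conv {p q : H →ₗ[K] Matrix V V K} {f g : V → V → WithConv (H →ₗ[K] K)}
    (hp : ∀ i k x, p x i k = f i k x) (hq : ∀ k j x, q x k j = g k j x) (i j : V) (a : H) :
    (LinearMap.mul' K (Matrix V V K) (TensorProduct.map p q (comul (R := K) a))) i j =
      ∑ k, (f i k * g k j) a := by
  simp only [conv_apply']
  generalize comul (R := K) a = x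
  induction x with
  | zero => simp
  | add x y hx hy =>
    simp only [map_add, Finset.sum_add_distrib, ← hx, ← hy]
    rfl
  | tmul x y =>
    simp only [map_tmul, LinearMap.mul'_apply, Matrix.mul_apply, hp, hq]
    simp

theorem preRep_rel ⦃x y : TensorAlgebra K (H × H)⦄ (h : HcRel C x y) :
    preRep (V := V) x = preRep y := by
  induction h with
  | one => simp [preRep_genL]
  | mul a b => simp [preRep_genL]
  | sig_mul a b => simp [preRep_genS]
  | sig_e i => rw [preRep_genL, preRep_genS, rep_e, rep_eo, Matrix.transpose_single]
  | sig_eo i => rw [preRep_genL, preRep_genS, rep_e, rep_eo, Matrix.transpose_single]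
  | straighten b c => exact preRep_straighten C b c
  | antipode_left a =>
    rw [map_mul_map, preRep_genL]
    ext i j
    rw [entry_conv (f := fun i k => dualEo K H k * dualE K H i)
      (g := fun k j => dualEo K H k * dualE K H j)]
    · have h1 : ∀ k : V, ((dualEo K H k * dualE K H i) * (dualEo K H k * dualE K H j)) a =
          counit (R := K) (e K k * (a * e K j * e K i)) := fun k => by
        rw [← apply_ract, ract_mul, ract_dualEo, ract_dualE, mul_dualE, dualEo_apply]
        simp only [← mul_assoc]
        rw [mul_assoc _ (eo K i) (e K j), ← e_mul_eo, ← mul_assoc, counit_mul_eo, e_mul_eo]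
        simp only [mul_assoc]
        rw [counit_eo_mul, ← mul_assoc, e_mul_e, if_pos rfl]
      simp_rw [h1]
      rw [← map_sum, ← Finset.sum_mul, sum_e, one_mul, mul_assoc, e_mul_e, Eplus, map_sum]
      simp only [map_smul, rep_e, Matrix.sum_apply, Matrix.smul_apply, Matrix.single_apply]
      by_cases h : i = j
      · subst h
        simp
      · simp [h, ite_and, Ne.symm h]
    · intro i k x
      rw [LinearMap.comp_apply, AlgHom.toLinearMap_apply, preRep_genS, Matrix.transpose_apply,
        rep_apply, mul_dualE, dualEo_apply, mul_assoc]
    · intro k j x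
      rw [LinearMap.comp_apply, AlgHom.toLinearMap_apply, preRep_genL,
        rep_apply, mul_dualE, dualEo_apply, mul_assoc]
  | antipode_right a =>
    rw [map_mul_map, preRep_genL]
    ext i j
    rw [entry_conv (f := fun i k => dualEo K H i * dualE K H k)
      (g := fun k j => dualEo K H j * dualE K H k)]
    · have h1 : ∀ k : V, ((dualEo K H i * dualE K H k) * (dualEo K H j * dualE K H k)) a =
          counit (R := K) (e K i * (e K j * a) * e K k) := fun k => by
        rw [← apply_ract, ract_mul, ract_dualEo, ract_dualE, mul_dualE, dualEo_apply]
        simp only [← mul_assoc]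
        rw [mul_assoc _ (eo K k) (e K k), ← e_mul_eo, ← mul_assoc, counit_mul_eo, mul_assoc _ (e K k),
            e_mul_e, if_pos rfl, e_mul_eo]
        simp only [mul_assoc]
        rw [counit_eo_mul]
      simp_rw [h1]
      rw [← map_sum, ← Finset.mul_sum, sum_e, mul_one, ← mul_assoc, e_mul_e, Eminus, map_sum]
      simp only [map_smul, rep_eo, Matrix.sum_apply, Matrix.smul_apply, Matrix.single_apply]
      by_cases h : i = j
      · subst h
        simp
      · simp [h, ite_and, Ne.symm h]
    · intro i k x
      rw [LinearMap.comp_apply, AlgHom.toLinearMap_apply, preRep_genL,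
        rep_apply, mul_dualE, dualEo_apply, mul_assoc]
    · intro k j x
      rw [LinearMap.comp_apply, AlgHom.toLinearMap_apply, preRep_genS, Matrix.transpose_apply,
        rep_apply, mul_dualE, dualEo_apply, mul_assoc]

/-- The matrix representation of `Hc(H)`. -/
def repHc : Hc C →ₐ[K] Matrix V V K := lift C preRep (preRep_rel C)

theorem repHc_iota (a : H) : repHc C (iota C a) = rep K V H a := by
  rw [← mk_genL, repHc, lift_mk, preRep_genL]

theorem repHc_sig (a : H) : repHc C (sig C a) = (rep K V H a).transpose := by
  rw [← mk_genS, repHc, lift_mk, preRep_genS]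

/-! #### The comultiplication -/

/-- `Δ(a) = ∑ a₁ ⊗ a₂`. -/
def comulL : H →ₗ[K] Hc C ⊗[K] Hc C :=
  TensorProduct.map (iota C).toLinearMap (iota C).toLinearMap ∘ₗ comul

/-- `Δ(σ(b)) = ∑ σ(b₂) ⊗ σ(b₁)`. -/
def comulS : H →ₗ[K] Hc C ⊗[K] Hc C :=
  (TensorProduct.comm K _ _).toLinearMap ∘ₗ TensorProduct.map (sig C) (sig C) ∘ₗ comul

theorem iota_map_mul (x y : H ⊗[K] H) :
    TensorProduct.map (iota C).toLinearMap (iota C).toLinearMap (x * y) =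
      TensorProduct.map (iota C).toLinearMap (iota C).toLinearMap x *
        TensorProduct.map (iota C).toLinearMap (iota C).toLinearMap y :=
  map_mul (Algebra.TensorProduct.map (iota C) (iota C)) x y

theorem sig_map_mul (x y : H ⊗[K] H) :
    TensorProduct.comm K _ _ (TensorProduct.map (sig C) (sig C) (x * y)) =
      TensorProduct.comm K _ _ (TensorProduct.map (sig C) (sig C) y) *
        TensorProduct.comm K _ _ (TensorProduct.map (sig C) (sig C) x) := by
  induction x with
  | zero => simp
  | add x x' hx hy => simp only [map_add, add_mul, mul_add, hx, hy]
  | tmul x x' =>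
    induction y with
    | zero => simp
    | add y y' hx hy => simp only [map_add, add_mul, mul_add, hx, hy]
    | tmul y y' => simp [sig_mul]

theorem comulL_mul (a b : H) : comulL C (a * b) = comulL C a * comulL C b := by
  simp only [comulL, LinearMap.comp_apply]
  rw [FaceAlgebra.comul_mul (V := V), iota_map_mul]

theorem comulS_mul (a b : H) : comulS C (a * b) = comulS C b * comulS C a := by
  simp only [comulS, LinearMap.comp_apply, LinearEquiv.coe_coe]
  rw [FaceAlgebra.comul_mul (V := V), sig_map_mul]

theorem comulL_e (i : V) : comulL C (e K i) =
    ∑ k : V, iota C (e K k) ⊗ₜ[K] iota C (eo K k * e K i) := by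
  simp [comulL, comul_e, -map_mul]

theorem comulL_eo (i : V) : comulL C (eo K i) =
    ∑ k : V, iota C (eo K i * e K k) ⊗ₜ[K] iota C (eo K k) := by
  simp [comulL, comul_eo', comul_one K V H, Finset.mul_sum, -map_mul]

theorem comulS_e (i : V) : comulS C (e K i) = comulL C (eo K i) := by
  simp [comulS, comul_e, comulL_eo, sig_mul, sig_e, sig_eo, e_mul_eo]

theorem comulS_eo (i : V) : comulS C (eo K i) = comulL C (e K i) := by
  simp [comulS, comulL_e, comul_eo', comul_one K V H, Finset.mul_sum, sig_mul, sig_e, sig_eo,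
    e_mul_eo]

theorem comulL_one_idem : IsIdempotentElem (comulL C 1) := by
  rw [IsIdempotentElem, ← comulL_mul, one_mul]

theorem comulS_one : comulS C 1 = comulL C 1 := by
  rw [← sum_e (K := K) (V := V) (H := H), map_sum]
  simp_rw [comulS_e]
  rw [← map_sum, sum_e, sum_eo]

/-- The comultiplication on the free algebra. -/
def preComul : TensorAlgebra K (H × H) →ₐ[K] (comulL_one_idem C).Corner :=
  TensorAlgebra.lift K ((toCorner _ (comulL C)
      (fun a => by rw [← comulL_mul, one_mul]) (fun a => by rw [← comulL_mul, mul_one])).coprod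
    (toCorner _ (comulS C) (fun a => by rw [← comulS_one, ← comulS_mul, mul_one])
      (fun a => by rw [← comulS_one, ← comulS_mul, one_mul])))

/-- The comultiplication on the free algebra, as a linear map. -/
def preD : TensorAlgebra K (H × H) →ₗ[K] Hc C ⊗[K] Hc C :=
  cornerVal (K := K) (comulL_one_idem C) ∘ₗ (preComul C).toLinearMap

theorem preD_mul (x y : TensorAlgebra K (H × H)) : preD C (x * y) = preD C x * preD C y :=
  congrArg (cornerVal (K := K) _) (map_mul (preComul C) x y)

theorem preD_one : preD C 1 = comulL C 1 :=
  congrArg (cornerVal (K := K) _) (map_one (preComul C))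

theorem preD_genL (a : H) :
    preD C (genL K H a) = comulL C a := by
  simp [preD, preComul, genL]

theorem preD_genS (a : H) :
    preD C (genS K H a) = comulS C a := by
  simp [preD, preComul, genS]

theorem preD_prodLS (x : H ⊗[K] Cop H) :
    preD C (prodLS (genL K H) (genS K H) x) =
      TensorProduct.comm K _ _ (TensorProduct.map (prodLS (iota C).toLinearMap (sig C))
        (prodLS (iota C).toLinearMap (sig C)) (comul x)) := by
  have : preD C ∘ₗ prodLS (genL K H) (genS K H) =
      (TensorProduct.comm K _ _).toLinearMap ∘ₗ TensorProduct.map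
        (prodLS (iota C).toLinearMap (sig C)) (prodLS (iota C).toLinearMap (sig C)) ∘ₗ comul := by
    refine cop_ext fun b c => ?_
    change preD C (genL K H c * genS K H b) = _
    simp only [LinearMap.comp_apply, preD_mul, preD_genL, preD_genS, comulL, comulS, TensorProduct.comul_tmul,
      comul_toCop]
    generalize comul (R := K) b = y
    generalize comul (R := K) c = z
    induction y with
    | zero => simp
    | add x x' hx hy => simp only [map_add, add_tmul, mul_add, hx, hy]
    | tmul x x' =>
      induction z with
      | zero => simp
      | add y y' hx hy => simp only [map_add, tmul_add, add_mul, hx, hy]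
      | tmul y y' => simp
  exact LinearMap.congr_fun this x

theorem preD_prodSL (b c : H) :
    comulS C b * comulL C c =
      TensorProduct.comm K _ _ (TensorProduct.map (prodSL (iota C).toLinearMap (sig C))
        (prodSL (iota C).toLinearMap (sig C)) (comul (b ⊗ₜ toCop K H c))) := by
  simp only [comulL, comulS, TensorProduct.comul_tmul, comul_toCop, LinearMap.comp_apply]
  generalize comul (R := K) b = y
  generalize comul (R := K) c = z
  induction y with
  | zero => simp
  | add x x' hx hy => simp only [map_add, add_tmul, add_mul, hx, hy]
  | tmul x x' =>
    induction z with
    | zero => simp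
    | add y y' hx hy => simp only [map_add, tmul_add, mul_add, hx, hy]
    | tmul y y' => simp

theorem prodLS_lact_Fminus (x : H ⊗[K] Cop H) :
    prodLS (iota C).toLinearMap (sig C) (lact (Fminus K V H) x) =
      prodLS (iota C).toLinearMap (sig C) x := by
  have : prodLS (iota C).toLinearMap (sig C) ∘ₗ lact (Fminus K V H) =
      prodLS (iota C).toLinearMap (sig C) := by
    refine cop_ext fun b c => ?_
    simp only [LinearMap.comp_apply, Fminus, lact_sum, lact_tmulF, lact_copF, lact_dualE,
      ract_dualE, map_sum, prodLS_apply, AlgHom.toLinearMap_apply, sig_mul, sig_e]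
    simp only [← mul_assoc, ← map_mul]
    simp only [mul_assoc c, eo_mul_eo, if_true]
    rw [← Finset.sum_mul, ← map_sum, ← Finset.mul_sum, sum_eo, mul_one]
  exact LinearMap.congr_fun this x

theorem comul_straighten (x : H ⊗[K] Cop H) :
    TensorProduct.map (prodSL (iota C).toLinearMap (sig C)) (prodSL (iota C).toLinearMap (sig C))
      (comul x) = TensorProduct.map (prodLS (iota C).toLinearMap (sig C))
        (prodLS (iota C).toLinearMap (sig C)) (comul (twist C x)) := by
  set m := prodLS (iota C).toLinearMap (sig C) with hm
  set Q := C.Qp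
  set R := onCop C.Rm
  set F := Fminus K V H with hF
  have hs : prodSL (iota C).toLinearMap (sig C) = m ∘ₗ lact Q ∘ₗ ract R :=
    LinearMap.ext fun y => straighten C y
  have hl : m ∘ₗ lact F = m := LinearMap.ext fun y => prodLS_lact_Fminus C y
  have hc : ∀ f g : WithConv (H ⊗[K] Cop H →ₗ[K] K), lact f ∘ₗ ract g = ract g ∘ₗ lact f :=
    fun f g => LinearMap.ext fun y => lact_ract_comm f g y
  have hr : ract R ∘ₗ ract Q = ract F := LinearMap.ext fun y => by
    rw [LinearMap.comp_apply, ← ract_mul, C.genInv_Qp.mul_eq_ep]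
  rw [twist, LinearMap.comp_apply, comul_lact, comul_ract, hs]
  have key : ∀ (f g : H ⊗[K] Cop H →ₗ[K] Hc C) (X : WithConv (H ⊗[K] Cop H →ₗ[K] K)),
      TensorProduct.map (f ∘ₗ lact X) g (comul x) = TensorProduct.map f (g ∘ₗ ract X) (comul x) := by
    intro f g X
    have h := congrArg (TensorProduct.map f g) (lact_ract_mid X x)
    rw [LinearMap.map_rTensor, LinearMap.map_lTensor] at h
    exact h
  rw [LinearMap.map_lTensor, LinearMap.map_rTensor]
  calc TensorProduct.map (m ∘ₗ lact Q ∘ₗ ract R) (m ∘ₗ lact Q ∘ₗ ract R) (comul x)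
      = TensorProduct.map ((m ∘ₗ ract R) ∘ₗ lact Q) (m ∘ₗ lact Q ∘ₗ ract R) (comul x) := by
        rw [LinearMap.comp_assoc, ← hc]
    _ = TensorProduct.map (m ∘ₗ ract R) ((m ∘ₗ lact Q) ∘ₗ ract F) (comul x) := by
        rw [key, ← hr]
        rfl
    _ = TensorProduct.map (m ∘ₗ lact F ∘ₗ ract R) (m ∘ₗ lact Q) (comul x) := by
        rw [← key, LinearMap.comp_assoc, ← hc]
    _ = _ := by rw [← LinearMap.comp_assoc, hl]

/-- `(u ⊗ v) ⊗ (w ⊗ z) ↦ m(v ⊗ w) ⊗ m(u ⊗ z)`. -/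
def nest {A : Type*} [Ring A] [Algebra K A] (m : H ⊗[K] H →ₗ[K] A) :
    (H ⊗[K] H) ⊗[K] (H ⊗[K] H) →ₗ[K] A ⊗[K] A :=
  TensorProduct.map m m ∘ₗ (TensorProduct.leftComm K H (H ⊗[K] H) H).toLinearMap ∘ₗ
    (TensorProduct.assoc K H H H).symm.toLinearMap.lTensor H ∘ₗ
    (TensorProduct.assoc K H H (H ⊗[K] H)).toLinearMap

theorem nest_comul {A : Type*} [Ring A] [Algebra K A] (m : H ⊗[K] H →ₗ[K] A)
    (f : V → WithConv (H →ₗ[K] K)) (z w : V → A)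
    (h1 : ∀ a : H, m (comul (R := K) a) = ∑ k, f k a • z k)
    (h2 : ∀ k x y, m (x ⊗ₜ ract (f k) y) = m (x ⊗ₜ y) * w k) (a : H) :
    nest m (TensorProduct.map comul comul (comul (R := K) a)) =
      ∑ k, z k ⊗ₜ[K] (m (comul (R := K) a) * w k) := by
  have e1 : ∀ t : H ⊗[K] H, TensorProduct.assoc K H H (H ⊗[K] H)
      (TensorProduct.map comul comul t) = ((comul (R := K) (A := H)).lTensor H).lTensor H
        (TensorProduct.assoc K H H H (comul.rTensor H t)) := by
    intro t
    induction t with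
    | zero => simp
    | add x y hx hy => simp only [map_add, hx, hy]
    | tmul x y =>
      simp only [map_tmul, LinearMap.rTensor_tmul]
      generalize comul (R := K) x = p
      induction p with
      | zero => simp
      | add x y hx hy => simp only [map_add, add_tmul, hx, hy]
      | tmul x y => simp
  have e2 : ∀ t : H ⊗[K] H, TensorProduct.map m m (TensorProduct.leftComm K H (H ⊗[K] H) H
      ((TensorProduct.assoc K H H H).symm.toLinearMap.lTensor H
        (((comul (R := K) (A := H)).lTensor H).lTensor H (comul.lTensor H t)))) =
        ∑ k, z k ⊗ₜ[K] (m t * w k) := by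
    intro t
    induction t with
    | zero => simp
    | add x y hx hy => simp only [map_add, hx, hy, add_mul, tmul_add, Finset.sum_add_distrib]
    | tmul x y =>
      simp only [LinearMap.lTensor_tmul, LinearEquiv.coe_coe]
      rw [← Coalgebra.coassoc_apply, LinearEquiv.symm_apply_apply]
      have e3 : ∀ k, m (x ⊗ₜ y) * w k = m (x ⊗ₜ ract (f k) y) := fun k => (h2 k x y).symm
      simp only [e3, ract, LinearMap.comp_apply]
      generalize comul (R := K) y = p
      induction p with
      | zero => simp
      | add x y hx hy => simp only [map_add, tmul_add, hx, hy, Finset.sum_add_distrib]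
      | tmul p q => simp [h1, sum_tmul, smul_tmul, tmul_smul]
  simp only [nest, LinearMap.comp_apply, LinearEquiv.coe_coe]
  rw [e1, Coalgebra.coassoc_apply]
  exact e2 _

theorem comul_antipode_left (a : H) :
    preD C (LinearMap.mul' K _
      (TensorProduct.map (genS K H) (genL K H) (comul (R := K) a))) =
    comulL C (Eplus K V a) := by
  have e1 : ∀ t : H ⊗[K] H, preD C (LinearMap.mul' K _
      (TensorProduct.map (genS K H) (genL K H) t)) =
      nest (LinearMap.mul' K _ ∘ₗ TensorProduct.map (sig C) (iota C).toLinearMap)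
        (TensorProduct.map comul comul t) := by
    intro t
    induction t with
    | zero => simp
    | add x y hx hy => simp only [map_add, hx, hy]
    | tmul x y =>
      simp only [map_tmul, LinearMap.mul'_apply, preD_mul, preD_genL,
        preD_genS, comulL, comulS, LinearMap.comp_apply]
      generalize comul (R := K) x = p
      generalize comul (R := K) y = q
      induction p with
      | zero => simp
      | add x x' hx hy => simp only [map_add, add_tmul, add_mul, hx, hy]
      | tmul x x' =>
        induction q with
        | zero => simp
        | add y y' hx hy => simp only [map_add, tmul_add, mul_add, hx, hy]
        | tmul y y' => simp [nest]
  rw [e1, nest_comul _ (fun k : V => dualE K H k) (fun k : V => iota C (e K k))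
    (fun k : V => iota C (eo K k))]
  · simp only [LinearMap.comp_apply, antipode_left, Eplus, map_sum, map_smul, comulL_e,
      Finset.sum_mul, tmul_sum, smul_mul_assoc, tmul_smul, Finset.smul_sum]
    rw [Finset.sum_comm]
    simp only [← map_mul, e_mul_eo]
  · intro a
    simp [antipode_left, Eplus]
  · intro k x y
    simp [ract_dualE, mul_assoc]

theorem comul_antipode_right (a : H) :
    preD C (LinearMap.mul' K _
      (TensorProduct.map (genL K H) (genS K H) (comul (R := K) a))) =
    comulL C (Eminus K V a) := by
  have e1 : ∀ t : H ⊗[K] H, preD C (LinearMap.mul' K _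
      (TensorProduct.map (genL K H) (genS K H) t)) = TensorProduct.comm K _ _ (
      nest (LinearMap.mul' K _ ∘ₗ TensorProduct.map (iota C).toLinearMap (sig C))
        (TensorProduct.map comul comul t)) := by
    intro t
    induction t with
    | zero => simp
    | add x y hx hy => simp only [map_add, hx, hy]
    | tmul x y =>
      simp only [map_tmul, LinearMap.mul'_apply, preD_mul, preD_genL,
        preD_genS, comulL, comulS, LinearMap.comp_apply]
      generalize comul (R := K) x = p
      generalize comul (R := K) y = q
      induction p with
      | zero => simp
      | add x x' hx hy => simp only [map_add, add_tmul, add_mul, hx, hy]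
      | tmul x x' =>
        induction q with
        | zero => simp
        | add y y' hx hy => simp only [map_add, tmul_add, mul_add, hx, hy]
        | tmul y y' => simp [nest]
  rw [e1, nest_comul _ (fun k : V => dualEo K H k) (fun k : V => iota C (eo K k))
    (fun k : V => iota C (e K k))]
  · simp only [LinearMap.comp_apply, antipode_right, Eminus, map_sum, map_smul, comulL_eo,
      Finset.sum_mul, tmul_sum, smul_mul_assoc, tmul_smul, Finset.smul_sum, comm_tmul]
    rw [Finset.sum_comm]
    simp only [← map_mul]
  · intro a
    simp [antipode_right, Eminus]
  · intro k x y
    simp [ract_dualEo, mul_assoc, sig_mul, sig_eo]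

theorem preComul_rel ⦃x y : TensorAlgebra K (H × H)⦄ (h : HcRel C x y) :
    preComul C x = preComul C y := by
  refine cornerVal_injective K _ ?_
  change preD C x = preD C y
  induction h with
  | one => rw [preD_genL, preD_one]
  | mul a b => rw [preD_mul, preD_genL, preD_genL, preD_genL, comulL_mul]
  | sig_mul a b => rw [preD_mul, preD_genS, preD_genS, preD_genS, comulS_mul]
  | sig_e i => rw [preD_genL, preD_genS, comulS_e]
  | sig_eo i => rw [preD_genL, preD_genS, comulS_eo]
  | straighten b c =>
    rw [preD_mul, preD_genL, preD_genS, preD_prodSL, preD_prodLS,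
      comul_straighten]
  | antipode_left a => rw [comul_antipode_left, preD_genL]
  | antipode_right a => rw [comul_antipode_right, preD_genL]

/-- The comultiplication of `Hc(H)`. -/
def comulHc : Hc C →ₐ[K] (comulL_one_idem C).Corner := lift C (preComul C) (preComul_rel C)

theorem comulHc_iota (a : H) : cornerVal (K := K) _ (comulHc C (iota C a)) = comulL C a := by
  rw [← mk_genL, comulHc, lift_mk]
  exact preD_genL C a

theorem comulHc_sig (b : H) : cornerVal (K := K) _ (comulHc C (sig C b)) = comulS C b := by
  rw [← mk_genS, comulHc, lift_mk]
  exact preD_genS C b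

theorem adjoin_top : Algebra.adjoin K (Set.range (iota C) ∪ Set.range (sig C)) = ⊤ := by
  rw [eq_top_iff]
  rintro x -
  obtain ⟨x, rfl⟩ := mk_surjective C x
  induction x using TensorAlgebra.induction with
  | algebraMap r => rw [AlgHom.commutes]; exact Subalgebra.algebraMap_mem _ r
  | ι x =>
    have : TensorAlgebra.ι K x = genL K H x.1 + genS K H x.2 := by
      rw [genL, genS, LinearMap.comp_apply, LinearMap.comp_apply, ← map_add]
      simp
    rw [this, map_add]
    exact add_mem (Algebra.subset_adjoin (Or.inl ⟨_, rfl⟩))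
      (Algebra.subset_adjoin (Or.inr ⟨_, rfl⟩))
  | mul x y hx hy => rw [map_mul]; exact mul_mem hx hy
  | add x y hx hy => rw [map_add]; exact add_mem hx hy

theorem coassoc_gen (D : Hc C →ₗ[K] Hc C ⊗[K] Hc C) (hl : ∀ a, D (iota C a) = comulL C a)
    (hs : ∀ b, D (sig C b) = comulS C b) (x : Hc C)
    (hx : x ∈ Set.range (iota C) ∪ Set.range (sig C)) :
    TensorProduct.assoc K _ _ _ (D.rTensor _ (D x)) = D.lTensor _ (D x) := by
  have hl' : ∀ a, D ((iota C).toLinearMap a) = comulL C a := hl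
  rcases hx with ⟨x, rfl⟩ | ⟨x, rfl⟩
  · have e1 : ∀ t : H ⊗[K] H, TensorProduct.assoc K _ _ _ (D.rTensor _
        (TensorProduct.map (iota C).toLinearMap (iota C).toLinearMap t)) =
        TensorProduct.map (iota C).toLinearMap (TensorProduct.map (iota C).toLinearMap
          (iota C).toLinearMap) (TensorProduct.assoc K H H H (comul.rTensor H t)) := by
      intro t
      induction t with
      | zero => simp
      | add x y hx hy => simp only [map_add, hx, hy]
      | tmul x y =>
        simp only [map_tmul, LinearMap.rTensor_tmul, hl', comulL, LinearMap.comp_apply]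
        generalize comul (R := K) x = p
        induction p with
        | zero => simp
        | add x y hx hy => simp only [map_add, add_tmul, hx, hy]
        | tmul x y => simp
    have e2 : ∀ t : H ⊗[K] H, D.lTensor _
        (TensorProduct.map (iota C).toLinearMap (iota C).toLinearMap t) =
        TensorProduct.map (iota C).toLinearMap (TensorProduct.map (iota C).toLinearMap
          (iota C).toLinearMap) (comul.lTensor H t) := by
      intro t
      induction t with
      | zero => simp
      | add x y hx hy => simp only [map_add, hx, hy]
      | tmul x y => simp only [map_tmul, LinearMap.lTensor_tmul, hl', comulL, LinearMap.comp_apply]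
    rw [hl, comulL, LinearMap.comp_apply, e1, e2, Coalgebra.coassoc_apply]
  · let rev : H ⊗[K] (H ⊗[K] H) →ₗ[K] Hc C ⊗[K] (Hc C ⊗[K] Hc C) :=
      TensorProduct.map (sig C) (TensorProduct.map (sig C) (sig C)) ∘ₗ
        (TensorProduct.assoc K H H H).toLinearMap ∘ₗ
        (TensorProduct.comm K H H).toLinearMap.rTensor H ∘ₗ
        (TensorProduct.comm K H (H ⊗[K] H)).toLinearMap
    have e1 : ∀ t : H ⊗[K] H, TensorProduct.assoc K _ _ _ (D.rTensor _
        (TensorProduct.comm K _ _ (TensorProduct.map (sig C) (sig C) t))) =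
        rev (comul.lTensor H t) := by
      intro t
      induction t with
      | zero => simp
      | add x y hx hy => simp only [map_add, hx, hy]
      | tmul x y =>
        simp only [map_tmul, LinearMap.rTensor_tmul, LinearMap.lTensor_tmul, comm_tmul, hs, comulS,
          LinearMap.comp_apply]
        generalize comul (R := K) y = p
        induction p with
        | zero => simp
        | add x y hx hy => simp only [map_add, add_tmul, tmul_add, hx, hy]
        | tmul x y => simp [rev]
    have e2 : ∀ t : H ⊗[K] H, D.lTensor _
        (TensorProduct.comm K _ _ (TensorProduct.map (sig C) (sig C) t)) =
        rev (TensorProduct.assoc K H H H (comul.rTensor H t)) := by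
      intro t
      induction t with
      | zero => simp
      | add x y hx hy => simp only [map_add, hx, hy]
      | tmul x y =>
        simp only [map_tmul, LinearMap.rTensor_tmul, LinearMap.lTensor_tmul, comm_tmul, hs, comulS,
          LinearMap.comp_apply]
        generalize comul (R := K) x = p
        induction p with
        | zero => simp
        | add x y hx hy => simp only [map_add, add_tmul, tmul_add, hx, hy]
        | tmul x y => simp [rev]
    rw [hs, comulS, LinearMap.comp_apply, LinearMap.comp_apply, LinearEquiv.coe_coe, e1, e2,
      Coalgebra.coassoc_apply]

theorem counit_gen (D : Hc C →ₗ[K] Hc C ⊗[K] Hc C) (hl : ∀ a, D (iota C a) = comulL C a)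
    (hs : ∀ b, D (sig C b) = comulS C b) (ep : Hc C →ₗ[K] K)
    (el : ∀ a, ep (iota C a) = counit (R := K) a) (es : ∀ a, ep (sig C a) = counit (R := K) a)
    (x : Hc C) (hx : x ∈ Set.range (iota C) ∪ Set.range (sig C)) :
    ep.rTensor _ (D x) = 1 ⊗ₜ[K] x ∧ ep.lTensor _ (D x) = x ⊗ₜ[K] 1 := by
  have el' : ∀ a, ep ((iota C).toLinearMap a) = counit (R := K) a := el
  rcases hx with ⟨x, rfl⟩ | ⟨x, rfl⟩
  · have h1 := congrArg ((iota C).toLinearMap.lTensor K) (Coalgebra.rTensor_counit_comul (R := K) x)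
    have h2 := congrArg ((iota C).toLinearMap.rTensor K) (Coalgebra.lTensor_counit_comul (R := K) x)
    rw [LinearMap.lTensor_tmul] at h1
    rw [LinearMap.rTensor_tmul] at h2
    rw [hl, comulL, LinearMap.comp_apply]
    refine ⟨Eq.trans ?_ h1, Eq.trans ?_ h2⟩
    · generalize comul (R := K) x = p
      induction p with
      | zero => simp
      | add x y hx hy => simp only [map_add, hx, hy]
      | tmul x y => simp [el]
    · generalize comul (R := K) x = p
      induction p with
      | zero => simp
      | add x y hx hy => simp only [map_add, hx, hy]
      | tmul x y => simp [el]
  · have h1 := congrArg (fun t => TensorProduct.comm K _ _ ((sig C).rTensor K t))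
      (Coalgebra.lTensor_counit_comul (R := K) x)
    have h2 := congrArg (fun t => TensorProduct.comm K _ _ ((sig C).lTensor K t))
      (Coalgebra.rTensor_counit_comul (R := K) x)
    simp only [LinearMap.lTensor_tmul, LinearMap.rTensor_tmul, comm_tmul] at h1 h2
    rw [hs, comulS, LinearMap.comp_apply, LinearMap.comp_apply, LinearEquiv.coe_coe]
    refine ⟨Eq.trans ?_ h1, Eq.trans ?_ h2⟩
    · generalize comul (R := K) x = p
      induction p with
      | zero => simp
      | add x y hx hy => simp only [map_add, hx, hy]
      | tmul x y => simp [es]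
    · generalize comul (R := K) x = p
      induction p with
      | zero => simp
      | add x y hx hy => simp only [map_add, hx, hy]
      | tmul x y => simp [es]

theorem eps_iota (a : H) :
    (entrySum K V ∘ₗ (repHc C).toLinearMap) (iota C a) = counit (R := K) a := by
  rw [LinearMap.comp_apply, AlgHom.toLinearMap_apply, repHc_iota, entrySum_rep]

theorem eps_sig (a : H) :
    (entrySum K V ∘ₗ (repHc C).toLinearMap) (sig C a) = counit (R := K) a := by
  rw [LinearMap.comp_apply, AlgHom.toLinearMap_apply, repHc_sig, entrySum_transpose,
    entrySum_rep]

/-- The face algebra structure of `Hc(H)`: `Δ(a σ(b)) = ∑ a₁ σ(b₂) ⊗ a₂ σ(b₁)`,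
`ε(a σ(b)) = ∑ ε(a e k) ε(b e k)`. -/
def datum : FaceDatum K V (Hc C) where
  e i := iota C (e K i)
  eo i := iota C (eo K i)
  e_mul_e i j := by rw [← map_mul, e_mul_e, apply_ite (iota C), map_zero]
  eo_mul_eo i j := by rw [← map_mul, eo_mul_eo, apply_ite (iota C), map_zero]
  e_mul_eo i j := by rw [← map_mul, e_mul_eo, map_mul]
  sum_e := by rw [← map_sum, sum_e, map_one]
  sum_eo := by rw [← map_sum, sum_eo, map_one]
  D := cornerVal (K := K) _ ∘ₗ (comulHc C).toLinearMap
  D_mul a b := congrArg (cornerVal (K := K) _) (map_mul (comulHc C) a b)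
  D_eo_mul_e i j := by
    rw [← map_mul]
    refine (comulHc_iota C _).trans ?_
    rw [comulL, LinearMap.comp_apply, comul_eo_mul_e, map_sum]
    simp
  ρ := repHc C
  ρ_e i := by rw [repHc_iota, rep_e]
  ρ_eo i := by rw [repHc_iota, rep_eo]
  gen := Set.range (iota C) ∪ Set.range (sig C)
  gen_top := adjoin_top C
  coassoc_gen := coassoc_gen C _ (comulHc_iota C) (comulHc_sig C)
  counit_left_gen x hx := (counit_gen C _ (comulHc_iota C) (comulHc_sig C) _ (eps_iota C)
    (eps_sig C) x hx).1
  counit_right_gen x hx := (counit_gen C _ (comulHc_iota C) (comulHc_sig C) _ (eps_iota C)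
    (eps_sig C) x hx).2

end Hc

instance : Coalgebra K (Hc C) := (Hc.datum C).toCoalgebra
instance : FaceAlgebra K V (Hc C) := (Hc.datum C).toFaceAlgebra

end Hc

open FaceAlgebra

/-! ### The face algebra of a finite oriented graph -/

/-- An oriented graph with vertices `V` and edges `E`. -/
structure OGraph (V E : Type*) where
  /-- the source of an edge -/
  src : E → V
  /-- the range of an edge -/
  tgt : E → V

namespace OGraph

variable {V E : Type*} (G : OGraph V E)

/-- `G.IsPath i l`: the edges in `l` form a path with source `i`. -/
def IsPath : V → List E → Prop
  | _, [] => True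
  | i, p :: l => G.src p = i ∧ IsPath (G.tgt p) l

/-- The range of the path with source `i` and edges `l`. -/
def endpt : V → List E → V
  | i, [] => i
  | _, p :: l => endpt (G.tgt p) l

theorem endpt_append (i : V) (l m : List E) : G.endpt i (l ++ m) = G.endpt (G.endpt i l) m := by
  induction l generalizing i with
  | nil => rfl
  | cons p l ih => exact ih _

theorem isPath_append (i : V) (l m : List E) :
    G.IsPath i (l ++ m) ↔ G.IsPath i l ∧ G.IsPath (G.endpt i l) m := by
  induction l generalizing i with
  | nil => simp [IsPath, endpt]
  | cons p l ih => simp [IsPath, endpt, ih, and_assoc]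

/-- The paths of `G`, of arbitrary length. The paths of length `0` are the vertices. -/
@[ext] structure Path where
  /-- the source -/
  s : V
  /-- the edges -/
  edges : List E
  isPath : G.IsPath s edges

namespace Path

variable {G}

instance : DecidableEq G.Path := Classical.decEq _

/-- The range of a path. -/
def r (p : G.Path) : V := G.endpt p.s p.edges

/-- The length of a path. -/
def len (p : G.Path) : ℕ := p.edges.length

/-- A vertex, as a path of length `0`. -/
def vert (G : OGraph V E) (i : V) : G.Path := ⟨i, [], trivial⟩

/-- An edge, as a path of length `1`. -/
def edge (G : OGraph V E) (p : E) : G.Path := ⟨G.src p, [p], rfl, trivial⟩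

open Classical in
/-- The concatenation `p · q` if the range of `p` is the source of `q` (and a junk value
otherwise). -/
def cat (p q : G.Path) : G.Path :=
  if h : p.r = q.s then ⟨p.s, p.edges ++ q.edges,
    (G.isPath_append _ _ _).2 ⟨p.isPath, by have := q.isPath; rwa [← h] at this⟩⟩ else p

theorem cat_s (p q : G.Path) : (p.cat q).s = p.s := by
  unfold cat
  split_ifs <;> rfl

theorem cat_edges {p q : G.Path} (h : p.r = q.s) : (p.cat q).edges = p.edges ++ q.edges := by
  rw [cat, dif_pos h]

theorem cat_r {p q : G.Path} (h : p.r = q.s) : (p.cat q).r = q.r := by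
  rw [r, cat_s, cat_edges h, endpt_append]
  exact congrArg (fun i => G.endpt i q.edges) h

theorem cat_len {p q : G.Path} (h : p.r = q.s) : (p.cat q).len = p.len + q.len := by
  rw [len, cat_edges h, List.length_append]
  rfl

theorem cat_assoc {p q t : G.Path} (h : p.r = q.s) (h' : q.r = t.s) :
    (p.cat q).cat t = p.cat (q.cat t) := by
  have h1 : (p.cat q).r = t.s := (cat_r h).trans h'
  have h2 : p.r = (q.cat t).s := h.trans (cat_s q t).symm
  ext1
  · rw [cat_s, cat_s, cat_s]
  · rw [cat_edges h1, cat_edges h, cat_edges h2, cat_edges h', List.append_assoc]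

@[simp] theorem vert_s (i : V) : (vert G i).s = i := rfl
@[simp] theorem vert_r (i : V) : (vert G i).r = i := rfl
@[simp] theorem vert_len (i : V) : (vert G i).len = 0 := rfl

theorem vert_inj {i j : V} : vert G i = vert G j ↔ i = j :=
  ⟨fun h => congrArg s h, fun h => congrArg _ h⟩

theorem vert_cat (p : G.Path) : (vert G p.s).cat p = p := by
  ext1
  · rw [cat_s]; rfl
  · rw [cat_edges rfl]; rfl

theorem cat_vert (p : G.Path) : p.cat (vert G p.r) = p := by
  ext1
  · rw [cat_s]
  · rw [cat_edges rfl]; exact List.append_nil _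

theorem eq_vert {p : G.Path} (h : p.len = 0) : p = vert G p.s := by
  ext1
  · rfl
  · exact List.eq_nil_of_length_eq_zero h

theorem cat_inj {p q p' q' : G.Path} (h : p.r = q.s) (h' : p'.r = q'.s) (hl : p.len = p'.len) :
    p.cat q = p'.cat q' ↔ p = p' ∧ q = q' := by
  refine ⟨fun e => ?_, fun e => by rw [e.1, e.2]⟩
  have e1 := congrArg edges e
  rw [cat_edges h, cat_edges h'] at e1
  obtain ⟨e2, e3⟩ := List.append_inj e1 hl
  have e4 := congrArg s e
  rw [cat_s, cat_s] at e4
  have e5 : p = p' := Path.ext e4 e2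
  refine ⟨e5, Path.ext ?_ e3⟩
  rw [← h, ← h', e5]

theorem exists_cat (v : G.Path) (m n : ℕ) (h : v.len = m + n) :
    ∃ t u : G.Path, t.len = m ∧ u.len = n ∧ t.r = u.s ∧ t.cat u = v := by
  have hv := v.isPath
  rw [← List.take_append_drop m v.edges, isPath_append] at hv
  have hl : v.edges.length = m + n := h
  refine ⟨⟨v.s, v.edges.take m, hv.1⟩, ⟨_, v.edges.drop m, hv.2⟩, ?_, ?_, rfl, ?_⟩
  · rw [len, List.length_take]; omega
  · rw [len, List.length_drop]; omega
  · ext1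
    · rw [cat_s]
    · rw [cat_edges rfl]
      exact List.take_append_drop m v.edges

theorem finite_len (G : OGraph V E) [Finite V] [Finite E] (n : ℕ) :
    {p : G.Path | p.len = n}.Finite := by
  refine Set.Finite.of_finite_image (f := fun p : G.Path => (p.s, p.edges)) ?_ ?_
  · refine ((Set.finite_univ (α := V)).prod (List.finite_length_eq E n)).subset ?_
    rintro _ ⟨p, hp, rfl⟩
    exact ⟨trivial, hp⟩
  · intro p _ q _ h
    exact Path.ext (congrArg Prod.fst h) (congrArg Prod.snd h)

/-- The set of paths of length `n`. -/
def ofLen (G : OGraph V E) [Finite V] [Finite E] (n : ℕ) : Finset G.Path :=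
  (finite_len G n).toFinset

@[simp] theorem mem_ofLen [Finite V] [Finite E] {n : ℕ} {p : G.Path} :
    p ∈ ofLen G n ↔ p.len = n := by
  simp [ofLen]

open Classical in
theorem sum_ofLen_add [Finite V] [Finite E] {M : Type*} [AddCommMonoid M] (m n : ℕ)
    (f : G.Path → M) :
    ∑ v ∈ ofLen G (m + n), f v =
      ∑ t ∈ ofLen G m, ∑ u ∈ ofLen G n, if t.r = u.s then f (t.cat u) else 0 := by
  rw [← Finset.sum_product', ← Finset.sum_filter]
  symm
  refine Finset.sum_bij (fun x _ => x.1.cat x.2) ?_ ?_ ?_ ?_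
  · rintro ⟨t, u⟩ h
    simp only [Finset.mem_filter, Finset.mem_product, mem_ofLen] at h
    rw [mem_ofLen, cat_len h.2, h.1.1, h.1.2]
  · rintro ⟨t, u⟩ h ⟨t', u'⟩ h' e
    simp only [Finset.mem_filter, Finset.mem_product, mem_ofLen] at h h'
    obtain ⟨rfl, rfl⟩ := (cat_inj h.2 h'.2 (h.1.1.trans h'.1.1.symm)).1 e
    rfl
  · intro v hv
    obtain ⟨t, u, h1, h2, h3, h4⟩ := exists_cat v m n (mem_ofLen.1 hv)
    exact ⟨(t, u), by simp [h1, h2, h3], h4⟩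
  · intros
    rfl

theorem sum_ofLen_zero [Fintype V] [Finite E] {M : Type*} [AddCommMonoid M] (f : G.Path → M) :
    ∑ v ∈ ofLen G 0, f v = ∑ i : V, f (vert G i) := by
  symm
  refine Finset.sum_bij (fun i _ => vert G i) ?_ ?_ ?_ ?_
  · intro i _
    simp
  · intro i _ j _ h
    exact vert_inj.1 h
  · intro v hv
    exact ⟨v.s, Finset.mem_univ _, (eq_vert (mem_ofLen.1 hv)).symm⟩
  · intros
    rfl

end Path

end OGraph

open OGraph.Path

/-- The algebra `H(G)`: the vector space with basis the pairs `(p, q)` of paths of the same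
length. -/
def HG (K : Type*) [Field K] {V E : Type*} (G : OGraph V E) : Type _ :=
  {x : G.Path × G.Path // x.1.len = x.2.len} →₀ K

namespace HG

variable {K V E : Type*} [Field K] {G : OGraph V E}

instance : AddCommGroup (HG K G) :=
  inferInstanceAs (AddCommGroup ({x : G.Path × G.Path // x.1.len = x.2.len} →₀ K))
instance : Module K (HG K G) :=
  inferInstanceAs (Module K ({x : G.Path × G.Path // x.1.len = x.2.len} →₀ K))

variable (K G) in
/-- The identity map. -/
def of : ({x : G.Path × G.Path // x.1.len = x.2.len} →₀ K) ≃ₗ[K] HG K G := LinearEquiv.refl K _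

variable (K) in
/-- The basis element `e(p; q)`, for paths `p`, `q` of the same length
(and `0` for paths of different lengths). -/
def ee (p q : G.Path) : HG K G :=
  if h : p.len = q.len then of K G (Finsupp.single ⟨(p, q), h⟩ 1) else 0

theorem ee_pos {p q : G.Path} (h : p.len = q.len) :
    ee K p q = of K G (Finsupp.single ⟨(p, q), h⟩ 1) := dif_pos h

/-- The linear map with prescribed values on the basis. -/
def lin {M : Type*} [AddCommGroup M] [Module K M] (f : G.Path → G.Path → M) : HG K G →ₗ[K] M :=
  Finsupp.linearCombination K
    (fun x : {x : G.Path × G.Path // x.1.len = x.2.len} => f x.1.1 x.1.2) ∘ₗ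
    (of K G).symm.toLinearMap

theorem lin_ee {M : Type*} [AddCommGroup M] [Module K M] (f : G.Path → G.Path → M) {p q : G.Path}
    (h : p.len = q.len) : lin f (ee K p q) = f p q := by
  rw [ee_pos h, lin]
  simp

theorem induct {P : HG K G → Prop} (x : HG K G) (h0 : P 0)
    (hE : ∀ p q : G.Path, p.len = q.len → P (ee K p q))
    (ha : ∀ x y, P x → P y → P (x + y)) (hs : ∀ (c : K) x, P x → P (c • x)) : P x := by
  obtain ⟨x, rfl⟩ := (of K G).surjective x
  induction x using Finsupp.induction_linear with
  | zero => rwa [map_zero]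
  | add x y hx hy => rw [map_add]; exact ha _ _ hx hy
  | single i c =>
    have := hs c _ (hE i.1.1 i.1.2 i.2)
    rwa [ee_pos i.2, ← map_smul, Finsupp.smul_single, smul_eq_mul, mul_one] at this

theorem hom_ext {M : Type*} [AddCommGroup M] [Module K M] {f g : HG K G →ₗ[K] M}
    (h : ∀ p q : G.Path, p.len = q.len → f (ee K p q) = g (ee K p q)) : f = g := by
  refine LinearMap.ext fun x => ?_
  induction x using induct with
  | h0 => simp only [map_zero]
  | ha x x' hx hy => simp only [map_add, hx, hy]
  | hs c x hx => simp only [map_smul, hx]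
  | hE p q h' => exact h p q h'

open Classical in
/-- The product: `e(p; q) e(t; u) = δ δ e(p · t; q · u)`. -/
def mulB : HG K G →ₗ[K] HG K G →ₗ[K] HG K G :=
  lin fun p q => lin fun t u => if p.r = t.s ∧ q.r = u.s then ee K (p.cat t) (q.cat u) else 0

instance : Mul (HG K G) := ⟨fun x y => mulB x y⟩

open Classical in
theorem ee_mul_ee {p q t u : G.Path} (h : p.len = q.len) (h' : t.len = u.len) :
    ee K p q * ee K t u = if p.r = t.s ∧ q.r = u.s then ee K (p.cat t) (q.cat u) else 0 := by
  change mulB (ee K p q) (ee K t u) = _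
  rw [mulB, lin_ee _ h, lin_ee _ h']

theorem add_mul' (x y z : HG K G) : (x + y) * z = x * z + y * z :=
  LinearMap.map_add₂ mulB x y z
theorem mul_add' (x y z : HG K G) : x * (y + z) = x * y + x * z := map_add (mulB x) y z
theorem zero_mul' (x : HG K G) : 0 * x = 0 := LinearMap.map_zero₂ mulB x
theorem mul_zero' (x : HG K G) : x * 0 = 0 := map_zero (mulB x)
theorem smul_mul' (c : K) (x y : HG K G) : (c • x) * y = c • (x * y) :=
  LinearMap.map_smul₂ mulB c x y
theorem mul_smul' (c : K) (x y : HG K G) : x * (c • y) = c • (x * y) := map_smul (mulB x) c y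

theorem cat_len_eq {p q t u : G.Path} (h : p.len = q.len) (h' : t.len = u.len)
    (h1 : p.r = t.s ∧ q.r = u.s) : (p.cat t).len = (q.cat u).len := by
  rw [cat_len h1.1, cat_len h1.2, h, h']

theorem mul_assoc' (x y z : HG K G) : x * y * z = x * (y * z) := by
  induction x using induct with
  | h0 => simp only [zero_mul']
  | ha x x' hx hy => simp only [add_mul', hx, hy]
  | hs c x hx => simp only [smul_mul', hx]
  | hE p q h =>
  induction y using induct with
  | h0 => simp only [zero_mul', mul_zero']
  | ha x x' hx hy => simp only [add_mul', mul_add', hx, hy]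
  | hs c x hx => simp only [smul_mul', mul_smul', hx]
  | hE t u h' =>
  induction z using induct with
  | h0 => simp only [mul_zero']
  | ha x x' hx hy => simp only [mul_add', hx, hy]
  | hs c x hx => simp only [mul_smul', hx]
  | hE v w h'' =>
  rw [ee_mul_ee h h', ee_mul_ee h' h'']
  by_cases h1 : p.r = t.s ∧ q.r = u.s <;> by_cases h2 : t.r = v.s ∧ u.r = w.s
  · rw [if_pos h1, if_pos h2, ee_mul_ee (cat_len_eq h h' h1) h'', ee_mul_ee h
      (cat_len_eq h' h'' h2), cat_r h1.1, cat_r h1.2, cat_s, cat_s, if_pos h1, if_pos h2,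
      cat_assoc h1.1 h2.1, cat_assoc h1.2 h2.2]
  · rw [if_pos h1, if_neg h2, ee_mul_ee (cat_len_eq h h' h1) h'', cat_r h1.1, cat_r h1.2,
      if_neg h2, mul_zero']
  · rw [if_neg h1, if_pos h2, ee_mul_ee h (cat_len_eq h' h'' h2), cat_s, cat_s, if_neg h1,
      zero_mul']
  · rw [if_neg h1, if_neg h2, mul_zero', zero_mul']

theorem vlen (i j : V) : (vert G i).len = (vert G j).len := rfl

theorem vert_mul_ee [DecidableEq V] (i j : V) {p q : G.Path} (h : p.len = q.len) :
    ee K (vert G i) (vert G j) * ee K p q = if i = p.s ∧ j = q.s then ee K p q else 0 := by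
  rw [ee_mul_ee (vlen i j) h]
  by_cases h1 : i = p.s ∧ j = q.s
  · rw [if_pos h1, if_pos (show (vert G i).r = p.s ∧ (vert G j).r = q.s from h1), h1.1, h1.2,
      vert_cat, vert_cat]
  · rw [if_neg h1, if_neg (show ¬ ((vert G i).r = p.s ∧ (vert G j).r = q.s) from h1)]

theorem ee_mul_vert [DecidableEq V] (i j : V) {p q : G.Path} (h : p.len = q.len) :
    ee K p q * ee K (vert G i) (vert G j) = if p.r = i ∧ q.r = j then ee K p q else 0 := by
  rw [ee_mul_ee h (vlen i j)]
  by_cases h1 : p.r = i ∧ q.r = j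
  · rw [if_pos h1, if_pos (show p.r = (vert G i).s ∧ q.r = (vert G j).s from h1), ← h1.1, ← h1.2,
      cat_vert, cat_vert]
  · rw [if_neg h1, if_neg (show ¬ (p.r = (vert G i).s ∧ q.r = (vert G j).s) from h1)]

variable [Fintype V]

instance : One (HG K G) := ⟨∑ i : V, ∑ j : V, ee K (vert G i) (vert G j)⟩

theorem one_def : (1 : HG K G) = ∑ i : V, ∑ j : V, ee K (vert G i) (vert G j) := rfl

open Classical in
theorem one_mul' (x : HG K G) : 1 * x = x := by
  induction x using induct with
  | h0 => simp only [mul_zero']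
  | ha x x' hx hy => simp only [mul_add', hx, hy]
  | hs c x hx => simp only [mul_smul', hx]
  | hE p q h =>
    change mulB.flip (ee K p q) 1 = _
    have e : ∀ i j : V, mulB.flip (ee K p q) (ee K (vert G i) (vert G j)) =
        if i = p.s ∧ j = q.s then ee K p q else 0 := fun i j => vert_mul_ee i j h
    simp only [one_def, map_sum, e]
    simp [ite_and]

open Classical in
theorem mul_one' (x : HG K G) : x * 1 = x := by
  induction x using induct with
  | h0 => simp only [zero_mul']
  | ha x x' hx hy => simp only [add_mul', hx, hy]
  | hs c x hx => simp only [smul_mul', hx]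
  | hE p q h =>
    change mulB (ee K p q) 1 = _
    have e : ∀ i j : V, mulB (ee K p q) (ee K (vert G i) (vert G j)) =
        if p.r = i ∧ q.r = j then ee K p q else 0 := fun i j => ee_mul_vert i j h
    simp only [one_def, map_sum, e]
    simp [ite_and]

instance : Ring (HG K G) :=
  { (inferInstance : AddCommGroup (HG K G)) with
    mul := (· * ·)
    one := 1
    left_distrib := mul_add'
    right_distrib := add_mul'
    zero_mul := zero_mul'
    mul_zero := mul_zero'
    mul_assoc := mul_assoc'
    one_mul := one_mul'
    mul_one := mul_one' }

instance : Algebra K (HG K G) := Algebra.ofModule smul_mul' mul_smul'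

variable [Finite E]

open Classical in
/-- The comultiplication `Δ(e(p; q)) = ∑ e(p; t) ⊗ e(t; q)` and the counit
`ε(e(p; q)) = δ`. -/
instance : CoalgebraStruct K (HG K G) where
  comul := lin fun p q => ∑ t ∈ ofLen G p.len, ee K p t ⊗ₜ[K] ee K t q
  counit := lin fun p q => if p = q then 1 else 0

theorem comul_ee {p q : G.Path} (h : p.len = q.len) :
    comul (R := K) (ee K p q) = ∑ t ∈ ofLen G p.len, ee K p t ⊗ₜ[K] ee K t q := lin_ee _ h

open Classical in
theorem counit_ee {p q : G.Path} (h : p.len = q.len) :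
    counit (R := K) (ee K p q) = if p = q then 1 else 0 := lin_ee _ h

instance : Coalgebra K (HG K G) where
  coassoc := hom_ext fun p q h => by
    simp only [LinearMap.comp_apply, comul_ee h, map_sum, LinearMap.rTensor_tmul,
      LinearMap.lTensor_tmul]
    have e1 : ∀ t ∈ ofLen G p.len, comul (R := K) (ee K p t) ⊗ₜ[K] ee K t q =
        ∑ u ∈ ofLen G p.len, (ee K p u ⊗ₜ[K] ee K u t) ⊗ₜ[K] ee K t q := fun t ht => by
      rw [comul_ee (mem_ofLen.1 ht).symm, sum_tmul]
    have e2 : ∀ t ∈ ofLen G p.len, ee K p t ⊗ₜ[K] comul (R := K) (ee K t q) =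
        ∑ u ∈ ofLen G p.len, ee K p t ⊗ₜ[K] (ee K t u ⊗ₜ[K] ee K u q) := fun t ht => by
      rw [comul_ee ((mem_ofLen.1 ht).trans h), tmul_sum, mem_ofLen.1 ht]
    rw [Finset.sum_congr rfl e2]
    have e3 := Finset.sum_congr rfl e1
    have e4 := congrArg (TensorProduct.assoc K _ _ _) e3
    simp only [map_sum] at e4
    refine Eq.trans e4 ?_
    rw [Finset.sum_comm]
    rfl
  rTensor_counit_comp_comul := hom_ext fun p q h => by
    simp only [LinearMap.comp_apply, comul_ee h, map_sum, LinearMap.rTensor_tmul]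
    rw [Finset.sum_eq_single p]
    · rw [counit_ee rfl, if_pos rfl]; rfl
    · intro t ht hne
      rw [counit_ee (mem_ofLen.1 ht).symm, if_neg hne.symm, zero_tmul]
    · intro hp
      exact absurd (mem_ofLen.2 rfl) hp
  lTensor_counit_comp_comul := hom_ext fun p q h => by
    simp only [LinearMap.comp_apply, comul_ee h, map_sum, LinearMap.lTensor_tmul]
    rw [Finset.sum_eq_single q]
    · rw [counit_ee rfl, if_pos rfl]; rfl
    · intro t ht hne
      rw [counit_ee ((mem_ofLen.1 ht).trans h), if_neg hne, tmul_zero]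
    · intro hp
      exact absurd (mem_ofLen.2 h.symm) hp

/-- The face idempotent `e j`. -/
def fe (j : V) : HG K G := ∑ i : V, ee K (vert G i) (vert G j)

/-- The face idempotent `e° i`. -/
def feo (i : V) : HG K G := ∑ j : V, ee K (vert G i) (vert G j)

variable [DecidableEq V]

theorem ee_mul_fe (j : V) {p q : G.Path} (h : p.len = q.len) :
    ee K p q * fe j = if q.r = j then ee K p q else 0 := by
  rw [fe, Finset.mul_sum]
  simp only [ee_mul_vert _ _ h]
  simp [ite_and]

theorem ee_mul_feo (j : V) {p q : G.Path} (h : p.len = q.len) :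
    ee K p q * feo j = if p.r = j then ee K p q else 0 := by
  rw [feo, Finset.mul_sum]
  simp only [ee_mul_vert _ _ h]
  simp [ite_and]

theorem feo_mul_ee (j : V) {p q : G.Path} (h : p.len = q.len) :
    feo j * ee K p q = if j = p.s then ee K p q else 0 := by
  rw [feo, Finset.sum_mul]
  simp only [vert_mul_ee _ _ h]
  simp [ite_and]

theorem fe_mul_ee (j : V) {p q : G.Path} (h : p.len = q.len) :
    fe j * ee K p q = if j = q.s then ee K p q else 0 := by
  rw [fe, Finset.sum_mul]
  simp only [vert_mul_ee _ _ h]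
  simp [ite_and]

theorem vert_mul_fe (i j k : V) : ee K (vert G i) (vert G j) * fe k =
    if j = k then ee K (vert G i) (vert G j) else 0 := ee_mul_fe k (vlen i j)

theorem vert_mul_feo (i j k : V) : ee K (vert G i) (vert G j) * feo k =
    if i = k then ee K (vert G i) (vert G j) else 0 := ee_mul_feo k (vlen i j)

theorem fe_mul_vert (i j k : V) : fe k * ee K (vert G i) (vert G j) =
    if k = j then ee K (vert G i) (vert G j) else 0 := fe_mul_ee k (vlen i j)

theorem feo_mul_vert (i j k : V) : feo k * ee K (vert G i) (vert G j) =
    if k = i then ee K (vert G i) (vert G j) else 0 := feo_mul_ee k (vlen i j)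

theorem feo_mul_fe (i j : V) : feo i * fe j = ee K (vert G i) (vert G j) := by
  rw [fe, Finset.mul_sum]
  simp only [feo_mul_vert]
  rw [Finset.sum_ite_eq, if_pos (Finset.mem_univ _)]

theorem comul_mul_ee {p q t u : G.Path} (h : p.len = q.len) (h' : t.len = u.len) :
    comul (R := K) (ee K p q * ee K t u) = comul (R := K) (ee K p q) * comul (R := K) (ee K t u) := by
  classical
  rw [comul_ee h, comul_ee h', Finset.sum_mul_sum, ee_mul_ee h h']
  simp only [Algebra.TensorProduct.tmul_mul_tmul]
  split_ifs with h1
  · rw [comul_ee (cat_len_eq h h' h1), cat_len h1.1, sum_ofLen_add]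
    refine Finset.sum_congr rfl fun v hv => Finset.sum_congr rfl fun w hw => ?_
    rw [ee_mul_ee (mem_ofLen.1 hv).symm (mem_ofLen.1 hw).symm,
      ee_mul_ee ((mem_ofLen.1 hv).trans h) ((mem_ofLen.1 hw).trans h')]
    simp only [h1, true_and, and_true]
    split_ifs
    · rfl
    · simp
  · rw [map_zero]
    symm
    refine Finset.sum_eq_zero fun v hv => Finset.sum_eq_zero fun w hw => ?_
    rw [ee_mul_ee (mem_ofLen.1 hv).symm (mem_ofLen.1 hw).symm,
      ee_mul_ee ((mem_ofLen.1 hv).trans h) ((mem_ofLen.1 hw).trans h')]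
    split_ifs with h2 h3
    · exact absurd ⟨h2.1, h3.2⟩ h1
    all_goals simp

theorem comul_mul' (x y : HG K G) : comul (R := K) (x * y) = comul (R := K) x * comul (R := K) y := by
  induction x using induct with
  | h0 => simp only [zero_mul, map_zero]
  | ha x x' hx hy => simp only [add_mul, map_add, hx, hy]
  | hs c x hx => simp only [smul_mul_assoc, map_smul, hx]
  | hE p q h =>
  induction y using induct with
  | h0 => simp only [mul_zero, map_zero]
  | ha x x' hx hy => simp only [mul_add, map_add, hx, hy]
  | hs c x hx => simp only [mul_smul_comm, map_smul, hx]
  | hE t u h' => exact comul_mul_ee h h'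

theorem counit_mul'' (x y : HG K G) : counit (R := K) (x * y) =
    ∑ k : V, counit (R := K) (x * fe k) * counit (R := K) (feo k * y) := by
  classical
  induction x using induct with
  | h0 => simp
  | ha x x' hx hy => simp only [add_mul, map_add, hx, hy, Finset.sum_add_distrib]
  | hs c x hx => simp only [smul_mul_assoc, map_smul, hx, Finset.smul_sum]
  | hE p q h =>
  induction y using induct with
  | h0 => simp
  | ha x x' hx hy => simp only [mul_add, map_add, hx, hy, Finset.sum_add_distrib]
  | hs c x hx => simp only [mul_smul_comm, map_smul, hx, Finset.smul_sum]
  | hE t u h' =>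
    simp only [ee_mul_fe _ h, feo_mul_ee _ h']
    rw [Finset.sum_eq_single q.r]
    · rw [if_pos rfl, ee_mul_ee h h']
      by_cases h1 : p.r = t.s ∧ q.r = u.s
      · rw [if_pos h1, counit_ee (cat_len_eq h h' h1)]
        simp only [cat_inj h1.1 h1.2 h]
        by_cases h2 : p = q
        · by_cases h3 : t = u
          · subst h2 h3
            rw [if_pos ⟨rfl, rfl⟩, if_pos h1.1, counit_ee rfl, counit_ee rfl]
            simp
          · rw [if_neg (fun h4 => h3 h4.2), apply_ite (counit (R := K)), counit_ee h', if_neg h3]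
            simp
        · rw [if_neg (fun h4 => h2 h4.1), counit_ee h, if_neg h2, zero_mul]
      · rw [if_neg h1, map_zero]
        by_cases h2 : p = q
        · by_cases h3 : t = u
          · subst h2 h3
            rw [if_neg (fun h4 => h1 ⟨h4, h4⟩), map_zero, mul_zero]
          · rw [apply_ite (counit (R := K)), counit_ee h', if_neg h3]
            simp
        · rw [counit_ee h, if_neg h2, zero_mul]
    · intro k _ hk
      rw [if_neg hk.symm, map_zero, zero_mul]
    · simp

instance : FaceAlgebra K V (HG K G) where
  e := fe
  eo := feo
  comul_mul := comul_mul'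
  e_mul_e i j := by
    rw [fe, Finset.sum_mul]
    simp only [vert_mul_fe]
    split_ifs
    · rfl
    · exact Finset.sum_const_zero
  eo_mul_eo i j := by
    rw [feo, Finset.sum_mul]
    simp only [vert_mul_feo]
    split_ifs
    · rfl
    · exact Finset.sum_const_zero
  e_mul_eo i j := by
    rw [feo_mul_fe, feo, Finset.mul_sum]
    simp only [fe_mul_vert]
    rw [Finset.sum_ite_eq, if_pos (Finset.mem_univ _)]
  sum_e := by rw [one_def, Finset.sum_comm]; rfl
  sum_eo := rfl
  comul_eo_mul_e i j := by
    rw [feo_mul_fe, comul_ee (vlen i j), vert_len, sum_ofLen_zero]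
    simp only [feo_mul_fe]
  counit_eo_mul_e i j := by
    classical
    rw [feo_mul_fe, counit_ee (vlen i j)]
    exact if_congr vert_inj rfl rfl
  counit_mul := counit_mul''

end HG

open FaceAlgebra OGraph.Path

/-! ### Quotients of face algebras -/

namespace FQuot

variable {K V H : Type*} [Field K] [Fintype V] [DecidableEq V] [Ring H] [Algebra K H]
  [Coalgebra K H] [FaceAlgebra K V H] (r : H → H → Prop)

variable (K) in
/-- `(π ⊗ π) Δ`, where `π` is the projection onto the quotient by `r`. -/
def quotComul : H →ₗ[K] RingQuot r ⊗[K] RingQuot r :=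
  TensorProduct.map (RingQuot.mkAlgHom K r).toLinearMap (RingQuot.mkAlgHom K r).toLinearMap ∘ₗ
    comul

theorem quotComul_mul (V : Type*) [Fintype V] [DecidableEq V] [FaceAlgebra K V H] (a b : H) :
    quotComul K r (a * b) = quotComul K r a * quotComul K r b := by
  simp only [quotComul, LinearMap.comp_apply]
  rw [FaceAlgebra.comul_mul (V := V)]
  exact map_mul (Algebra.TensorProduct.map (RingQuot.mkAlgHom K r) (RingQuot.mkAlgHom K r)) _ _

theorem quotComul_idem (V : Type*) [Fintype V] [DecidableEq V] [FaceAlgebra K V H] :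
    IsIdempotentElem (quotComul K r 1) := by
  rw [IsIdempotentElem, ← quotComul_mul r V, one_mul]

/-- `(π ⊗ π) Δ` as an algebra map into a corner. -/
def preComul (V : Type*) [Fintype V] [DecidableEq V] [FaceAlgebra K V H] :
    H →ₐ[K] (quotComul_idem (K := K) r V).Corner :=
  AlgHom.ofLinearMap (toCorner _ (quotComul K r)
      (fun a => by rw [← quotComul_mul r V, one_mul])
      (fun a => by rw [← quotComul_mul r V, mul_one]))
    (cornerVal_injective K (quotComul_idem (K := K) r V) rfl)
    (fun a b => cornerVal_injective K (quotComul_idem (K := K) r V) (quotComul_mul r V a b))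

/-- The induced comultiplication, with values in a corner. -/
def qComul (V : Type*) [Fintype V] [DecidableEq V] [FaceAlgebra K V H]
    (hD : ∀ ⦃x y⦄, r x y → quotComul K r x = quotComul K r y) :
    RingQuot r →ₐ[K] (quotComul_idem (K := K) r V).Corner :=
  RingQuot.liftAlgHom K ⟨preComul r V, fun _ _ h =>
    cornerVal_injective K (quotComul_idem (K := K) r V) (hD h)⟩

/-- The induced comultiplication. -/
def qD (V : Type*) [Fintype V] [DecidableEq V] [FaceAlgebra K V H]
    (hD : ∀ ⦃x y⦄, r x y → quotComul K r x = quotComul K r y) :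
    RingQuot r →ₗ[K] RingQuot r ⊗[K] RingQuot r :=
  cornerVal (K := K) _ ∘ₗ (qComul r V hD).toLinearMap

theorem qD_mk (V : Type*) [Fintype V] [DecidableEq V] [FaceAlgebra K V H]
    (hD : ∀ ⦃x y⦄, r x y → quotComul K r x = quotComul K r y) (a : H) :
    qD r V hD (RingQuot.mkAlgHom K r a) = quotComul K r a := by
  rw [qD, LinearMap.comp_apply, AlgHom.toLinearMap_apply, qComul,
    RingQuot.liftAlgHom_mkAlgHom_apply]
  rfl

/-- The induced representation. -/
def qrep (V : Type*) [Fintype V] [DecidableEq V] [FaceAlgebra K V H]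
    (hr : ∀ ⦃x y⦄, r x y → rep K V H x = rep K V H y) : RingQuot r →ₐ[K] Matrix V V K :=
  RingQuot.liftAlgHom K ⟨rep K V H, hr⟩

theorem qrep_mk (V : Type*) [Fintype V] [DecidableEq V] [FaceAlgebra K V H]
    (hr : ∀ ⦃x y⦄, r x y → rep K V H x = rep K V H y) (a : H) :
    qrep r V hr (RingQuot.mkAlgHom K r a) = rep K V H a := by
  rw [qrep, RingQuot.liftAlgHom_mkAlgHom_apply]

theorem eps_mk (V : Type*) [Fintype V] [DecidableEq V] [FaceAlgebra K V H]
    (hr : ∀ ⦃x y⦄, r x y → rep K V H x = rep K V H y) (a : H) :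
    (entrySum K V ∘ₗ (qrep r V hr).toLinearMap) (RingQuot.mkAlgHom K r a) =
      counit (R := K) a := by
  rw [LinearMap.comp_apply, AlgHom.toLinearMap_apply, qrep_mk, entrySum_rep]

/-- The face algebra structure of a quotient: the projection is a map of face algebras. -/
def datum (hD : ∀ ⦃x y⦄, r x y → quotComul K r x = quotComul K r y)
    (hr : ∀ ⦃x y⦄, r x y → rep K V H x = rep K V H y) : FaceDatum K V (RingQuot r) where
  e i := RingQuot.mkAlgHom K r (e K i)
  eo i := RingQuot.mkAlgHom K r (eo K i)
  e_mul_e i j := by rw [← map_mul, e_mul_e, apply_ite (RingQuot.mkAlgHom K r), map_zero]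
  eo_mul_eo i j := by rw [← map_mul, eo_mul_eo, apply_ite (RingQuot.mkAlgHom K r), map_zero]
  e_mul_eo i j := by rw [← map_mul, e_mul_eo, map_mul]
  sum_e := by rw [← map_sum, sum_e, map_one]
  sum_eo := by rw [← map_sum, sum_eo, map_one]
  D := qD r V hD
  D_mul a b := congrArg (cornerVal (K := K) _) (map_mul (qComul r V hD) a b)
  D_eo_mul_e i j := by
    rw [← map_mul, qD_mk, quotComul, LinearMap.comp_apply, comul_eo_mul_e, map_sum]
    simp
  ρ := qrep r V hr
  ρ_e i := by rw [qrep_mk, rep_e]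
  ρ_eo i := by rw [qrep_mk, rep_eo]
  gen := Set.range (RingQuot.mkAlgHom K r)
  gen_top := by
    rw [(RingQuot.mkAlgHom_surjective K r).range_eq]
    exact Algebra.adjoin_univ K _
  coassoc_gen := by
    rintro _ ⟨x, rfl⟩
    have hl : ∀ a, qD r V hD ((RingQuot.mkAlgHom K r).toLinearMap a) = quotComul K r a :=
      qD_mk r V hD
    set f := (RingQuot.mkAlgHom K r).toLinearMap with hf
    have e1 : ∀ t : H ⊗[K] H, TensorProduct.assoc K _ _ _ ((qD r V hD).rTensor _
        (TensorProduct.map f f t)) = TensorProduct.map f (TensorProduct.map f f)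
          (TensorProduct.assoc K H H H (comul.rTensor H t)) := by
      intro t
      induction t with
      | zero => simp
      | add x y hx hy => simp only [map_add, hx, hy]
      | tmul x y =>
        simp only [map_tmul, LinearMap.rTensor_tmul, hl, quotComul, LinearMap.comp_apply, ← hf]
        generalize comul (R := K) x = p
        induction p with
        | zero => simp
        | add x y hx hy => simp only [map_add, add_tmul, hx, hy]
        | tmul x y => simp
    have e2 : ∀ t : H ⊗[K] H, (qD r V hD).lTensor _ (TensorProduct.map f f t) =
        TensorProduct.map f (TensorProduct.map f f) (comul.lTensor H t) := by
      intro t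
      induction t with
      | zero => simp
      | add x y hx hy => simp only [map_add, hx, hy]
      | tmul x y =>
        simp only [map_tmul, LinearMap.lTensor_tmul, hl, quotComul, LinearMap.comp_apply, ← hf]
    rw [qD_mk, quotComul, LinearMap.comp_apply, ← hf, e1, e2, Coalgebra.coassoc_apply]
  counit_left_gen := by
    rintro _ ⟨x, rfl⟩
    have h1 := congrArg ((RingQuot.mkAlgHom K r).toLinearMap.lTensor K)
      (Coalgebra.rTensor_counit_comul (R := K) x)
    rw [LinearMap.lTensor_tmul] at h1
    rw [qD_mk, quotComul, LinearMap.comp_apply]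
    refine Eq.trans ?_ h1
    have el : ∀ a, (entrySum K V ∘ₗ (qrep r V hr).toLinearMap)
        ((RingQuot.mkAlgHom K r).toLinearMap a) = counit (R := K) a := eps_mk r V hr
    generalize comul (R := K) x = p
    induction p with
    | zero => simp
    | add x y hx hy => simp only [map_add, hx, hy]
    | tmul x y => rw [map_tmul, LinearMap.rTensor_tmul, el, LinearMap.rTensor_tmul,
        LinearMap.lTensor_tmul]
  counit_right_gen := by
    rintro _ ⟨x, rfl⟩
    have h1 := congrArg ((RingQuot.mkAlgHom K r).toLinearMap.rTensor K)
      (Coalgebra.lTensor_counit_comul (R := K) x)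
    rw [LinearMap.rTensor_tmul] at h1
    rw [qD_mk, quotComul, LinearMap.comp_apply]
    refine Eq.trans ?_ h1
    have el : ∀ a, (entrySum K V ∘ₗ (qrep r V hr).toLinearMap)
        ((RingQuot.mkAlgHom K r).toLinearMap a) = counit (R := K) a := eps_mk r V hr
    generalize comul (R := K) x = p
    induction p with
    | zero => simp
    | add x y hx hy => simp only [map_add, hx, hy]
    | tmul x y => rw [map_tmul, LinearMap.lTensor_tmul, el, LinearMap.lTensor_tmul,
        LinearMap.rTensor_tmul]

end FQuot

/-! ### Face models -/

section Model

variable {K V E : Type*} [Field K]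

/-- The set `G²` of paths of length `2`. -/
abbrev OGraph.G2 (G : OGraph V E) : Type _ := {x : E × E // G.tgt x.1 = G.src x.2}

/-- The path of length `2` given by an element of `G²`. -/
def OGraph.G2.path {G : OGraph V E} (x : G.G2) : G.Path :=
  (edge G x.1.1).cat (edge G x.1.2)

theorem OGraph.G2.edges_path {G : OGraph V E} (x : G.G2) : x.path.edges = [x.1.1, x.1.2] := by
  rw [path, cat_edges (show (edge G x.1.1).r = (edge G x.1.2).s from x.2)]
  rfl

theorem OGraph.G2.path_s {G : OGraph V E} (x : G.G2) : x.path.s = G.src x.1.1 := by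
  rw [path, cat_s]
  rfl

theorem OGraph.G2.path_r {G : OGraph V E} (x : G.G2) : x.path.r = G.tgt x.1.2 := by
  rw [path, cat_r (show (edge G x.1.1).r = (edge G x.1.2).s from x.2)]
  rfl

@[simp] theorem OGraph.G2.path_len {G : OGraph V E} (x : G.G2) : x.path.len = 2 := by
  rw [len, edges_path]
  rfl

theorem OGraph.G2.path_inj {G : OGraph V E} {x y : G.G2} : x.path = y.path ↔ x = y := by
  refine ⟨fun h => ?_, fun h => by rw [h]⟩
  have := congrArg OGraph.Path.edges h
  rw [edges_path, edges_path] at this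
  simp only [List.cons.injEq, and_true] at this
  exact Subtype.ext (Prod.ext this.1 this.2)

theorem OGraph.sum_ofLen_two {G : OGraph V E} [Finite V] [Finite E] [Fintype G.G2] {M : Type*}
    [AddCommMonoid M] (f : G.Path → M) : ∑ t ∈ ofLen G 2, f t = ∑ x : G.G2, f x.path := by
  symm
  refine Finset.sum_bij (fun x _ => x.path) ?_ ?_ ?_ ?_
  · intro x _
    rw [mem_ofLen, G2.path_len]
  · intro x _ y _ h
    exact G2.path_inj.1 h
  · rintro ⟨s, l, hl⟩ h
    obtain ⟨p, q, rfl⟩ := List.length_eq_two.1 (mem_ofLen.1 h)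
    refine ⟨⟨(p, q), hl.2.1.symm⟩, Finset.mem_univ _, Path.ext ?_ ?_⟩
    · rw [G2.path_s]
      exact hl.1
    · rw [G2.edges_path]
  · intros
    rfl

variable (K) in
/-- A face model: a scalar `w r p s q`, with left edge `r`, top edge `p`, bottom edge `s` and
right edge `q`, for each face (and `0` if the edges do not form a face). -/
structure FaceModel (G : OGraph V E) where
  /-- the weights -/
  w : E → E → E → E → K
  face : ∀ r p s q, w r p s q ≠ 0 →
    G.src p = G.src r ∧ G.tgt p = G.src q ∧ G.tgt r = G.src s ∧ G.tgt s = G.tgt q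

namespace FaceModel

variable {G : OGraph V E} (M : FaceModel K G)

/-- The coefficient of `(r, s)` in `w (p, q)`. -/
def coeff (x y : G.G2) : K := M.w x.1.1 y.1.1 x.1.2 y.1.2

theorem coeff_face {x y : G.G2} (h : M.coeff x y ≠ 0) :
    x.path.s = y.path.s ∧ x.path.r = y.path.r := by
  obtain ⟨h1, -, -, h4⟩ := M.face _ _ _ _ h
  rw [OGraph.G2.path_s, OGraph.G2.path_s, OGraph.G2.path_r, OGraph.G2.path_r]
  exact ⟨h1.symm, h4⟩

variable [Fintype E] [DecidableEq V]

/-- The linear operator `w` on `K G²`, with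
`w (p, q) = ∑ w[r, p, s, q] (r, s)`. -/
def op : (G.G2 →₀ K) →ₗ[K] (G.G2 →₀ K) :=
  Finsupp.linearCombination K fun y => ∑ x : G.G2, Finsupp.single x (M.coeff x y)

/-- The relations `∑ w[a, c, b, d] e(c · d; p · q) = ∑ w[r, p, s, q] e(a · b; r · s)`
for `x = (a, b)` and `y = (p, q)`. -/
inductive Rel : HG K G → HG K G → Prop
  | of (x y : G.G2) : Rel (∑ c : G.G2, M.coeff x c • HG.ee K c.path y.path)
      (∑ z : G.G2, M.coeff z y • HG.ee K x.path z.path)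

variable [Fintype V]

theorem comul_ee_path (x y : G.G2) : FQuot.quotComul K M.Rel (HG.ee K x.path y.path) =
    ∑ t : G.G2, RingQuot.mkAlgHom K M.Rel (HG.ee K x.path t.path) ⊗ₜ[K]
      RingQuot.mkAlgHom K M.Rel (HG.ee K t.path y.path) := by
  rw [FQuot.quotComul, LinearMap.comp_apply, HG.comul_ee (by simp), OGraph.G2.path_len,
    OGraph.sum_ofLen_two, map_sum]
  rfl

theorem rel_comul ⦃a b : HG K G⦄ (h : M.Rel a b) :
    FQuot.quotComul K M.Rel a = FQuot.quotComul K M.Rel b := by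
  obtain ⟨x, y⟩ := h
  have key : ∀ x y : G.G2,
      ∑ c : G.G2, M.coeff x c • RingQuot.mkAlgHom K M.Rel (HG.ee K c.path y.path) =
        ∑ z : G.G2, M.coeff z y • RingQuot.mkAlgHom K M.Rel (HG.ee K x.path z.path) := fun x y => by
    simpa only [map_sum, map_smul] using RingQuot.mkAlgHom_rel K (Rel.of (M := M) x y)
  simp only [map_sum, map_smul, comul_ee_path, Finset.smul_sum]
  set f := RingQuot.mkAlgHom K M.Rel with hf
  calc _ = ∑ t : G.G2, (∑ c : G.G2, M.coeff x c • f (HG.ee K c.path t.path)) ⊗ₜ[K]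
        f (HG.ee K t.path y.path) := by
        rw [Finset.sum_comm]
        refine Finset.sum_congr rfl fun t _ => ?_
        rw [sum_tmul]
        rfl
    _ = ∑ t : G.G2, ∑ z : G.G2, M.coeff z t •
        f (HG.ee K x.path z.path) ⊗ₜ[K] f (HG.ee K t.path y.path) := by
        refine Finset.sum_congr rfl fun t _ => ?_
        rw [key, sum_tmul]
        rfl
    _ = ∑ z : G.G2, f (HG.ee K x.path z.path) ⊗ₜ[K]
        ∑ t : G.G2, M.coeff z t • f (HG.ee K t.path y.path) := by
        rw [Finset.sum_comm]
        refine Finset.sum_congr rfl fun t _ => ?_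
        rw [tmul_sum]
        refine Finset.sum_congr rfl fun z _ => ?_
        rw [tmul_smul]
    _ = _ := by
        rw [Finset.sum_comm]
        refine Finset.sum_congr rfl fun t _ => ?_
        rw [key, tmul_sum]
        refine Finset.sum_congr rfl fun z _ => ?_
        rw [tmul_smul]

theorem rep_ee [DecidableEq G.Path] (p q : G.Path) (h : p.len = q.len) :
    rep K V (HG K G) (HG.ee K p q) = if p = q then Matrix.single p.s p.r 1 else 0 := by
  ext i j
  have h1 : (e K i * HG.ee K p q * e K j : HG K G) =
      if i = q.s ∧ q.r = j then HG.ee K p q else 0 := by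
    change HG.fe i * HG.ee K p q * HG.fe j = _
    rw [HG.fe_mul_ee i h, ite_mul, zero_mul, HG.ee_mul_fe j h, ite_and]
  rw [rep_apply, h1]
  by_cases hpq : p = q
  · subst hpq
    rw [if_pos rfl, apply_ite (counit (R := K)), map_zero, HG.counit_ee rfl, if_pos rfl,
      Matrix.single_apply]
    exact if_congr ⟨fun h => ⟨h.1.symm, h.2⟩, fun h => ⟨h.1.symm, h.2⟩⟩ rfl rfl
  · rw [if_neg hpq, apply_ite (counit (R := K)), map_zero, HG.counit_ee h, if_neg hpq, ite_self]
    rfl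

theorem rel_rep ⦃a b : HG K G⦄ (h : M.Rel a b) :
    rep K V (HG K G) a = rep K V (HG K G) b := by
  classical
  obtain ⟨x, y⟩ := h
  simp only [map_sum, map_smul, rep_ee _ _ ((OGraph.G2.path_len _).trans (OGraph.G2.path_len _).symm),
    OGraph.G2.path_inj]
  rw [Finset.sum_eq_single y, Finset.sum_eq_single x, if_pos rfl, if_pos rfl]
  · by_cases h0 : M.coeff x y = 0
    · rw [h0, zero_smul, zero_smul]
    · rw [(M.coeff_face h0).1, (M.coeff_face h0).2]
  · intro z _ hz
    rw [if_neg (Ne.symm hz), smul_zero]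
  · simp
  · intro z _ hz
    rw [if_neg hz, smul_zero]
  · simp

/-- The algebra `A(w)`. -/
def A : Type _ := RingQuot M.Rel

instance : Ring M.A := inferInstanceAs (Ring (RingQuot M.Rel))
instance : Algebra K M.A := inferInstanceAs (Algebra K (RingQuot M.Rel))

/-- The face algebra structure of `A(w)`, for which the projection `H(G) → A(w)` is a map of face
algebras. -/
def datum : FaceDatum K V M.A := FQuot.datum M.Rel M.rel_comul M.rel_rep

instance : Coalgebra K M.A := M.datum.toCoalgebra
instance : FaceAlgebra K V M.A := M.datum.toFaceAlgebra

/-- The projection `H(G) → A(w)`. -/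
def proj : HG K G →ₐ[K] M.A := RingQuot.mkAlgHom K M.Rel

theorem proj_e (i : V) : M.proj (e K i) = e K i := rfl
theorem proj_eo (i : V) : M.proj (eo K i) = eo K i := rfl
theorem counit_proj (a : HG K G) : counit (R := K) (M.proj a) = counit (R := K) a :=
  FQuot.eps_mk M.Rel V M.rel_rep a
theorem comul_proj (a : HG K G) : comul (R := K) (M.proj a) =
    TensorProduct.map M.proj.toLinearMap M.proj.toLinearMap (comul (R := K) a) :=
  FQuot.qD_mk M.Rel V M.rel_comul a

end FaceModel

end Model

/-! ### The comodule `K G¹` -/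

section Comodule

variable {K V E : Type*} [Field K] [Fintype V] [DecidableEq V] [Fintype E] {G : OGraph V E}
  {H : Type*} [Ring H] [Algebra K H] [Coalgebra K H] [FaceAlgebra K V H]

/-- The coaction `q ↦ ∑ p ⊗ e(p; q)` on `K G¹`, where the elements `e(p; q)` are read in `H`
through `κ : H(G) → H`. -/
def coact (κ : HG K G →ₐ[K] H) : (E →₀ K) →ₗ[K] (E →₀ K) ⊗[K] H :=
  Finsupp.linearCombination K fun q =>
    ∑ p : E, Finsupp.single p 1 ⊗ₜ[K] κ (HG.ee K (edge G p) (edge G q))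

/-- The action `π(X) = (id ⊗ X) ∘ ρ` of the functional `X` on the comodule `K G¹`. -/
def piEdge (κ : HG K G →ₐ[K] H) (X : WithConv (H →ₗ[K] K)) : Module.End K (E →₀ K) :=
  (TensorProduct.rid K (E →₀ K)).toLinearMap ∘ₗ X.ofConv.lTensor (E →₀ K) ∘ₗ coact κ

theorem piEdge_single (κ : HG K G →ₐ[K] H) (X : WithConv (H →ₗ[K] K)) (q : E) :
    piEdge κ X (Finsupp.single q 1) =
      ∑ p : E, X (κ (HG.ee K (edge G p) (edge G q))) • Finsupp.single p 1 := by
  simp [piEdge, coact]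

variable (K V H) in
/-- The subalgebra `E` of the dual algebra `H^*` generated by the face idempotents of the dual face
algebra. -/
def dualFace : Subalgebra K (WithConv (H →ₗ[K] K)) :=
  Algebra.adjoin K (Set.range (dualE K H : V → _) ∪ Set.range (dualEo K H : V → _))

/-- The monoid `End_{π(E)} (K G¹)` of all `E`-linear endomorphisms of `K G¹`. -/
def EndE (κ : HG K G →ₐ[K] H) : Submonoid (Module.End K (E →₀ K)) :=
  Submonoid.centralizer (piEdge κ '' dualFace K V H)

/-- The inclusion `K G² = K G¹ ⊗̄ K G¹ → K G¹ ⊗ K G¹`, `(p, q) ↦ p ⊗ q`. -/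
def inclT (K : Type*) [Field K] (G : OGraph V E) :
    (G.G2 →₀ K) →ₗ[K] (E →₀ K) ⊗[K] (E →₀ K) :=
  Finsupp.linearCombination K fun x => Finsupp.single x.1.1 1 ⊗ₜ[K] Finsupp.single x.1.2 1

/-- The projection `K G¹ ⊗ K G¹ → K G² = K G¹ ⊗̄ K G¹`: the left inverse of `inclT` that
kills all `p ⊗ q` for which `(p, q)` is not a path. -/
def projT (K : Type*) [Field K] (G : OGraph V E) :
    (E →₀ K) ⊗[K] (E →₀ K) →ₗ[K] (G.G2 →₀ K) :=
  TensorProduct.lift (Finsupp.linearCombination K fun p => Finsupp.linearCombination K fun q =>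
    if h : G.tgt p = G.src q then Finsupp.single ⟨(p, q), h⟩ 1 else 0)

/-- The operator `T ⊗̄ T` on `K G²`. -/
def barT (G : OGraph V E) (T : Module.End K (E →₀ K)) : Module.End K (G.G2 →₀ K) :=
  projT K G ∘ₗ TensorProduct.map T T ∘ₗ inclT K G

variable {κ : HG K G →ₐ[K] H}

theorem piEdge_dualE (he : ∀ i : V, κ (e K i) = e K i)
    (hc : ∀ a, counit (R := K) (κ a) = counit (R := K) a) (k : V) (q : E) :
    piEdge κ (dualE K H k) (Finsupp.single q 1) =
      if G.tgt q = k then Finsupp.single q 1 else 0 := by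
  classical
  rw [piEdge_single, Finset.sum_eq_single q]
  · have h1 : (HG.ee K (edge G q) (edge G q) * e K k : HG K G) =
        if (edge G q).r = k then HG.ee K (edge G q) (edge G q) else 0 := HG.ee_mul_fe k rfl
    rw [dualE_apply, ← he, ← map_mul, hc, h1, apply_ite (counit (R := K)), HG.counit_ee rfl,
      if_pos rfl, map_zero, ite_smul, one_smul, zero_smul]
    rfl
  · intro p _ hp
    have h1 : (HG.ee K (edge G p) (edge G q) * e K k : HG K G) =
        if (edge G q).r = k then HG.ee K (edge G p) (edge G q) else 0 := HG.ee_mul_fe k rfl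
    have h2 : counit (R := K) (HG.ee K (edge G p) (edge G q)) = 0 := by
      rw [HG.counit_ee (by rfl), if_neg]
      intro h
      exact hp (List.cons.inj (congrArg OGraph.Path.edges h)).1
    rw [dualE_apply, ← he, ← map_mul, hc, h1, apply_ite (counit (R := K)), h2, map_zero, ite_self,
      zero_smul]
  · intro h
    exact absurd (Finset.mem_univ _) h

theorem piEdge_dualEo (he : ∀ i : V, κ (e K i) = e K i)
    (hc : ∀ a, counit (R := K) (κ a) = counit (R := K) a) (k : V) (q : E) :
    piEdge κ (dualEo K H k) (Finsupp.single q 1) =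
      if G.src q = k then Finsupp.single q 1 else 0 := by
  classical
  rw [piEdge_single, Finset.sum_eq_single q]
  · have h1 : (e K k * HG.ee K (edge G q) (edge G q) : HG K G) =
        if k = (edge G q).s then HG.ee K (edge G q) (edge G q) else 0 := HG.fe_mul_ee k rfl
    rw [dualEo_apply, ← he, ← map_mul, hc, h1, apply_ite (counit (R := K)), HG.counit_ee rfl,
      if_pos rfl, map_zero, ite_smul, one_smul, zero_smul]
    exact if_congr eq_comm rfl rfl
  · intro p _ hp
    have h1 : (e K k * HG.ee K (edge G p) (edge G q) : HG K G) =
        if k = (edge G q).s then HG.ee K (edge G p) (edge G q) else 0 := HG.fe_mul_ee k rfl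
    have h2 : counit (R := K) (HG.ee K (edge G p) (edge G q)) = 0 := by
      rw [HG.counit_ee (by rfl), if_neg]
      intro h
      exact hp (List.cons.inj (congrArg OGraph.Path.edges h)).1
    rw [dualEo_apply, ← he, ← map_mul, hc, h1, apply_ite (counit (R := K)), h2, map_zero, ite_self,
      zero_smul]
  · intro h
    exact absurd (Finset.mem_univ _) h

/-- `E`-linear endomorphisms preserve sources and ranges. -/
theorem EndE_face (he : ∀ i : V, κ (e K i) = e K i)
    (hc : ∀ a, counit (R := K) (κ a) = counit (R := K) a) {T : Module.End K (E →₀ K)}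
    (hT : T ∈ EndE κ) {p q : E} (h : T (Finsupp.single q 1) p ≠ 0) :
    G.src p = G.src q ∧ G.tgt p = G.tgt q := by
  have key : ∀ (P : Module.End K (E →₀ K)) (f : E → V) (k : V),
      (∀ q : E, P (Finsupp.single q 1) = if f q = k then Finsupp.single q 1 else 0) →
      f p ≠ k → ∀ x : E →₀ K, P x p = 0 := by
    intro P f k hP hk x
    induction x using Finsupp.induction_linear with
    | zero => simp
    | add x y hx hy => rw [map_add, Finsupp.add_apply, hx, hy, add_zero]
    | single a c =>
      rw [← mul_one c, ← smul_eq_mul, ← Finsupp.smul_single, map_smul, hP]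
      split_ifs with h1
      · have : a ≠ p := fun h2 => hk (h2 ▸ h1)
        simp [this]
      · simp
  have comm := Submonoid.mem_centralizer_iff.1 hT
  constructor
  · by_contra h1
    have h2 := LinearMap.congr_fun (comm (piEdge κ (dualEo K H (G.src q)))
      ⟨_, Algebra.subset_adjoin (Or.inr ⟨_, rfl⟩), rfl⟩) (Finsupp.single q 1)
    rw [Module.End.mul_apply, Module.End.mul_apply, piEdge_dualEo he hc _ q, if_pos rfl] at h2
    exact h (by rw [← h2, key _ _ _ (piEdge_dualEo he hc _) h1])
  · by_contra h1
    have h2 := LinearMap.congr_fun (comm (piEdge κ (dualE K H (G.tgt q)))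
      ⟨_, Algebra.subset_adjoin (Or.inl ⟨_, rfl⟩), rfl⟩) (Finsupp.single q 1)
    rw [Module.End.mul_apply, Module.End.mul_apply, piEdge_dualE he hc _ q, if_pos rfl] at h2
    exact h (by rw [← h2, key _ _ _ (piEdge_dualE he hc _) h1])

theorem projT_inclT (x : G.G2 →₀ K) : projT K G (inclT K G x) = x := by
  have : projT K G ∘ₗ inclT K G = LinearMap.id := by
    refine Finsupp.lhom_ext fun y c => ?_
    simp [projT, inclT, y.2]
  exact LinearMap.congr_fun this x

theorem inclT_projT (p q : E) (h : G.tgt p = G.src q) :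
    inclT K G (projT K G (Finsupp.single p 1 ⊗ₜ Finsupp.single q 1)) =
      Finsupp.single p 1 ⊗ₜ Finsupp.single q 1 := by
  simp [projT, inclT, h]

/-- `T ⊗̄ T` is the restriction of `T ⊗ T`. -/
theorem inclT_barT (he : ∀ i : V, κ (e K i) = e K i)
    (hc : ∀ a, counit (R := K) (κ a) = counit (R := K) a) {T : Module.End K (E →₀ K)}
    (hT : T ∈ EndE κ) (x : G.G2 →₀ K) :
    inclT K G (barT G T x) = TensorProduct.map T T (inclT K G x) := by
  suffices h : inclT K G ∘ₗ barT G T = TensorProduct.map T T ∘ₗ inclT K G from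
    LinearMap.congr_fun h x
  refine Finsupp.lhom_ext fun y c => ?_
  have hy : inclT K G (Finsupp.single y c) =
      c • (Finsupp.single y.1.1 1 ⊗ₜ Finsupp.single y.1.2 1) := by simp [inclT]
  have hsum : ∀ q : E, T (Finsupp.single q 1) =
      ∑ p : E, T (Finsupp.single q 1) p • Finsupp.single p 1 := fun q => by
    conv_lhs => rw [← Finsupp.univ_sum_single (T (Finsupp.single q 1))]
    simp
  simp only [barT, LinearMap.comp_apply, hy, map_smul, map_tmul]
  congr 1
  rw [hsum y.1.1, hsum y.1.2]
  simp only [sum_tmul, tmul_sum, map_sum]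
  refine Finset.sum_congr rfl fun b _ => Finset.sum_congr rfl fun a _ => ?_
  rw [TensorProduct.smul_tmul_smul, map_smul, map_smul]
  by_cases ha : T (Finsupp.single y.1.1 1) a = 0
  · rw [ha, zero_mul, zero_smul, zero_smul]
  by_cases hb : T (Finsupp.single y.1.2 1) b = 0
  · rw [hb, mul_zero, zero_smul, zero_smul]
  rw [inclT_projT]
  rw [(EndE_face he hc hT ha).2, (EndE_face he hc hT hb).1, y.2]

theorem barT_mul (he : ∀ i : V, κ (e K i) = e K i)
    (hc : ∀ a, counit (R := K) (κ a) = counit (R := K) a) {S T : Module.End K (E →₀ K)}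
    (hT : T ∈ EndE κ) : barT G (S * T) = barT G S * barT G T := by
  refine LinearMap.ext fun x => ?_
  rw [Module.End.mul_apply]
  conv_rhs => rw [barT]
  rw [LinearMap.comp_apply, LinearMap.comp_apply, inclT_barT he hc hT, barT, LinearMap.comp_apply,
    LinearMap.comp_apply]
  congr 1
  exact LinearMap.congr_fun (TensorProduct.map_comp S S T T) _

theorem barT_one : barT G (1 : Module.End K (E →₀ K)) = 1 := by
  refine LinearMap.ext fun x => ?_
  rw [barT, LinearMap.comp_apply, LinearMap.comp_apply]
  have : TensorProduct.map (1 : Module.End K (E →₀ K)) (1 : Module.End K (E →₀ K)) =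
    LinearMap.id := TensorProduct.map_id
  rw [this, LinearMap.id_apply, projT_inclT]
  rfl

namespace FaceModel

variable (M : FaceModel K G)

/-- The monoid of all `T` in `End_{π(E)} (K G¹)` with `(T ⊗̄ T) w = w (T ⊗̄ T)`. -/
def CommEnd : Submonoid (Module.End K (E →₀ K)) where
  carrier := {T | T ∈ EndE M.proj ∧ barT G T * M.op = M.op * barT G T}
  mul_mem' := fun {S T} hS hT => ⟨mul_mem hS.1 hT.1, by
    rw [barT_mul M.proj_e M.counit_proj hT.1, mul_assoc, hT.2, ← mul_assoc, hS.2, mul_assoc]⟩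
  one_mem' := ⟨one_mem _, by rw [barT_one, one_mul, mul_one]⟩

/-- The group of all `T` in `Aut_{π(E)} (K G¹)` with `(T ⊗̄ T) w = w (T ⊗̄ T)`. -/
def CommAut : Subgroup (Module.End K (E →₀ K))ˣ where
  carrier := {T | (T : Module.End K (E →₀ K)) ∈ M.CommEnd}
  mul_mem' := fun {S T} hS hT => M.CommEnd.mul_mem hS hT
  one_mem' := one_mem M.CommEnd
  inv_mem' := fun {T} hT => by
    have h1 : ((T⁻¹ : (Module.End K (E →₀ K))ˣ) : Module.End K (E →₀ K)) ∈ EndE M.proj := by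
      refine Submonoid.mem_centralizer_iff.2 fun X hX => ?_
      have : Commute X (T : Module.End K (E →₀ K)) := Submonoid.mem_centralizer_iff.1 hT.1 X hX
      exact this.units_inv_right.eq
    have h2 := barT_mul M.proj_e M.counit_proj (S := T) h1
    have h3 := barT_mul M.proj_e M.counit_proj (S := (T⁻¹ : (Module.End K (E →₀ K))ˣ)) hT.1
    rw [Units.mul_inv, barT_one] at h2
    rw [Units.inv_mul, barT_one] at h3
    have h4 : Commute ((⟨_, _, h2.symm, h3.symm⟩ : (Module.End K (G.G2 →₀ K))ˣ) :
        Module.End K (G.G2 →₀ K)) M.op := hT.2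
    exact ⟨h1, h4.units_inv_left.eq⟩

end FaceModel

end Comodule

end

end FaceAlg

open FaceAlg FaceAlgebra

/-! A group-like functional `f` is the same thing as a matrix representation on `K^V` that sends
both `e i` and `e° i` to the diagonal matrix unit `E_ii`. The matrix of `a` has the entries `f(e i a
e j)`, and `f(a)` is the sum of all of them (`IsGroupLike.rep`, `IsGroupLike.entrySum_rep`,
`isGroupLike_entrySum`). Functionals on algebras given by generators and relations can therefore be
built by choosing matrices for the generators and checking the relations, and two of them can be
compared on generators. The counit corresponds to `rep`. Since `f` commutes with the face
idempotents of the dual algebra, its representation is `rep` precomposed with `a ↦ ∑ a₁ f(a₂)`, or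
equally with `a ↦ ∑ f(a₁) a₂`.

Hopf closure. For `X` group-like on `Hc(H)`, the two antipode relations make `X ∘ σ` a two-sided
convolution inverse of `X ∘ ι`. Restriction thus lands in the invertible functionals. It is
injective because inverses are unique and `ι(H)`, `σ(H)` generate `Hc(H)`. For surjectivity, an
invertible group-like `u` yields matrices for `a` (from `u`) and for `σ(b)` (the transpose, from
`u⁻¹`). Compared with the counit representation of `Hc(H)`, which is known to satisfy the relations,
the products `c σ(b)` and `σ(b) c` are changed only by letting `u⁻¹ ⊗ u` act on `b ⊗ c`. In the
antipode relations `u` and `u⁻¹` cancel. The straightening relation survives because `u⁻¹ ⊗ u`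
commutes with `Q⁺`: the braiding axiom at `X = u` shows that `u ⊗ u` commutes with `R⁺`, hence with
its generalized inverse `R⁻`. Read in `(H ⊗ H^cop)^*`, this says that `u⁻¹ ⊗ u` commutes with `R⁻`,
hence with the generalized inverse `Q⁺` of `R⁻`.

Graphs. A representation of the above kind is forced on the vertices of `H(G)`, and vertices and
edges generate, so the functional is determined by `π(X)`. Conversely, commuting with `π(E)` forces
`T` to preserve sources and ranges of edges, which is exactly what makes the coefficients of the
tensor powers of `T` multiplicative along concatenation (`pathCoeff_cat`). On paths of length two
these coefficients are those of `T ⊗̄ T`, so the defining relations of `A(w)` turn into commutation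
with `w` (`pathRep_rel`, `piEdge_mem_CommEnd`). Passing to invertible elements and composing with
the isomorphism for the Hopf closure gives the last statement. -/

namespace FaceAlg

open FaceAlgebra OGraph.Path

noncomputable section

/-! ### Group-like functionals as matrix representations -/

section GroupLike

variable {K V H : Type*} [Field K] [Fintype V] [DecidableEq V] [Ring H] [Algebra K H]
  [Coalgebra K H] [FaceAlgebra K V H]

/-- The sum of the entries of a representation that sends both kinds of face idempotents to the
diagonal matrix units is group-like. -/
theorem isGroupLike_entrySum (ρ : H →ₐ[K] Matrix V V K)
    (he : ∀ i, ρ (e K i) = Matrix.single i i 1) (ho : ∀ i, ρ (eo K i) = Matrix.single i i 1) :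
    IsGroupLike K V H (toConv (entrySum K V ∘ₗ ρ.toLinearMap)) where
  map_mul a b := by
    simp only [LinearMap.comp_apply, AlgHom.toLinearMap_apply, map_mul, he, ho]
    -- The entry sum of `A B` is the sum over `k` of the `k`-th column sum of `A` times the `k`-th
    -- row sum of `B`. This is the group-like identity once `E_kk` stands for both idempotents.
    exact entrySum_mul _ _
  map_eo_mul_eo a i j := by
    simp only [LinearMap.comp_apply, AlgHom.toLinearMap_apply, map_mul, he, ho]
  map_eo_mul_e i j := by
    simp only [LinearMap.comp_apply, AlgHom.toLinearMap_apply, map_mul, he, ho]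
    split_ifs with h
    · subst h
      rw [Matrix.single_mul_single_same, entrySum_single, mul_one]
    · rw [Matrix.single_mul_single_of_ne _ _ _ _ h, map_zero]

namespace IsGroupLike

variable {f g : WithConv (H →ₗ[K] K)}

theorem map_eo_mul (hf : IsGroupLike K V H f) (i : V) (a : H) : f (eo K i * a) = f (e K i * a) := glf_l hf.map_eo_mul_eo i a

theorem map_mul_eo (hf : IsGroupLike K V H f) (i : V) (a : H) : f (a * eo K i) = f (a * e K i) := glf_r hf.map_eo_mul_eo i a

theorem map_e (hf : IsGroupLike K V H f) (i : V) : f (e K i) = 1 := ((isGroupLike_iff f).1 hf).2.2.1 i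

theorem map_eo (hf : IsGroupLike K V H f) (i : V) : f (eo K i) = 1 := by
  rw [← mul_one (eo K i : H), hf.map_eo_mul, mul_one, hf.map_e]

theorem commute_dualE (hf : IsGroupLike K V H f) (i : V) : Commute f (dualE K H i) := ((isGroupLike_iff f).1 hf).1 i

theorem commute_dualEo (hf : IsGroupLike K V H f) (i : V) : Commute f (dualEo K H i) := ((isGroupLike_iff f).1 hf).2.1 i

/-- The representation `a ↦ (f(e i a e j))` given by a group-like functional `f`. -/
def rep (hf : IsGroupLike K V H f) : H →ₐ[K] Matrix V V K :=
  AlgHom.ofLinearMap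
    { toFun := fun a => Matrix.of fun i j => f (e K i * a * e K j)
      map_add' := fun a b => by ext i j; simp [mul_add, add_mul]
      map_smul' := fun c a => by ext i j; simp }
    (by
      ext i j
      simp only [LinearMap.coe_mk, AddHom.coe_mk, Matrix.of_apply, mul_one, e_mul_e,
        Matrix.one_apply]
      split_ifs
      · exact hf.map_e i
      · simp)
    (fun a b => by
      ext i j
      simp only [LinearMap.coe_mk, AddHom.coe_mk, Matrix.of_apply, Matrix.mul_apply]
      -- Group-likeness splits `(e i a)(b e j)` along `e k` and `e° k`. Replacing `e° k` by `e k` at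
      -- the left end turns the sum into the matrix product.
      rw [← mul_assoc, mul_assoc (e K i * a), hf.map_mul]
      simp only [hf.map_eo_mul, mul_assoc])

theorem rep_apply (hf : IsGroupLike K V H f) (a : H) (i j : V) :
    hf.rep a i j = f (e K i * a * e K j) := rfl

/-- The `e i` sum to `1` on both sides of `a`. So the representation loses no information about `f`.
-/
theorem entrySum_rep (hf : IsGroupLike K V H f) (a : H) : entrySum K V (hf.rep a) = f a := by
  rw [entrySum_apply]
  simp only [rep_apply]
  simp_rw [← map_sum, ← Finset.mul_sum, ← Finset.sum_mul]
  simp [sum_e]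

theorem rep_e (hf : IsGroupLike K V H f) (k : V) : hf.rep (e K k) = Matrix.single k k 1 := by
  ext i j
  rw [rep_apply, e_mul_e, Matrix.single_apply]
  split_ifs with h1 h2 h2
  · rw [e_mul_e, if_pos (h1.trans h2.2), hf.map_e]
  · rw [e_mul_e, if_neg (fun h => h2 ⟨h1.symm, h1.symm.trans h⟩), map_zero]
  · exact absurd h2.1.symm h1
  · simp

/-- The idempotent `e° k` commutes past `e i` to the left end, where `f` cannot tell it from `e k`.
-/
theorem rep_eo (hf : IsGroupLike K V H f) (k : V) : hf.rep (eo K k) = Matrix.single k k 1 := by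
  rw [← hf.rep_e]
  ext i j
  rw [rep_apply, rep_apply, e_mul_eo, mul_assoc, hf.map_eo_mul, ← mul_assoc, e_mul_e, e_mul_e]
  split_ifs with h1 h2 h2
  · rw [h1]
  · exact absurd h1.symm h2
  · exact absurd h2.symm h1
  · simp

/-- Replaces an equality of functionals by one of algebra maps, which only has to be tested on
algebra generators. -/
theorem ext_rep (hf : IsGroupLike K V H f) (hg : IsGroupLike K V H g) (h : hf.rep = hg.rep) :
    f = g :=
  WithConv.ext (LinearMap.ext fun a => by rw [← hf.entrySum_rep, h, hg.entrySum_rep])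

/-- Since `f` commutes with the dual face idempotents, `a ↦ ∑ a₁ f(a₂)` commutes with multiplication
by `e i` on either side, and `ε` composed with it is `f`. This compares every group-like functional
with the counit, whose representation is known to extend to `Hc(H)`. -/
theorem rep_eq_rep_lact (hf : IsGroupLike K V H f) (a : H) : hf.rep a = FaceAlg.rep K V H (lact f a) := by
  ext i j
  have h1 : lact f (e K i * a * e K j) = e K i * lact f a * e K j := by
    rw [← lact_dualE, ← lact_mul, (hf.commute_dualE j).eq, lact_mul, lact_dualE, ← lact_dualEo,
      ← lact_mul, (hf.commute_dualEo i).eq, lact_mul, lact_dualEo]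
  rw [rep_apply, FaceAlg.rep_apply, ← h1]
  conv_lhs => rw [← one_mul f, ← apply_lact, LinearMap.convOne_apply]
  rfl

/-- The operator `a ↦ ∑ f(a₁) a₂` commutes with multiplication by `e° i` instead of `e i`. Both `f`
and `ε` are group-like and so take the same values on the two kinds of corners. -/
theorem rep_eq_rep_ract (hf : IsGroupLike K V H f) (a : H) : hf.rep a = FaceAlg.rep K V H (ract f a) := by
  ext i j
  have h1 : ract f (eo K i * a * eo K j) = eo K i * ract f a * eo K j := by
    rw [← ract_dualE, ← ract_mul, ← (hf.commute_dualE j).eq, ract_mul, ract_dualE, ← ract_dualEo,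
      ← ract_mul, ← (hf.commute_dualEo i).eq, ract_mul, ract_dualEo]
  have h2 := (isGroupLike_one (K := K) (V := V) (H := H)).map_eo_mul_eo (ract f a) i j
  simp only [LinearMap.convOne_apply, Algebra.algebraMap_self, RingHom.id_apply] at h2
  rw [rep_apply, FaceAlg.rep_apply, ← h2, ← h1, ← hf.map_eo_mul_eo]
  conv_lhs => rw [← mul_one f, ← apply_ract, LinearMap.convOne_apply]
  rfl

end IsGroupLike

end GroupLike

/-! ### Functionals and maps of face algebras -/

section FaceMap

variable {K V H L : Type*} [Field K] [Fintype V] [DecidableEq V] [Ring H] [Algebra K H]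
  [Coalgebra K H] [FaceAlgebra K V H] [Ring L] [Algebra K L] [Coalgebra K L] [FaceAlgebra K V L]

variable (V) in
/-- An algebra map is a map of face algebras if it preserves the face idempotents, the
comultiplication and the counit. -/
structure IsFaceMap (κ : H →ₐ[K] L) : Prop where
  map_e : ∀ i : V, κ (e K i) = e K i
  map_eo : ∀ i : V, κ (eo K i) = eo K i
  counit_map : ∀ a, counit (R := K) (κ a) = counit (R := K) a
  comul_map : ∀ a, comul (R := K) (κ a) =
    TensorProduct.map κ.toLinearMap κ.toLinearMap (comul (R := K) a)

variable (K V H) in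
theorem isFaceMap_id : IsFaceMap V (AlgHom.id K H) where
  map_e _ := rfl
  map_eo _ := rfl
  counit_map _ := rfl
  comul_map a := (LinearMap.congr_fun (TensorProduct.map_id (R := K) (M := H) (N := H))
    (comul (R := K) a)).symm

/-- The functional `X ∘ κ`. -/
def pull (κ : H →ₐ[K] L) (X : WithConv (L →ₗ[K] K)) : WithConv (H →ₗ[K] K) :=
  toConv (X.ofConv ∘ₗ κ.toLinearMap)

theorem pull_apply (κ : H →ₐ[K] L) (X : WithConv (L →ₗ[K] K)) (a : H) :
    pull κ X a = X (κ a) := rfl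

variable {κ : H →ₐ[K] L}

theorem IsFaceMap.pull_mul (hκ : IsFaceMap V κ) (X Y : WithConv (L →ₗ[K] K)) :
    pull κ (X * Y) = pull κ X * pull κ Y := by
  refine WithConv.ext (LinearMap.ext fun a => ?_)
  rw [pull_apply, conv_apply', conv_apply', hκ.comul_map]
  generalize comul (R := K) a = z
  induction z with
  | zero => simp
  | tmul x y => simp [pull]
  | add x y hx hy => simp only [map_add, hx, hy]

theorem IsFaceMap.pull_one (hκ : IsFaceMap V κ) :
    pull κ (1 : WithConv (L →ₗ[K] K)) = 1 := by
  refine WithConv.ext (LinearMap.ext fun a => ?_)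
  rw [pull_apply, LinearMap.convOne_apply, LinearMap.convOne_apply, hκ.counit_map]

theorem IsGroupLike.pull (hκ : IsFaceMap V κ) {X : WithConv (L →ₗ[K] K)}
    (hX : IsGroupLike K V L X) : IsGroupLike K V H (pull κ X) where
  map_mul a b := by
    simp only [pull_apply, _root_.map_mul, hκ.map_e, hκ.map_eo]
    exact hX.map_mul _ _
  map_eo_mul_eo a i j := by
    simp only [pull_apply, _root_.map_mul, hκ.map_e, hκ.map_eo]
    exact hX.map_eo_mul_eo _ i j
  map_eo_mul_e i j := by
    simp only [pull_apply, _root_.map_mul, hκ.map_e, hκ.map_eo]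
    exact hX.map_eo_mul_e i j

end FaceMap

/-! ### Group-like functionals and the braiding -/

/-- The identities `ep xm = xm = xm em` allow `t xm = ep t xm = xm xp t xm = xm t xp xm = xm t em =
xm t`. This is the analogue of the fact that whatever commutes with a unit commutes with its
inverse, and it is used for the pair `R⁺`, `R⁻` and again for `R⁻`, `Q⁺`. -/
theorem IsGenInv.commute {A : Type*} [Monoid A] {ep em xp xm t : A} (h : IsGenInv ep em xp xm)
    (h1 : Commute t ep) (h2 : Commute t em) (h3 : Commute t xp) : Commute t xm := by
  have e1 : ep * xm = xm := by rw [← h.mul_eq_ep, h.mul_mul_inv]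
  have e2 : xm * em = xm := by rw [← h.mul_eq_em, ← mul_assoc, h.mul_mul_inv]
  calc t * xm = xm * (xp * t) * xm := by
        rw [← mul_assoc, h.mul_eq_ep, ← h1.eq, mul_assoc, e1]
    _ = xm * t * em := by rw [← h3.eq, ← h.mul_eq_em]; simp only [mul_assoc]
    _ = xm * t := by rw [mul_assoc, h2.eq, ← mul_assoc, e2]

section Braiding

variable {K V H : Type*} [Field K] [Fintype V] [DecidableEq V] [Ring H] [Algebra K H]
  [Coalgebra K H] [FaceAlgebra K V H]

theorem mulOpPull_one : mulOpPull (1 : WithConv (H →ₗ[K] K)) =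
    ∑ k : V, tmulF (dualEo K H k) (dualE K H k) := by
  refine WithConv.ext (TensorProduct.ext' fun a b => ?_)
  rw [mulOpPull_apply, LinearMap.convOne_apply, counit_mul' V]
  simp [mul_comm]

namespace IsGroupLike

variable {f : WithConv (H →ₗ[K] K)}

/-- The expansion `f(b a) = ∑ f(b e k) f(e k a)` read with the tensor factors exchanged: `f ⊗ f`
times the same idempotent form that represents `ε(b a)`. -/
theorem mulOpPull_eq (hf : IsGroupLike K V H f) :
    mulOpPull f = tmulF f f * mulOpPull 1 := by
  rw [mulOpPull_one (V := V), Finset.mul_sum]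
  simp_rw [tmulF_mul]
  refine WithConv.ext (TensorProduct.ext' fun a b => ?_)
  rw [mulOpPull_apply, hf.map_mul]
  simp [hf.map_eo_mul, mul_dualE, mul_dualEo, -LinearMap.convMul_apply, mul_comm]

theorem commute_mulPull_one (hf : IsGroupLike K V H f) : Commute (tmulF f f) (mulPull 1) :=
  tmulF_comm hf.commute_dualE hf.commute_dualEo

theorem commute_mulOpPull_one (hf : IsGroupLike K V H f) :
    Commute (tmulF f f) (mulOpPull 1) := by
  rw [mulOpPull_one (V := V)]
  refine Commute.sum_right _ _ _ fun k _ => ?_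
  rw [Commute, SemiconjBy, tmulF_mul, tmulF_mul, (hf.commute_dualE k).eq, (hf.commute_dualEo k).eq]

/-- The braiding axiom at `X = f`, multiplied by `R⁺` on the right, moves `m^*(f)` past `R⁺`. Both
pullbacks of `f` are `f ⊗ f` times the corresponding pullback of `1`, and these pullbacks of `1` are
absorbed by `R⁺` on the appropriate side. No invertibility of `f` is needed. -/
theorem commute_Rp (hf : IsGroupLike K V H f) (C : CQT K H) : Commute (tmulF f f) C.Rp := by
  have e1 : mulOpPull 1 * C.Rp = C.Rp := by rw [← C.genInv.mul_eq_em, C.genInv.mul_mul_self]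
  have e2 : C.Rp * mulPull 1 = C.Rp := by
    rw [← C.genInv.mul_eq_ep, ← mul_assoc, C.genInv.mul_mul_self]
  have e3 : mulPull f = tmulF f f * mulPull 1 := ((isGroupLike_iff f).1 hf).2.2.2
  calc tmulF f f * C.Rp = mulOpPull f * C.Rp := by rw [hf.mulOpPull_eq, mul_assoc, e1]
    _ = C.Rp * (mulPull f * mulPull 1) := by
        rw [← C.braid, mul_assoc, C.genInv.mul_eq_ep, mul_assoc]
    _ = C.Rp * tmulF f f := by
        rw [← mulPull_mul V, mul_one, e3, hf.commute_mulPull_one.eq, ← mul_assoc, e2]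

theorem commute_Rm (hf : IsGroupLike K V H f) (C : CQT K H) : Commute (tmulF f f) C.Rm :=
  C.genInv.commute hf.commute_mulPull_one hf.commute_mulOpPull_one (hf.commute_Rp C)

end IsGroupLike

/-! ### The action of an invertible group-like functional on the Lyubashenko forms. -/

variable {u : (WithConv (H →ₗ[K] K))ˣ}

/-- The functional `u⁻¹ ⊗ u` on `H ⊗ H^cop`. -/
def invTmul (u : (WithConv (H →ₗ[K] K))ˣ) : WithConv (H ⊗[K] Cop H →ₗ[K] K) :=
  tmulF (u⁻¹ : (WithConv (H →ₗ[K] K))ˣ).val (copF u.val)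

/-- The convolution product of `(H ⊗ H^cop)^*` is reversed in the second factor, so the claim means
`(u⁻¹ ⊗ 1) R⁻ (1 ⊗ u) = (1 ⊗ u) R⁻ (u⁻¹ ⊗ 1)` in `(H ⊗ H)^*`. This is the identity `R⁻ (u ⊗ u) = (u
⊗ u) R⁻` multiplied by `u⁻¹ ⊗ 1` on both sides. -/
theorem invTmul_commute_Rm (C : CCQT K V H) (hu : IsGroupLike K V H u) : Commute (invTmul u) (onCop C.Rm) := by
  refine WithConv.ext (cop_ext fun b c => ?_)
  rw [← apply_ract, ← apply_lact, invTmul, lact_tmulF, ract_tmulF, lact_copF, ract_copF,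
    onCop_apply, onCop_apply]
  -- Evaluation with both one-sided actions of `u⁻¹` on `b` is multiplication of the functional by
  -- `u⁻¹ ⊗ 1` on the left and on the right.
  have h := congrArg (fun X => X.ofConv (lact u⁻¹.val (ract u⁻¹.val b) ⊗ₜ[K] c))
    (hu.commute_Rm C.toCQT).eq
  beta_reduce at h
  rw [← apply_ract, ← apply_lact, lact_tmulF, ract_tmulF, ← lact_ract_comm, ← ract_mul,
    Units.inv_mul, ract_one, LinearMap.id_apply, ← lact_mul, Units.mul_inv, lact_one, LinearMap.id_apply] at h
  exact h.symm

/-- Passing to `H^cop` reverses the convolution product, and commutation is symmetric. -/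
theorem copF_commute {f g : WithConv (H →ₗ[K] K)} (h : Commute f g) :
    Commute (copF f) (copF g) := by
  refine WithConv.ext (LinearMap.ext fun b => ?_)
  obtain ⟨b, rfl⟩ := (toCop K H).surjective b
  rw [← apply_ract, ← apply_lact, lact_copF, ract_copF, copF_apply, copF_apply, apply_ract,
    apply_lact, h.eq]

theorem invTmul_commute_Fplus (hu : IsGroupLike K V H u) :
    Commute (invTmul u) (Fplus K V H) := by
  refine Commute.sum_right _ _ _ fun k _ => ?_
  rw [Commute, SemiconjBy, invTmul, tmulF_mul, tmulF_mul, (hu.inv.commute_dualEo k).eq,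
    (copF_commute (hu.commute_dualEo k)).eq]

theorem invTmul_commute_Fminus (hu : IsGroupLike K V H u) :
    Commute (invTmul u) (Fminus K V H) := by
  refine Commute.sum_right _ _ _ fun k _ => ?_
  rw [Commute, SemiconjBy, invTmul, tmulF_mul, tmulF_mul, (hu.inv.commute_dualE k).eq,
    (copF_commute (hu.commute_dualE k)).eq]

/-- `Q⁺` is a generalized inverse of `R⁻` relative to `F⁻` and `F⁺`. The functional `u⁻¹ ⊗ u`
commutes with all three, with `F⁻` and `F⁺` because they are built from the dual face idempotents.
-/
theorem invTmul_commute_Qp (C : CCQT K V H)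
    (hu : IsGroupLike K V H u) : Commute (invTmul u) C.Qp :=
  C.genInv_Qp.commute (invTmul_commute_Fminus hu) (invTmul_commute_Fplus hu)
    (invTmul_commute_Rm C hu)

end Braiding

/-! ### Group-like functionals on the Hopf closure -/

/-- In `∑ a₁ f(a₂) ⊗ g(a₃) a₄` the two middle legs combine to `(f * g)(a₂) = ε(a₂)`. Used to cancel
`u` against `u⁻¹` in the antipode relations. -/
theorem map_lact_ract {K C : Type*} [Field K] [AddCommGroup C] [Module K C] [Coalgebra K C]
    {f g : WithConv (C →ₗ[K] K)} (h : f * g = 1) (a : C) :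
    TensorProduct.map (lact f) (ract g) (comul (R := K) a) = comul (R := K) a := by
  have h1 : ract g ∘ₗ ract f = LinearMap.id := LinearMap.ext fun x => by
    rw [LinearMap.comp_apply, ← ract_mul, h, ract_one]
  rw [← LinearMap.lTensor_comp_rTensor, LinearMap.comp_apply, lact_ract_mid,
    ← LinearMap.comp_apply, ← LinearMap.lTensor_comp, h1, LinearMap.lTensor_id,
    LinearMap.id_apply]

namespace Hc

variable {K V H : Type*} [Field K] [Fintype V] [DecidableEq V] [Ring H] [Algebra K H]
  [Coalgebra K H] [FaceAlgebra K V H] (C : CCQT K V H)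

theorem isFaceMap_iota : IsFaceMap V (iota C) where
  map_e _ := rfl
  map_eo _ := rfl
  counit_map := eps_iota C
  comul_map := comulHc_iota C

/-! ### Extending an invertible group-like functional from `H` to `Hc(H)`. -/

section Extend

variable {u : (WithConv (H →ₗ[K] K))ˣ} (hu : IsGroupLike K V H u)

/-- `σ(b) ↦ (u⁻¹(e j b e i))`. -/
def glRepS : H →ₗ[K] Matrix V V K :=
  (Matrix.transposeLinearEquiv V V K K).toLinearMap ∘ₗ hu.inv.rep.toLinearMap

theorem glRepS_apply (b : H) : glRepS hu b = (hu.inv.rep b).transpose := rfl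

theorem glRepS_eq (b : H) : glRepS hu b = repS (V := V) (lact u⁻¹.val b) := by
  rw [glRepS_apply, hu.inv.rep_eq_rep_lact]
  rfl

theorem repHc_comp_iota : (repHc C).toLinearMap ∘ₗ (iota C).toLinearMap =
    (rep K V H).toLinearMap := LinearMap.ext (repHc_iota C)

theorem repHc_comp_sig : (repHc C).toLinearMap ∘ₗ sig C = repS := LinearMap.ext (repHc_sig C)

/-- This is the straightening relation of `Hc(H)` seen through its counit representation. It is the
known case from which the relation for general `u` is deduced. -/
theorem repS_mul_rep (x : H ⊗[K] Cop H) :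
    prodSL (rep K V H).toLinearMap repS x =
      prodLS (rep K V H).toLinearMap repS (twist C x) := by
  have h1 := congrArg (repHc C) (straighten C x)
  rw [map_prodLS, repHc_comp_iota, repHc_comp_sig] at h1
  rw [← h1]
  suffices h : prodSL (rep K V H).toLinearMap repS =
      (repHc C).toLinearMap ∘ₗ prodSL (iota C).toLinearMap (sig C) from LinearMap.congr_fun h x
  refine cop_ext fun b c => ?_
  simp only [LinearMap.comp_apply, prodSL_apply, AlgHom.toLinearMap_apply, map_mul, repHc_iota,
    repHc_sig]
  rfl

/-- The matrix of `σ(b)` absorbs `u⁻¹` as `∑ b₁ u⁻¹(b₂)` and that of `c` absorbs `u` as `∑ u(c₁)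
c₂`. Since the coproduct of the second factor is reversed, both are right legs in `H ⊗ H^cop`, so
together they form one action of `u⁻¹ ⊗ u`. -/
theorem prodLS_glRep (x : H ⊗[K] Cop H) : prodLS hu.rep.toLinearMap (glRepS hu) x =
    prodLS (rep K V H).toLinearMap repS (lact (invTmul u) x) := by
  suffices h : prodLS hu.rep.toLinearMap (glRepS hu) =
      prodLS (rep K V H).toLinearMap repS ∘ₗ lact (invTmul u) from LinearMap.congr_fun h x
  refine cop_ext fun b c => ?_
  rw [LinearMap.comp_apply, invTmul, lact_tmulF, lact_copF, prodLS_apply, prodLS_apply,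
    glRepS_eq, AlgHom.toLinearMap_apply, hu.rep_eq_rep_ract, AlgHom.toLinearMap_apply]

/-- The action of `u⁻¹ ⊗ u` uses the last leg, as does `Q⁺`, with which it commutes, while `R⁻` acts
on the first leg and is out of the way by coassociativity. Hence the action passes through `twist`,
and the relation reduces to the one for the counit representation. -/
theorem glRepS_mul_rep (b c : H) : glRepS hu b * hu.rep c =
    prodLS hu.rep.toLinearMap (glRepS hu) (twist C (b ⊗ₜ toCop K H c)) := by
  have h : ∀ x, lact (invTmul u) (twist C x) = twist C (lact (invTmul u) x) := fun x => by
    rw [twist, LinearMap.comp_apply, LinearMap.comp_apply, ← lact_mul,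
      (invTmul_commute_Qp C hu).eq, lact_mul, lact_ract_comm]
  rw [prodLS_glRep, h, ← repS_mul_rep, invTmul, lact_tmulF, lact_copF, prodSL_apply, glRepS_eq,
    hu.rep_eq_rep_ract, AlgHom.toLinearMap_apply]

/-- In `∑ σ(a₁) a₂` the functional `u⁻¹` is attached to the right of `a₁` and `u` to the left of
`a₂`, so they meet and cancel as `u⁻¹ * u = 1`. -/
theorem map_glRepS_rep (a : H) :
    TensorProduct.map (glRepS hu) hu.rep.toLinearMap (comul (R := K) a) =
      TensorProduct.map (repS (V := V)) (rep K V H).toLinearMap (comul (R := K) a) := by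
  have h1 : glRepS hu = repS (V := V) ∘ₗ lact u⁻¹.val := LinearMap.ext (glRepS_eq hu)
  have h2 : hu.rep.toLinearMap = (rep K V H).toLinearMap ∘ₗ ract u.val :=
    LinearMap.ext hu.rep_eq_rep_ract
  rw [h1, h2, TensorProduct.map_comp, LinearMap.comp_apply]
  rw [map_lact_ract (Units.inv_mul u)]

/-- In `∑ a₁ σ(a₂)` the functionals `u` and `u⁻¹` are attached to the inner sides of `a₁` and `a₂`,
which needs the other one-sided formula for each of them. They cancel as `u * u⁻¹ = 1`. -/
theorem map_rep_glRepS (a : H) :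
    TensorProduct.map hu.rep.toLinearMap (glRepS hu) (comul (R := K) a) =
      TensorProduct.map (rep K V H).toLinearMap (repS (V := V)) (comul (R := K) a) := by
  have h1 : glRepS hu = repS (V := V) ∘ₗ ract u⁻¹.val := LinearMap.ext fun b => by
    rw [glRepS_apply, hu.inv.rep_eq_rep_ract]
    rfl
  have h2 : hu.rep.toLinearMap = (rep K V H).toLinearMap ∘ₗ lact u.val :=
    LinearMap.ext hu.rep_eq_rep_lact
  rw [h1, h2, TensorProduct.map_comp, LinearMap.comp_apply]
  rw [map_lact_ract (Units.mul_inv u)]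

/-- The representation `a ↦ (u(e i a e j))`, `σ(b) ↦ (u⁻¹(e j b e i))` of the free algebra. -/
def preGlRep : TensorAlgebra K (H × H) →ₐ[K] Matrix V V K :=
  TensorAlgebra.lift K (hu.rep.toLinearMap.coprod (glRepS hu))

theorem preGlRep_genL (a : H) : preGlRep hu (genL K H a) = hu.rep a := by
  simp [preGlRep, genL]

theorem preGlRep_genS (a : H) : preGlRep hu (genS K H a) = glRepS hu a := by
  simp [preGlRep, genS]

theorem preGlRep_comp_genL :
    (preGlRep hu).toLinearMap ∘ₗ genL K H = hu.rep.toLinearMap := LinearMap.ext (preGlRep_genL hu)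

theorem preGlRep_comp_genS :
    (preGlRep hu).toLinearMap ∘ₗ genS K H = glRepS hu := LinearMap.ext (preGlRep_genS hu)

/-- Multiplicativity and the values on idempotents come from `u` and `u⁻¹` being group-like, with
the transpose accounting for the reversed product in `σ`. The straightening and antipode relations
are transported from the counit representation. -/
theorem preGlRep_rel ⦃x y : TensorAlgebra K (H × H)⦄ (h : HcRel C x y) :
    preGlRep hu x = preGlRep hu y := by
  induction h with
  | one => simp [preGlRep_genL]
  | mul a b => simp [preGlRep_genL]
  | sig_mul a b => simp [preGlRep_genS, glRepS_apply]
  | sig_e i =>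
    rw [preGlRep_genL, preGlRep_genS, glRepS_apply, hu.inv.rep_e, hu.rep_eo,
      Matrix.transpose_single]
  | sig_eo i =>
    rw [preGlRep_genL, preGlRep_genS, glRepS_apply, hu.inv.rep_eo, hu.rep_e,
      Matrix.transpose_single]
  | straighten b c =>
    rw [map_prodLS, preGlRep_comp_genL, preGlRep_comp_genS, map_mul, preGlRep_genL, preGlRep_genS]
    exact glRepS_mul_rep C hu b c
  | antipode_left a =>
    rw [map_mul_map, preGlRep_comp_genL, preGlRep_comp_genS, map_glRepS_rep, preGlRep_genL]
    -- After the cancellation only the counit representation is left, and it satisfies the relation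
    -- because it is defined on `Hc(H)`. The right-hand side is a combination of face idempotents,
    -- on which the two representations agree.
    have h := congrArg (repHc C) (antipode_left C a)
    rw [map_mul_map, repHc_comp_iota, repHc_comp_sig, repHc_iota] at h
    rw [h, Eplus, map_sum, map_sum]
    simp only [map_smul, rep_e, hu.rep_e]
  | antipode_right a =>
    rw [map_mul_map, preGlRep_comp_genL, preGlRep_comp_genS, map_rep_glRepS, preGlRep_genL]
    have h := congrArg (repHc C) (antipode_right C a)
    rw [map_mul_map, repHc_comp_iota, repHc_comp_sig, repHc_iota] at h
    rw [h, Eminus, map_sum, map_sum]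
    simp only [map_smul, rep_eo, hu.rep_eo]

/-- The representation `a ↦ (u(e i a e j))`, `σ(b) ↦ (u⁻¹(e j b e i))` of `Hc(H)`. -/
def glRep : Hc C →ₐ[K] Matrix V V K := lift C (preGlRep hu) (preGlRep_rel C hu)

theorem glRep_iota (a : H) : glRep C hu (iota C a) = hu.rep a := by
  rw [← mk_genL, glRep, lift_mk, preGlRep_genL]

theorem isGroupLike_glRep :
    IsGroupLike K V (Hc C) (toConv (entrySum K V ∘ₗ (glRep C hu).toLinearMap)) :=
  isGroupLike_entrySum _ (fun i => (glRep_iota C hu _).trans (hu.rep_e i))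
    fun i => (glRep_iota C hu _).trans (hu.rep_eo i)

end Extend

/-! ### Restricting a group-like functional from `Hc(H)` to `H`. -/

section Restrict

/-- The functional `X ∘ σ`. -/
def pullSig (X : WithConv (Hc C →ₗ[K] K)) : WithConv (H →ₗ[K] K) :=
  toConv (X.ofConv ∘ₗ sig C)

theorem pullSig_apply (X : WithConv (Hc C →ₗ[K] K)) (a : H) :
    pullSig C X a = X (sig C a) := rfl

theorem e_def (i : V) : (e K i : Hc C) = iota C (e K i) := rfl

theorem eo_def (i : V) : (eo K i : Hc C) = iota C (eo K i) := rfl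

variable {C} {X Y : WithConv (Hc C →ₗ[K] K)}

/-- Group-likeness inserts `e k` and `e° k` between the factors, and `e° k σ(b) = σ(b e k)` because
`σ` reverses products and exchanges the idempotents. -/
theorem apply_iota_mul_sig (hX : IsGroupLike K V (Hc C) X) (a b : H) :
    X (iota C a * sig C b) = ∑ k : V, pull (iota C) X (a * e K k) * pullSig C X (b * e K k) := by
  rw [hX.map_mul]
  simp only [e_def, eo_def, pull_apply, pullSig_apply, map_mul, sig_mul, sig_e]

/-- Here `σ(a) e k = σ(e° k a)` moves the inserted idempotent into `σ`. -/
theorem apply_sig_mul_iota (hX : IsGroupLike K V (Hc C) X) (a b : H) :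
    X (sig C a * iota C b) = ∑ k : V, pullSig C X (eo K k * a) * pull (iota C) X (eo K k * b) := by
  rw [hX.map_mul]
  simp only [e_def, eo_def, pull_apply, pullSig_apply, map_mul, sig_mul, sig_eo]

/-- Applying `σ` turns the summand into `e° k e k σ(b)`, and `X` reads `e° k` at the left end as `e
k`. The `e k` then sum to `1`. -/
theorem sum_pullSig_mul (hX : IsGroupLike K V (Hc C) X) (b : H) :
    ∑ k : V, pullSig C X (b * (eo K k * e K k)) = pullSig C X b := by
  have h : ∀ k : V, pullSig C X (b * (eo K k * e K k)) = X (e K k * sig C b) := fun k => by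
    rw [pullSig_apply, sig_mul, sig_mul, sig_e, sig_eo, ← e_def, ← eo_def, ← e_mul_eo, e_mul_eo,
      mul_assoc, hX.map_eo_mul, ← mul_assoc, e_mul_e, if_pos rfl]
  simp_rw [h]
  rw [← map_sum, ← Finset.sum_mul, sum_e, one_mul, pullSig_apply]

/-- The idempotents now stand to the right of `σ(b)`, where `X` reads `e° k` as `e k`. -/
theorem sum_mul_pullSig (hX : IsGroupLike K V (Hc C) X) (b : H) :
    ∑ k : V, pullSig C X (eo K k * e K k * b) = pullSig C X b := by
  have h : ∀ k : V, pullSig C X (eo K k * e K k * b) = X (sig C b * e K k) := fun k => by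
    rw [pullSig_apply, sig_mul, sig_mul, sig_e, sig_eo, ← e_def, ← eo_def, ← e_mul_eo,
      ← mul_assoc, hX.map_mul_eo, mul_assoc, e_mul_e, if_pos rfl]
  simp_rw [h]
  rw [← map_sum, ← Finset.mul_sum, sum_e, mul_one, pullSig_apply]

/-- Evaluate `X` on the antipode relation for `∑ a₁ σ(a₂)`. The right-hand side gives `ε(a)` because
`X(e° k) = 1`. The left-hand side is the convolution product with `e k` inserted in both factors,
and these idempotents have to be removed. -/
theorem pull_iota_mul_pullSig (hX : IsGroupLike K V (Hc C) X) :
    pull (iota C) X * pullSig C X = 1 := by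
  refine WithConv.ext (LinearMap.ext fun a => ?_)
  have h1 : X (LinearMap.mul' K (Hc C) (TensorProduct.map (iota C).toLinearMap (sig C)
      (comul (R := K) a))) = counit (R := K) a := by
    rw [antipode_right, Eminus, map_sum, map_sum]
    simp only [map_smul, ← eo_def, hX.map_eo]
    simp only [smul_eq_mul, mul_one]
    rw [← map_sum, ← Finset.sum_mul, sum_e, one_mul]
  have h2 : ∀ z : H ⊗[K] H, X (LinearMap.mul' K (Hc C) (TensorProduct.map (iota C).toLinearMap
      (sig C) z)) = ∑ k : V, TensorProduct.lift ((pull (iota C) X).ofConv.smulRight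
        (pullSig C X).ofConv) (z * (e K k ⊗ₜ[K] 1) * (1 ⊗ₜ[K] e K k)) := fun z => by
    induction z with
    | zero => simp
    | tmul x y => simp [apply_iota_mul_sig hX, -map_mul]
    | add x y hx hy => simp only [map_add, add_mul, hx, hy, Finset.sum_add_distrib]
  rw [h2] at h1
  -- The idempotent `e k` on the first leg of `Δ(a)` equals `e° k` on the second leg. There it meets
  -- the other `e k`, and the pair `e° k e k` sums away.
  simp only [comul_e_right] at h1
  rw [LinearMap.convOne_apply, conv_apply', Algebra.algebraMap_self, RingHom.id_apply, ← h1]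
  generalize comul (R := K) a = z
  induction z with
  | zero => simp
  | tmul x y =>
    simp only [Algebra.TensorProduct.tmul_mul_tmul, mul_one, lift.tmul, LinearMap.smulRight_apply, LinearMap.smul_apply, mul_assoc y]
    rw [← Finset.smul_sum, sum_pullSig_mul hX]
  | add x y hx hy => simp only [map_add, add_mul, hx, hy, Finset.sum_add_distrib]

/-- The same evaluation for `∑ σ(a₁) a₂`: here `e° k` on the left of the second leg becomes `e k` on
the left of the first leg, and the pair again sums away. -/
theorem pullSig_mul_pull_iota (hX : IsGroupLike K V (Hc C) X) :
    pullSig C X * pull (iota C) X = 1 := by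
  refine WithConv.ext (LinearMap.ext fun a => ?_)
  have h1 : X (LinearMap.mul' K (Hc C) (TensorProduct.map (sig C) (iota C).toLinearMap
      (comul (R := K) a))) = counit (R := K) a := by
    rw [antipode_left, Eplus, map_sum, map_sum]
    simp only [map_smul, ← e_def, hX.map_e]
    simp only [smul_eq_mul, mul_one]
    rw [← map_sum, ← Finset.mul_sum, sum_e, mul_one]
  have h2 : ∀ z : H ⊗[K] H, X (LinearMap.mul' K (Hc C) (TensorProduct.map (sig C)
      (iota C).toLinearMap z)) = ∑ k : V, TensorProduct.lift ((pullSig C X).ofConv.smulRight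
        (pull (iota C) X).ofConv) ((eo K k ⊗ₜ[K] 1) * ((1 ⊗ₜ[K] eo K k) * z)) := fun z => by
    induction z with
    | zero => simp
    | tmul x y => simp [apply_sig_mul_iota hX, -map_mul]
    | add x y hx hy => simp only [map_add, mul_add, hx, hy, Finset.sum_add_distrib]
  rw [h2] at h1
  simp only [← e_comul] at h1
  rw [LinearMap.convOne_apply, conv_apply', Algebra.algebraMap_self, RingHom.id_apply, ← h1]
  generalize comul (R := K) a = z
  induction z with
  | zero => simp
  | tmul x y =>
    simp only [Algebra.TensorProduct.tmul_mul_tmul, one_mul, lift.tmul, LinearMap.smulRight_apply,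
      LinearMap.smul_apply, ← mul_assoc]
    rw [← Finset.sum_smul, sum_mul_pullSig hX]
  | add x y hx hy => simp only [map_add, mul_add, hx, hy, Finset.sum_add_distrib]

/-- Both functionals are convolution inverses of the same element. -/
theorem pullSig_eq_of_pull_iota_eq (hX : IsGroupLike K V (Hc C) X) (hY : IsGroupLike K V (Hc C) Y)
    (h : pull (iota C) X = pull (iota C) Y) : pullSig C X = pullSig C Y :=
  left_inv_eq_right_inv (pullSig_mul_pull_iota hX) (h ▸ pull_iota_mul_pullSig hY)

/-- The values on `ι(H)` determine those on `σ(H)` by uniqueness of inverses. The two images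
generate `Hc(H)`, so the matrix representations coincide. -/
theorem isGroupLike_ext (hX : IsGroupLike K V (Hc C) X) (hY : IsGroupLike K V (Hc C) Y)
    (h : pull (iota C) X = pull (iota C) Y) : X = Y := by
  have hs := pullSig_eq_of_pull_iota_eq hX hY h
  refine hX.ext_rep hY (AlgHom.ext_of_adjoin_eq_top (adjoin_top C) ?_)
  rintro _ (⟨a, rfl⟩ | ⟨b, rfl⟩)
  · ext i j
    rw [IsGroupLike.rep_apply, IsGroupLike.rep_apply, e_def, e_def, ← map_mul, ← map_mul,
      ← pull_apply, ← pull_apply, h]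
  -- Each face idempotent of `Hc(H)` is itself in the image of `σ`, so an entry of the matrix of
  -- `σ(b)` is a value of `X ∘ σ`.
  · ext i j
    rw [IsGroupLike.rep_apply, IsGroupLike.rep_apply, e_def, e_def, ← sig_eo, ← sig_eo, ← sig_mul,
      ← sig_mul, ← pullSig_apply, ← pullSig_apply, hs]

end Restrict

/-- The restriction `X ↦ X ∘ ι` as a homomorphism from `GLF(Hc(H))` to `GLF(H)^×`. -/
def restrict : GLF K V (Hc C) →* GLFUnits K V H where
  -- The restriction is invertible without further assumptions on `X`, and its inverse is recorded
  -- as `X ∘ σ`.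
  toFun X := ⟨⟨pull (iota C) X.1, pullSig C X.1, pull_iota_mul_pullSig X.2, pullSig_mul_pull_iota X.2⟩,
    IsGroupLike.pull (isFaceMap_iota C) X.2⟩
  map_one' := Subtype.ext (Units.ext (isFaceMap_iota C).pull_one)
  map_mul' X Y := Subtype.ext (Units.ext ((isFaceMap_iota C).pull_mul X.1 Y.1))

/-- The preimage of `u` is the entry sum of the representation `glRep` of `Hc(H)`. On `ι(a)` it
gives back the entry sum of the matrix of `a`, which is `u(a)`. -/
theorem restrict_bijective : Function.Bijective (restrict (V := V) C) := by
  refine ⟨fun X Y h => Subtype.ext (isGroupLike_ext X.2 Y.2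
    (congrArg (fun u : GLFUnits K V H => u.1.1) h)), fun ⟨u, hu⟩ => ?_⟩
  have hu' : IsGroupLike K V H u := hu
  refine ⟨⟨_, isGroupLike_glRep C hu'⟩, Subtype.ext (Units.ext (WithConv.ext
    (LinearMap.ext fun a => ?_)))⟩
  change entrySum K V (glRep C hu' (iota C a)) = u.1 a
  rw [glRep_iota, IsGroupLike.entrySum_rep]

/-- The isomorphism `GLF(Hc(H)) ≅ GLF(H)^×`. -/
def restrictEquiv : GLF K V (Hc C) ≃* GLFUnits K V H :=
  MulEquiv.ofBijective (restrict C) (restrict_bijective C)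

/-- Write `u = X ∘ ι`. Then `u⁻¹` is `X ∘ σ` by the construction of the restriction map, so the
formula is the expansion of `X(a σ(b))`. -/
theorem restrictEquiv_symm_apply (u : GLFUnits K V H) (a b : H) :
    (((restrictEquiv C).symm u : GLF K V (Hc C)) : WithConv (Hc C →ₗ[K] K)) (iota C a * sig C b) =
      ∑ k : V, ((u : (WithConv (H →ₗ[K] K))ˣ) : WithConv (H →ₗ[K] K)) (a * e K k) *
        (((u : (WithConv (H →ₗ[K] K))ˣ)⁻¹ : (WithConv (H →ₗ[K] K))ˣ) :
          WithConv (H →ₗ[K] K)) (b * e K k) := by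
  obtain ⟨X, rfl⟩ := (restrictEquiv C).surjective u
  rw [MulEquiv.symm_apply_apply, apply_iota_mul_sig X.2]
  rfl

end Hc

/-! ### The representation of group-like functionals on `K G¹` -/

section Edge

variable {K V E : Type*} [Field K] {G : OGraph V E}

theorem OGraph.Path.eq_edge {p : G.Path} (h : p.len = 1) : ∃ a, p = edge G a := by
  obtain ⟨s, l, hl⟩ := p
  obtain ⟨a, rfl⟩ := List.length_eq_one_iff.1 h
  exact ⟨a, OGraph.Path.ext hl.1.symm rfl⟩

theorem OGraph.Path.edge_inj {p q : E} : edge G p = edge G q ↔ p = q :=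
  ⟨fun h => (List.cons.inj (congrArg OGraph.Path.edges h)).1, fun h => congrArg _ h⟩

theorem OGraph.Path.edge_len (p q : E) : (edge G p).len = (edge G q).len := rfl

theorem end_ext {S T : Module.End K (E →₀ K)}
    (h : ∀ p q, S (Finsupp.single q 1) p = T (Finsupp.single q 1) p) : S = T :=
  Finsupp.lhom_ext' fun q => LinearMap.ext_ring (Finsupp.ext fun p => h p q)

end Edge

/-! ### Multiplicativity and faithfulness of `X ↦ π(X)`. -/

section PiEdge

variable {K V E : Type*} [Field K] [Fintype V] [DecidableEq V] [Fintype E] {G : OGraph V E}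
  {H : Type*} [Ring H] [Algebra K H] [Coalgebra K H] [FaceAlgebra K V H] {κ : HG K G →ₐ[K] H}

theorem OGraph.sum_ofLen_one {M : Type*} [AddCommMonoid M] (f : G.Path → M) :
    ∑ t ∈ ofLen G 1, f t = ∑ p : E, f (edge G p) := by
  symm
  refine Finset.sum_bij (fun p _ => edge G p) ?_ ?_ ?_ ?_
  · intro p _
    exact mem_ofLen.2 rfl
  · intro p _ q _ h
    exact OGraph.Path.edge_inj.1 h
  · intro p hp
    obtain ⟨a, rfl⟩ := OGraph.Path.eq_edge (mem_ofLen.1 hp)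
    exact ⟨a, Finset.mem_univ _, rfl⟩
  · intros
    rfl

theorem piEdge_single_apply (κ : HG K G →ₐ[K] H) (X : WithConv (H →ₗ[K] K)) (p q : E) :
    piEdge κ X (Finsupp.single q 1) p = X (κ (HG.ee K (edge G p) (edge G q))) := by
  classical
  rw [piEdge_single, Finsupp.finsetSum_apply]
  simp [Finsupp.single_apply]

/-- The elements `e(p; q)` with edges `p`, `q` comultiply like matrix coefficients, so convolution
becomes matrix multiplication. -/
theorem piEdge_mul (hκ : IsFaceMap V κ) (X Y : WithConv (H →ₗ[K] K)) :
    piEdge κ (X * Y) = piEdge κ X * piEdge κ Y := by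
  refine end_ext fun p q => ?_
  rw [Module.End.mul_apply, piEdge_single κ Y, map_sum, Finsupp.finsetSum_apply,
    piEdge_single_apply, conv_apply', hκ.comul_map, HG.comul_ee (OGraph.Path.edge_len p q)]
  -- The length of an edge reduces to `1`, so the coproduct is indexed by the paths of length `1`,
  -- that is, by the edges.
  change TensorProduct.lift _ (TensorProduct.map _ _ (∑ t ∈ ofLen G 1, _)) = _
  rw [OGraph.sum_ofLen_one, map_sum, map_sum]
  refine Finset.sum_congr rfl fun t _ => ?_
  rw [map_smul, Finsupp.smul_apply, piEdge_single_apply]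
  simp [mul_comm]

theorem piEdge_one (hκ : IsFaceMap V κ) : piEdge κ (1 : WithConv (H →ₗ[K] K)) = 1 := by
  classical
  refine end_ext fun p q => ?_
  rw [piEdge_single_apply, LinearMap.convOne_apply, hκ.counit_map, HG.counit_ee (OGraph.Path.edge_len p q),
    Module.End.one_apply, Finsupp.single_apply]
  simp [OGraph.Path.edge_inj, eq_comm]

/-- A group-like functional commutes with the generators of the algebra `E`, hence with all of `E`,
and `π` is multiplicative. -/
theorem piEdge_mem_EndE (hκ : IsFaceMap V κ) {X : WithConv (H →ₗ[K] K)}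
    (hX : IsGroupLike K V H X) : piEdge κ X ∈ EndE κ := by
  have h : dualFace K V H ≤ Subalgebra.centralizer K {X} := by
    refine Algebra.adjoin_le ?_
    rintro _ (⟨i, rfl⟩ | ⟨i, rfl⟩)
    · rintro _ rfl
      exact hX.commute_dualE i
    · rintro _ rfl
      exact hX.commute_dualEo i
  refine Submonoid.mem_centralizer_iff.2 ?_
  rintro _ ⟨Y, hY, rfl⟩
  rw [← piEdge_mul hκ, ← piEdge_mul hκ, h hY X rfl]

/-- `X ↦ π(X)` as a homomorphism. -/
def piHom (hκ : IsFaceMap V κ) : WithConv (H →ₗ[K] K) →* Module.End K (E →₀ K) where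
  toFun := piEdge κ
  map_one' := piEdge_one hκ
  map_mul' := piEdge_mul hκ

/-- Two algebra maps on `H(G)` agree if they agree on vertices and edges. -/
theorem HG.algHom_ext {A : Type*} [Ring A] [Algebra K A] {f g : HG K G →ₐ[K] A}
    (hv : ∀ i j, f (HG.ee K (vert G i) (vert G j)) = g (HG.ee K (vert G i) (vert G j)))
    (he : ∀ p q, f (HG.ee K (edge G p) (edge G q)) = g (HG.ee K (edge G p) (edge G q))) :
    f = g := by
  suffices h : ∀ (n : ℕ) (p q : G.Path), p.len = n → q.len = n →
      f (HG.ee K p q) = g (HG.ee K p q) from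
    AlgHom.toLinearMap_injective (HG.hom_ext fun p q hpq => h _ p q rfl hpq.symm)
  intro n
  induction n with
  | zero =>
    intro p q hp hq
    rw [eq_vert hp, eq_vert hq, hv]
  | succ n ih =>
    intro p q hp hq
    -- Split off the first edge of both paths, so that `e(p; q)` is a product of an edge element and
    -- an element for paths of length `n`.
    obtain ⟨t, u, ht, hu, htu, rfl⟩ := exists_cat p 1 n (by omega)
    obtain ⟨t', u', ht', hu', htu', rfl⟩ := exists_cat q 1 n (by omega)
    obtain ⟨a, rfl⟩ := OGraph.Path.eq_edge ht
    obtain ⟨b, rfl⟩ := OGraph.Path.eq_edge ht'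
    have h := HG.ee_mul_ee (K := K) (ht.trans ht'.symm) (hu.trans hu'.symm)
    rw [if_pos ⟨htu, htu'⟩] at h
    rw [← h, map_mul, map_mul, he, ih _ _ hu hu']

/-- On vertices the matrix representation of a group-like functional is forced, since `e(i; j) = e°
i e j`. On edges its entries are matrix coefficients of `π(X)` or zero. Vertices and edges generate
`H(G)`. -/
theorem isGroupLike_HG_ext {X Y : WithConv (HG K G →ₗ[K] K)}
    (hX : IsGroupLike K V (HG K G) X) (hY : IsGroupLike K V (HG K G) Y)
    (h : piEdge (AlgHom.id K (HG K G)) X = piEdge (AlgHom.id K (HG K G)) Y) : X = Y := by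
  refine hX.ext_rep hY (HG.algHom_ext (fun i j => ?_) fun p q => ?_)
  · rw [← HG.feo_mul_fe, map_mul, map_mul]
    change hX.rep (eo K i) * hX.rep (e K j) = hY.rep (eo K i) * hY.rep (e K j)
    rw [hX.rep_e, hX.rep_eo, hY.rep_e, hY.rep_eo]
  · have h1 := congrArg (fun T : Module.End K (E →₀ K) => T (Finsupp.single q 1) p) h
    simp only [piEdge_single_apply, AlgHom.id_apply] at h1
    ext i j
    have h2 : (e K i * HG.ee K (edge G p) (edge G q) * e K j : HG K G) =
        if i = (edge G q).s ∧ (edge G q).r = j then HG.ee K (edge G p) (edge G q) else 0 := by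
      change HG.fe i * HG.ee K _ _ * HG.fe j = _
      rw [HG.fe_mul_ee i (OGraph.Path.edge_len p q), ite_mul, zero_mul,
        HG.ee_mul_fe j (OGraph.Path.edge_len p q), ite_and]
    rw [IsGroupLike.rep_apply, IsGroupLike.rep_apply, h2]
    split_ifs
    · exact h1
    · rw [map_zero, map_zero]

end PiEdge

/-! ### The representation of `H(G)` given by an endomorphism of `K G¹` -/

section PathRep

variable {K V E : Type*} [Field K]

/-- `T` preserves sources and ranges of edges. -/
def PreservesFaces (G : OGraph V E) (T : Module.End K (E →₀ K)) : Prop :=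
  ∀ p q, T (Finsupp.single q 1) p ≠ 0 → G.src p = G.src q ∧ G.tgt p = G.tgt q

/-- The product of the coefficients of `T` along two lists of edges. -/
def listCoeff (T : Module.End K (E →₀ K)) (l m : List E) : K :=
  (List.zipWith (fun p q => T (Finsupp.single q 1) p) l m).prod

/-- The equal lengths matter: otherwise `zipWith` pairs entries of `l'` with entries of `m`, or
conversely, instead of stopping at the common boundary. -/
theorem listCoeff_append (T : Module.End K (E →₀ K)) {l m : List E} (h : l.length = m.length)
    (l' m' : List E) :
    listCoeff T (l ++ l') (m ++ m') = listCoeff T l m * listCoeff T l' m' := by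
  rw [listCoeff, List.zipWith_append h, List.prod_append]
  rfl

variable {G : OGraph V E} {T : Module.End K (E →₀ K)}

/-- A nonzero product has only nonzero factors, so corresponding edges have equal ranges. For empty
lists both endpoints are the common starting vertex `i`. -/
theorem PreservesFaces.endpt_eq (hT : PreservesFaces G T) (l m : List E) (i : V)
    (hl : l.length = m.length) (h : listCoeff T l m ≠ 0) : G.endpt i l = G.endpt i m := by
  induction l generalizing m i with
  | nil => rw [List.length_eq_zero_iff.1 hl.symm]
  | cons p l ih =>
    obtain _ | ⟨q, m⟩ := m
    · cases hl
    · have h' : T (Finsupp.single q 1) p * listCoeff T l m ≠ 0 := h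
      change G.endpt (G.tgt p) l = G.endpt (G.tgt q) m
      rw [(hT p q (left_ne_zero_of_mul h')).2]
      exact ih m _ (Nat.succ_injective hl) (right_ne_zero_of_mul h')

open Classical in
/-- The coefficient of `p` in the image of `q` under the tensor power of `T`. -/
def pathCoeff (T : Module.End K (E →₀ K)) (p q : G.Path) : K :=
  if p.s = q.s then listCoeff T p.edges q.edges else 0

theorem pathCoeff_ne_zero (hT : PreservesFaces G T) {p q : G.Path} (hl : p.len = q.len)
    (h : pathCoeff T p q ≠ 0) : p.s = q.s ∧ p.r = q.r := by
  by_cases h1 : p.s = q.s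
  · rw [pathCoeff, if_pos h1] at h
    refine ⟨h1, ?_⟩
    rw [r, r, h1]
    exact hT.endpt_eq _ _ _ hl h
  · rw [pathCoeff, if_neg h1] at h
    exact absurd rfl h

/-- The source test in `pathCoeff T t u` has no counterpart on the left-hand side. It is automatic:
if the first factor is nonzero, then `p` and `q` end at the same vertex, so `t` and `u` start at the
same vertex. If the first factor is zero, both sides vanish. -/
theorem pathCoeff_cat (hT : PreservesFaces G T) {p q t u : G.Path} (h : p.len = q.len)
    (hp : p.r = t.s) (hq : q.r = u.s) :
    pathCoeff T (p.cat t) (q.cat u) = pathCoeff T p q * pathCoeff T t u := by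
  by_cases h0 : pathCoeff T p q = 0
  · rw [h0, zero_mul, pathCoeff, cat_s, cat_s]
    split_ifs with h1
    · rw [pathCoeff, if_pos h1] at h0
      rw [cat_edges hp, cat_edges hq, listCoeff_append T h, h0, zero_mul]
    · rfl
  · obtain ⟨h1, h2⟩ := pathCoeff_ne_zero hT h h0
    rw [pathCoeff, cat_s, cat_s, if_pos h1, pathCoeff, if_pos h1, pathCoeff,
      if_pos (hp.symm.trans (h2.trans hq)), cat_edges hp, cat_edges hq, listCoeff_append T h]

/-- The source test loses nothing, because the coefficients of `T` between edges with different
sources already vanish. -/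
theorem pathCoeff_edge (hT : PreservesFaces G T) (p q : E) :
    pathCoeff T (edge G p) (edge G q) = T (Finsupp.single q 1) p := by
  rw [pathCoeff]
  split_ifs with h
  · exact mul_one _
  · by_contra h1
    exact h (hT p q (Ne.symm h1)).1

theorem pathCoeff_path (hT : PreservesFaces G T) (x y : G.G2) :
    pathCoeff T x.path y.path =
      T (Finsupp.single y.1.1 1) x.1.1 * T (Finsupp.single y.1.2 1) x.1.2 := by
  have hx : (edge G x.1.1).r = (edge G x.1.2).s := x.2
  have hy : (edge G y.1.1).r = (edge G y.1.2).s := y.2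
  rw [OGraph.G2.path, OGraph.G2.path, pathCoeff_cat hT (OGraph.Path.edge_len _ _) hx hy,
    pathCoeff_edge hT, pathCoeff_edge hT]

variable [Fintype V] [DecidableEq V]

theorem pathCoeff_vert (i j : V) :
    pathCoeff T (vert G i) (vert G j) = if i = j then 1 else 0 := by
  unfold pathCoeff
  by_cases h : i = j
  · rw [if_pos h]
    exact if_pos h
  · rw [if_neg h]
    exact if_neg h

/-- The representation `e(p; q) ↦ T(p; q) E`, where `T(p; q)` are the matrix coefficients of the
tensor powers of `T`, and `E` is the matrix unit given by the source and the range of `q`. -/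
def pathRepLin (G : OGraph V E) (T : Module.End K (E →₀ K)) : HG K G →ₗ[K] Matrix V V K :=
  HG.lin fun p q => Matrix.single q.s q.r (pathCoeff T p q)

theorem pathRepLin_ee {p q : G.Path} (h : p.len = q.len) :
    pathRepLin G T (HG.ee K p q) = Matrix.single q.s q.r (pathCoeff T p q) := HG.lin_ee _ h

theorem pathRepLin_vert (i j : V) : pathRepLin G T (HG.ee K (vert G i) (vert G j)) =
    if i = j then Matrix.single i i 1 else 0 := by
  rw [pathRepLin_ee (HG.vlen i j), pathCoeff_vert]
  split_ifs with h
  · rw [h]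
    rfl
  · exact Matrix.single_zero _ _

theorem pathRepLin_fe (j : V) : pathRepLin G T (HG.fe j) = Matrix.single j j 1 := by
  rw [HG.fe, map_sum]
  simp [pathRepLin_vert]

theorem pathRepLin_feo (i : V) : pathRepLin G T (HG.feo i) = Matrix.single i i 1 := by
  rw [HG.feo, map_sum]
  simp [pathRepLin_vert]

/-- When both concatenations exist this is multiplicativity of the path coefficients. Otherwise the
product in `H(G)` is zero, and the product of the matrices has to vanish as well. -/
theorem pathRepLin_mul (hT : PreservesFaces G T) (x y : HG K G) :
    pathRepLin G T (x * y) = pathRepLin G T x * pathRepLin G T y := by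
  classical
  induction x using HG.induct with
  | h0 => simp only [zero_mul, map_zero]
  | ha x x' hx hy => simp only [add_mul, map_add, hx, hy]
  | hs c x hx => simp only [smul_mul_assoc, map_smul, hx]
  | hE p q h =>
  induction y using HG.induct with
  | h0 => simp only [mul_zero, map_zero]
  | ha x x' hx hy => simp only [mul_add, map_add, hx, hy]
  | hs c x hx => simp only [mul_smul_comm, map_smul, hx]
  | hE t u h' =>
    rw [HG.ee_mul_ee h h', pathRepLin_ee h, pathRepLin_ee h']
    split_ifs with h1
    · rw [pathRepLin_ee (HG.cat_len_eq h h' h1), pathCoeff_cat hT h h1.1 h1.2, cat_s,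
        cat_r h1.2, h1.2, Matrix.single_mul_single_same]
    · rw [map_zero]
      symm
      -- The matrix units record only the lower paths `q` and `u`. If these concatenate while `p`
      -- and `t` do not, the matrix units do not make the product vanish, and the coefficients must:
      -- were both nonzero, `p` would end where `q` ends and `t` would start where `u` starts.
      by_cases h2 : q.r = u.s
      · rw [h2, Matrix.single_mul_single_same]
        suffices pathCoeff T p q * pathCoeff T t u = 0 by rw [this, Matrix.single_zero]
        by_contra h3
        have h4 := pathCoeff_ne_zero hT h (left_ne_zero_of_mul h3)
        have h5 := pathCoeff_ne_zero hT h' (right_ne_zero_of_mul h3)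
        exact h1 ⟨h4.2.trans (h2.trans h5.1.symm), h2⟩
      · exact Matrix.single_mul_single_of_ne _ _ _ _ h2 _

variable [Fintype E]

/-- The representation `pathRepLin` as an algebra map. -/
def pathRep (hT : PreservesFaces G T) : HG K G →ₐ[K] Matrix V V K :=
  AlgHom.ofLinearMap (pathRepLin G T)
    (by
      rw [← sum_e (K := K) (V := V) (H := HG K G), map_sum]
      change ∑ j : V, pathRepLin G T (HG.fe j) = 1
      simp_rw [pathRepLin_fe]
      exact Matrix.sum_single_one)
    (pathRepLin_mul hT)

theorem pathRep_ee (hT : PreservesFaces G T) {p q : G.Path} (h : p.len = q.len) :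
    pathRep hT (HG.ee K p q) = Matrix.single q.s q.r (pathCoeff T p q) := pathRepLin_ee h

theorem pathRep_e (hT : PreservesFaces G T) (i : V) :
    pathRep hT (e K i) = Matrix.single i i 1 := pathRepLin_fe i

theorem pathRep_eo (hT : PreservesFaces G T) (i : V) :
    pathRep hT (eo K i) = Matrix.single i i 1 := pathRepLin_feo i

/-- The group-like functional on `H(G)` given by `T`. -/
def pathGlf (hT : PreservesFaces G T) : WithConv (HG K G →ₗ[K] K) :=
  toConv (entrySum K V ∘ₗ (pathRep hT).toLinearMap)

theorem isGroupLike_pathGlf (hT : PreservesFaces G T) :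
    IsGroupLike K V (HG K G) (pathGlf hT) :=
  isGroupLike_entrySum _ (pathRep_e hT) (pathRep_eo hT)

theorem pathGlf_ee (hT : PreservesFaces G T) {p q : G.Path} (h : p.len = q.len) :
    pathGlf hT (HG.ee K p q) = pathCoeff T p q := by
  change entrySum K V (pathRep hT (HG.ee K p q)) = _
  rw [pathRep_ee hT h, entrySum_single]

theorem piEdge_pathGlf (hT : PreservesFaces G T) :
    piEdge (AlgHom.id K (HG K G)) (pathGlf hT) = T := by
  refine end_ext fun p q => ?_
  rw [piEdge_single_apply, AlgHom.id_apply, pathGlf_ee hT (by rfl), pathCoeff_edge hT]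

variable (K G) in
/-- `X ↦ π(X)` as a homomorphism from `GLF(H(G))` to `End_{π(E)} (K G¹)`. -/
def glfHG : GLF K V (HG K G) →* EndE (AlgHom.id K (HG K G)) :=
  ((piHom (isFaceMap_id K V (HG K G))).comp (GLF K V (HG K G)).subtype).codRestrict _
    fun X => piEdge_mem_EndE (isFaceMap_id K V (HG K G)) X.2

/-- Injectivity holds because edges and vertices generate. The preimage of `T` is the entry sum of
the representation built from the tensor powers of `T`. -/
theorem glfHG_bijective : Function.Bijective (glfHG K G) := by
  refine ⟨fun X Y h => Subtype.ext (isGroupLike_HG_ext X.2 Y.2 (congrArg Subtype.val h)),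
    fun T => ?_⟩
  -- Commuting with the projections `π(ε(· e k))` and `π(ε(e k ·))` onto the edges with given range
  -- or source forces `T` to preserve both.
  have hT : PreservesFaces G T.1 := fun p q =>
    EndE_face (κ := AlgHom.id K (HG K G)) (fun _ => rfl) (fun _ => rfl) T.2
  exact ⟨⟨_, isGroupLike_pathGlf hT⟩, Subtype.ext (piEdge_pathGlf hT)⟩

end PathRep

/-! ### Group-like functionals on `A(w)` -/

namespace FaceModel

variable {K V E : Type*} [Field K] [Fintype V] [DecidableEq V] [Fintype E] {G : OGraph V E}

theorem projT_tmul_apply (a b : E →₀ K) (x : G.G2) :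
    projT K G (a ⊗ₜ b) x = a x.1.1 * b x.1.2 := by
  classical
  induction a using Finsupp.induction_linear with
  | zero => simp
  | add a a' h h' => rw [add_tmul, map_add, Finsupp.add_apply, h, h', Finsupp.add_apply, add_mul]
  | single p c =>
    induction b using Finsupp.induction_linear with
    | zero => simp
    | add a a' h h' => rw [tmul_add, map_add, Finsupp.add_apply, h, h', Finsupp.add_apply, mul_add]
    | single q d =>
      simp only [projT, lift.tmul, Finsupp.linearCombination_single, LinearMap.smul_apply]
      obtain ⟨⟨p', q'⟩, hx⟩ := x
      by_cases h : G.tgt p = G.src q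
      · rw [dif_pos h]
        simp [Finsupp.single_apply, ← ite_and, and_comm]
      · rw [dif_neg h]
        simp only [smul_zero, Finsupp.coe_zero, Pi.zero_apply]
        -- The edges of `x` form a path and `(p, q)` do not, so at least one of the two edges
        -- differs and the product of coefficients is zero.
        by_cases hp : p = p'
        · by_cases hq : q = q'
          · subst hp hq
            exact absurd hx h
          · simp [hq]
        · simp [hp]

theorem barT_single_apply (T : Module.End K (E →₀ K)) (x y : G.G2) :
    barT G T (Finsupp.single y 1) x =
      T (Finsupp.single y.1.1 1) x.1.1 * T (Finsupp.single y.1.2 1) x.1.2 := by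
  simp only [barT, LinearMap.comp_apply, inclT, Finsupp.linearCombination_single, one_smul,
    map_tmul, projT_tmul_apply]

variable (M : FaceModel K G)

theorem op_apply (v : G.G2 →₀ K) (x : G.G2) : M.op v x = ∑ y : G.G2, v y * M.coeff x y := by
  classical
  rw [op, Finsupp.linearCombination_apply, Finsupp.sum_fintype _ _ (by simp),
    Finsupp.finsetSum_apply]
  refine Finset.sum_congr rfl fun y _ => ?_
  rw [Finsupp.smul_apply, Finsupp.finsetSum_apply]
  simp [Finsupp.single_apply]

theorem op_single (y : G.G2) :
    M.op (Finsupp.single y 1) = ∑ x : G.G2, M.coeff x y • Finsupp.single x 1 := by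
  simp [op]

/-- `(T ⊗̄ T) w = w (T ⊗̄ T)` in terms of matrix coefficients. -/
theorem barT_comm_iff (T : Module.End K (E →₀ K)) :
    barT G T * M.op = M.op * barT G T ↔ ∀ x y : G.G2,
      ∑ c : G.G2, M.coeff x c * barT G T (Finsupp.single y 1) c =
        ∑ z : G.G2, M.coeff z y * barT G T (Finsupp.single z 1) x := by
  have h1 : ∀ x y, (barT G T * M.op) (Finsupp.single y 1) x =
      ∑ z : G.G2, M.coeff z y * barT G T (Finsupp.single z 1) x := fun x y => by
    rw [Module.End.mul_apply, op_single, map_sum, Finsupp.finsetSum_apply]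
    simp only [map_smul, Finsupp.smul_apply, smul_eq_mul]
  have h2 : ∀ x y, (M.op * barT G T) (Finsupp.single y 1) x =
      ∑ c : G.G2, M.coeff x c * barT G T (Finsupp.single y 1) c := fun x y => by
    rw [Module.End.mul_apply, op_apply]
    simp only [mul_comm]
  constructor
  · intro h x y
    rw [← h1, ← h2, h]
  · intro h
    refine end_ext fun x y => ?_
    rw [h1, h2, h]

theorem isFaceMap_proj : IsFaceMap V M.proj where
  map_e := M.proj_e
  map_eo := M.proj_eo
  counit_map := M.counit_proj
  comul_map := M.comul_proj

variable {M} {T : Module.End K (E →₀ K)}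

/-- Both sides of the relation for `x`, `y` become multiples of one matrix unit, and equality of the
two scalars is the `(x, y)` matrix coefficient of the commutation of `T ⊗̄ T` with `w`. -/
theorem pathRep_rel (hT : PreservesFaces G T) (h : barT G T * M.op = M.op * barT G T)
    ⦃a b : HG K G⦄ (hab : M.Rel a b) : pathRep (V := V) hT a = pathRep hT b := by
  obtain ⟨x, y⟩ := hab
  have h1 : ∀ z z' : G.G2, pathRep (V := V) hT (HG.ee K z.path z'.path) =
      Matrix.single z'.path.s z'.path.r (barT G T (Finsupp.single z' 1) z) := fun z z' => by
    rw [pathRep_ee hT (z.path_len.trans z'.path_len.symm), pathCoeff_path hT, barT_single_apply]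
  -- On the right-hand side of the relation the matrix unit depends on `z`. The face condition of
  -- the model makes `z` and `y` have the same source and range whenever the weight is nonzero.
  have h2 : ∀ z : G.G2, M.coeff z y • Matrix.single z.path.s z.path.r
      (barT G T (Finsupp.single z 1) x) = Matrix.single y.path.s y.path.r
        (M.coeff z y * barT G T (Finsupp.single z 1) x) := fun z => by
    by_cases h0 : M.coeff z y = 0
    · rw [h0, zero_smul, zero_mul, Matrix.single_zero]
    · rw [(M.coeff_face h0).1, (M.coeff_face h0).2, Matrix.smul_single, smul_eq_mul]
  simp only [map_sum, map_smul, h1, h2]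
  simp only [Matrix.smul_single, smul_eq_mul]
  have h3 := congrArg (Matrix.singleAddMonoidHom y.path.s y.path.r) ((M.barT_comm_iff T).1 h x y)
  rw [map_sum, map_sum] at h3
  exact h3

theorem piEdge_pull (X : WithConv (M.A →ₗ[K] K)) :
    piEdge (AlgHom.id K (HG K G)) (pull M.proj X) = piEdge M.proj X := by
  refine end_ext fun p q => ?_
  rw [piEdge_single_apply, piEdge_single_apply]
  rfl

theorem preservesFaces_piEdge {X : WithConv (M.A →ₗ[K] K)} (hX : IsGroupLike K V M.A X) :
    PreservesFaces G (piEdge M.proj X) := fun _ _ =>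
  EndE_face M.proj_e M.counit_proj (piEdge_mem_EndE M.isFaceMap_proj hX)

/-- Both functionals on `H(G)` have the same image under `π`, which is injective on group-like
functionals. This expresses the values of `X` on paths of any length through `π(X)` alone. -/
theorem pull_proj_eq {X : WithConv (M.A →ₗ[K] K)} (hX : IsGroupLike K V M.A X) :
    pull M.proj X = pathGlf (preservesFaces_piEdge hX) := by
  refine isGroupLike_HG_ext (hX.pull M.isFaceMap_proj) (isGroupLike_pathGlf _) ?_
  rw [piEdge_pull, piEdge_pathGlf]

/-- On paths of length two `X` takes the matrix coefficients of `π(X) ⊗̄ π(X)` as values, so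
applying `X` to the defining relations of `A(w)` gives the commutation with `w` coefficient by
coefficient. -/
theorem piEdge_mem_CommEnd {X : WithConv (M.A →ₗ[K] K)} (hX : IsGroupLike K V M.A X) :
    piEdge M.proj X ∈ M.CommEnd := by
  refine ⟨piEdge_mem_EndE M.isFaceMap_proj hX, (M.barT_comm_iff _).2 fun x y => ?_⟩
  have h1 : ∀ z z' : G.G2, X (M.proj (HG.ee K z.path z'.path)) =
      barT G (piEdge M.proj X) (Finsupp.single z' 1) z := fun z z' => by
    rw [← pull_apply, pull_proj_eq hX, pathGlf_ee _ (z.path_len.trans z'.path_len.symm),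
      pathCoeff_path (preservesFaces_piEdge hX), barT_single_apply]
  have h2 : M.proj _ = M.proj _ := RingQuot.mkAlgHom_rel K (Rel.of (M := M) x y)
  have h3 := congrArg X.ofConv h2
  simpa only [map_sum, map_smul, smul_eq_mul, h1] using h3

/-! ### The isomorphisms for `A(w)` and for its invertible functionals. -/

variable (M)

/-- `X ↦ π(X)` as a homomorphism from `GLF(A(w))`. -/
def glfA : GLF K V M.A →* M.CommEnd :=
  ((piHom M.isFaceMap_proj).comp (GLF K V M.A).subtype).codRestrict _
    fun X => piEdge_mem_CommEnd X.2

/-- Injectivity is inherited from `H(G)`, since a functional on a quotient is determined by its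
pullback. For surjectivity, the representation of `H(G)` attached to `T` descends to `A(w)` because
`T` commutes with `w`. -/
theorem glfA_bijective : Function.Bijective M.glfA := by
  constructor
  · intro X Y h
    have hX : IsGroupLike K V M.A X.1 := X.2
    have hY : IsGroupLike K V M.A Y.1 := Y.2
    have h1 : piEdge M.proj X.1 = piEdge M.proj Y.1 := congrArg Subtype.val h
    rw [← piEdge_pull, ← piEdge_pull] at h1
    have h2 := isGroupLike_HG_ext (hX.pull M.isFaceMap_proj) (hY.pull M.isFaceMap_proj) h1
    refine Subtype.ext (WithConv.ext (LinearMap.ext fun a => ?_))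
    obtain ⟨a, rfl⟩ := RingQuot.mkAlgHom_surjective K M.Rel a
    exact congrArg (fun X => X.ofConv a) h2
  · rintro ⟨T, hT, hc⟩
    have hT' : PreservesFaces G T := fun p q => EndE_face M.proj_e M.counit_proj hT
    let ρ : M.A →ₐ[K] Matrix V V K := RingQuot.liftAlgHom K ⟨pathRep hT', pathRep_rel hT' hc⟩
    have hρ : ∀ a, ρ (M.proj a) = pathRep hT' a := fun a =>
      RingQuot.liftAlgHom_mkAlgHom_apply K _ _ a
    have hg := isGroupLike_entrySum ρ (fun i => by rw [← M.proj_e, hρ, pathRep_e])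
      (fun i => by rw [← M.proj_eo, hρ, pathRep_eo])
    refine ⟨⟨_, hg⟩, Subtype.ext ?_⟩
    change piEdge M.proj _ = T
    rw [← piEdge_pull, ← piEdge_pathGlf hT']
    congr 1
    refine WithConv.ext (LinearMap.ext fun a => ?_)
    exact congrArg (entrySum K V) (hρ a)

/-- The isomorphism of `GLF(A(w))` onto the endomorphisms that commute with `w`. -/
def glfAEquiv : GLF K V M.A ≃* M.CommEnd := MulEquiv.ofBijective M.glfA M.glfA_bijective

theorem glfAEquiv_apply (X : GLF K V M.A) :
    (M.glfAEquiv X : Module.End K (E →₀ K)) = piEdge M.proj (X : WithConv (M.A →ₗ[K] K)) := rfl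

/-- `u ↦ π(u)` as a homomorphism from `GLF(A(w))^×`. -/
def glfUnitsA : GLFUnits K V M.A →* M.CommAut :=
  ((Units.map (piHom M.isFaceMap_proj)).comp (GLFUnits K V M.A).subtype).codRestrict _
    fun u => piEdge_mem_CommEnd u.2

/-- On both sides the group consists of those units of the ambient algebra that lie in the
submonoid, and it is closed under inverses. It is therefore the unit group of the submonoid, and the
isomorphism `glfAEquiv` of monoids carries units to units. -/
theorem glfUnitsA_bijective : Function.Bijective M.glfUnitsA := by
  constructor
  · intro u v h
    have h1 : M.glfAEquiv ⟨u.1.1, u.2⟩ = M.glfAEquiv ⟨v.1.1, v.2⟩ :=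
      Subtype.ext (congrArg (fun T : M.CommAut => T.1.1) h)
    exact Subtype.ext (Units.ext (congrArg Subtype.val (M.glfAEquiv.injective h1)))
  · intro T
    -- `T` as a unit of the submonoid itself: its inverse again commutes with `π(E)` and with `w`,
    -- because `CommAut` is a subgroup.
    let S : M.CommEndˣ := ⟨⟨T.1.1, T.2⟩, ⟨T⁻¹.1.1, T⁻¹.2⟩, Subtype.ext T.1.mul_inv,
      Subtype.ext T.1.inv_mul⟩
    let X : (GLF K V M.A)ˣ := Units.map M.glfAEquiv.symm.toMonoidHom S
    refine ⟨⟨Units.map (GLF K V M.A).subtype X, X.1.2⟩, Subtype.ext (Units.ext ?_)⟩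
    exact congrArg Subtype.val (M.glfAEquiv.apply_symm_apply S.1)

/-- The isomorphism of `GLF(A(w))^×` onto the automorphisms that commute with `w`. -/
def glfUnitsAEquiv : GLFUnits K V M.A ≃* M.CommAut :=
  MulEquiv.ofBijective M.glfUnitsA M.glfUnitsA_bijective

theorem glfUnitsAEquiv_apply (u : GLFUnits K V M.A) :
    ((M.glfUnitsAEquiv u : (Module.End K (E →₀ K))ˣ) : Module.End K (E →₀ K)) =
      piEdge M.proj ((u : (WithConv (M.A →ₗ[K] K))ˣ) : WithConv (M.A →ₗ[K] K)) := rfl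

end FaceModel

end

end FaceAlg

theorem mainTheorem6 {K V : Type*} [Field K] [Fintype V] [DecidableEq V] [Nonempty V] :
    (∀ {H : Type*} [Ring H] [Algebra K H] [Coalgebra K H] [FaceAlgebra K V H] (C : CCQT K V H),
      ∃ f : GLF K V (Hc C) ≃* GLFUnits K V H,
        (∀ (X : GLF K V (Hc C)) (a : H), ((f X : (WithConv (H →ₗ[K] K))ˣ) : WithConv (H →ₗ[K] K)) a =
          (X : WithConv (Hc C →ₗ[K] K)) (Hc.iota C a)) ∧
        ∀ (u : GLFUnits K V H) (a b : H),
          (f.symm u : WithConv (Hc C →ₗ[K] K)) (Hc.iota C a * Hc.sig C b) =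
            ∑ k : V, ((u : (WithConv (H →ₗ[K] K))ˣ) : WithConv (H →ₗ[K] K)) (a * e K k) *
              (((u : (WithConv (H →ₗ[K] K))ˣ)⁻¹ : (WithConv (H →ₗ[K] K))ˣ) :
                WithConv (H →ₗ[K] K)) (b * e K k)) ∧
    (∀ {E : Type*} [Fintype E] (G : OGraph V E),
      (∃ f : GLF K V (HG K G) ≃* EndE (AlgHom.id K (HG K G)),
        ∀ X : GLF K V (HG K G), (f X : Module.End K (E →₀ K)) =
          piEdge (AlgHom.id K (HG K G)) (X : WithConv (HG K G →ₗ[K] K))) ∧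
      ∀ M : FaceModel K G,
        (∃ f : GLF K V M.A ≃* M.CommEnd, ∀ X : GLF K V M.A,
          (f X : Module.End K (E →₀ K)) = piEdge M.proj (X : WithConv (M.A →ₗ[K] K))) ∧
        ∀ C : CCQT K V M.A, ∃ Φ : M.CommAut ≃* GLF K V (Hc C), ∀ T : M.CommAut,
          piEdge M.proj (WithConv.toConv
            ((Φ T : WithConv (Hc C →ₗ[K] K)).ofConv ∘ₗ (Hc.iota C).toLinearMap)) =
          ((T : (Module.End K (E →₀ K))ˣ) : Module.End K (E →₀ K))) := by
  refine ⟨fun C => ⟨Hc.restrictEquiv C, fun _ _ => rfl, Hc.restrictEquiv_symm_apply C⟩,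
    fun G => ⟨⟨MulEquiv.ofBijective (glfHG K G) glfHG_bijective, fun _ => rfl⟩, fun M =>
      ⟨⟨M.glfAEquiv, M.glfAEquiv_apply⟩, fun C =>
        ⟨((Hc.restrictEquiv C).trans M.glfUnitsAEquiv).symm, fun T => ?_⟩⟩⟩⟩
  -- `Φ` is the inverse of restriction along `ι` followed by `π`, so the required identity says that
  -- this composite, applied to `Φ(T)`, returns `T`.
  have h := M.glfUnitsAEquiv_apply
    (Hc.restrictEquiv C (((Hc.restrictEquiv C).trans M.glfUnitsAEquiv).symm T))
  rw [← MulEquiv.trans_apply, MulEquiv.apply_symm_apply] at h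
  exact h.symm
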